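/- Conventions. Metrics are in the "mostly minus" convention: Lorentzian metrics have signature $(+,-,\dots,-)$ and Riemannian metrics are negative definite. For $k$-forms $\langle\alpha,\beta\rangle=\frac1{k!}\alpha_{i_1\dots i_k}\beta_{j_1\dots j_k}g^{i_1j_1}\cdots g^{i_kj_k}$, $\|\alpha\|^2=\langle\alpha,\alpha\rangle$, and the Hodge star of an oriented pseudo-Riemannian manifold is defined by $\alpha\wedge\star\beta=\langle\alpha,\beta\rangle\,\mathrm{vol}$. A triple $(X^{1,10},h,F)$, with $h$ a Lorentzian metric on an oriented $11$-manifold and $F\in\Omega^4(X)$, is a bosonic supergravity background if $$dF=0,\qquad d\star F=\tfrac12F\wedge F,\qquad \mathrm{Ric}_h(Y,Z)=-\tfrac12\langle Y\lrcorner F,Z\lrcorner F\rangle_h+\tfrac16h(Y,Z)\|F\|_h^2 .$$ Setting. Let $(M^6,g)$ be an oriented Ricci-flat Riemannian manifold. Let $N^3$ be an oriented $3$-manifold with a smooth family $\rho=\rho_u$ ($u\in\mathbb R$) of Ricci-flat Riemannian metrics such that, with $\theta=\rho^{-1}\partial_u\rho\in\Gamma(\mathrm{End}\,TN)$, $$\mathrm{div}_\rho\,\theta=d_N(\mathrm{tr}\,\theta),\qquad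 \partial_u(\mathrm{tr}\,\theta)+\tfrac12\mathrm{tr}(\theta^2)=0;$$ both conditions hold automatically if $\rho$ does not depend on $u$. Let $H=H(u,x)$ and $f=f(u,x)$ be smooth functions on $\mathbb R\times N$. Put $\widetilde M=\mathbb R\times N\times\mathbb R$ (with points $(u,x,v)$), $\tilde g=2\,du\,dv+\rho+H\,du^2$, $X=\widetilde M\times M$ with some orientation, and $h=\tilde g+g$. For a nonzero constant $\lambda$ put $$\tilde\alpha=du\wedge f\,\mathrm{vol}_\rho,\qquad \omega(u)=-\tfrac1\lambda\star_\rho d_Nf,\qquad \tilde\beta=du\wedge\omega(u),$$ where $d_N$ is the exterior derivative on $N$ at fixed $u$. Let $\Delta_\rho H=\rho^{ij}(\partial_i\partial_jH-\Gamma_{ij}^k\partial_kH)$ be the Laplace–Beltrami operator of $\rho$. (1) Let $\kappa,\lambda$ be nonzero constants and $\varphi$ a smooth function on $M$ with $\star_6d\star_6d\varphi=\kappa\lambda\varphi$; put $\nu=\frac1\kappa d\varphi$, and suppose $\star_\rho d_N\star_\rho d_Nf=\kappa\lambda f$. Then $(X,h,F)$ with $F=\varphi\tilde\alpha+\tilde\beta\wedge\nu$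 is a bosonic supergravity background if and only if $$\Delta_\rho H=\|\omega(u)\|_\rho^2\,\|\nu\|_g^2-f^2\varphi^2\quad\text{on } X .$$ (2) Let $\nu$ be a closed $1$-form on $M$ with $\star_6d\star_6\nu=\lambda$ for a constant $\lambda\ne0$, and suppose $\star_\rho d_N\star_\rho d_Nf=0$. Then $(X,h,F)$ with $F=\tilde\alpha+\tilde\beta\wedge\nu$ is a bosonic supergravity background if and only if $$\Delta_\rho H=\|\omega(u)\|_\rho^2\,\|\nu\|_g^2-f^2\quad\text{on } X .$$ If it is a bosonic supergravity background and $\omega$ is not identically zero, then $\|\nu\|_g^2$ is constant. -/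

import Mathlib

open scoped Manifold ContDiff

noncomputable section

namespace Sugra

/-! ### Linear algebra of alternating forms on a finite-dimensional space with a metric -/

section Algebra

variable {V : Type*} [AddCommGroup V] [Module ℝ V] [TopologicalSpace V]

/-- The interior product `v ⌟ η`. -/
def iprod {k : ℕ} (v : V) (η : V [⋀^Fin (k + 1)]→L[ℝ] ℝ) : V [⋀^Fin k]→L[ℝ] ℝ :=
  { η.toAlternatingMap.curryLeft v with
    cont := η.cont.comp (continuous_const.finCons continuous_id) }

/-- Insertion of `k` vectors into the first slots: `w ↦ η (v 0, …, v (k - 1), w)`. -/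
def interiorMany {m : ℕ} : {k : ℕ} → (Fin k → V) → V [⋀^Fin (m + k)]→L[ℝ] ℝ → V [⋀^Fin m]→L[ℝ] ℝ
  | 0, _, η => η
  | k + 1, v, η => interiorMany (m := m) (k := k) (Fin.tail v) (iprod (k := m + k) (v 0) η)

/-- The tensor product of two forms, `(v, w) ↦ α v * β w`. -/
def tensor {k l : ℕ} (α : V [⋀^Fin k]→L[ℝ] ℝ) (β : V [⋀^Fin l]→L[ℝ] ℝ) :
    ContinuousMultilinearMap ℝ (fun _ : Fin (k + l) => V) ℝ :=
  { ((LinearMap.mul' ℝ ℝ).compMultilinearMap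
        (MultilinearMap.domCoprod α.toMultilinearMap β.toMultilinearMap)).domDomCongr
      finSumFinEquiv with
    cont := by
      refine Continuous.mul (α.cont.comp ?_) (β.cont.comp ?_)
      · exact continuous_pi fun i => continuous_apply _
      · exact continuous_pi fun i => continuous_apply _ }

theorem tensor_apply {k l : ℕ} (α : V [⋀^Fin k]→L[ℝ] ℝ) (β : V [⋀^Fin l]→L[ℝ] ℝ)
    (v : Fin (k + l) → V) :
    tensor α β v = α (fun i => v (Fin.castAdd l i)) * β (fun i => v (Fin.natAdd k i)) := rfl

/-- The one-form given by a covector. -/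
def oneForm (ξ : V →L[ℝ] ℝ) : V [⋀^Fin 1]→L[ℝ] ℝ :=
  ContinuousAlternatingMap.ofSubsingleton ℝ V ℝ (0 : Fin 1) ξ

/-- `vol` is one of the two volume forms of the metric `g` on the `n`-dimensional space `V`, i.e.
`vol (v₁, …, vₙ)² = |det (g (vᵢ, vⱼ))|`. -/
def IsVolumeForm {n : ℕ} (g : V →L[ℝ] V →L[ℝ] ℝ) (vol : V [⋀^Fin n]→L[ℝ] ℝ) : Prop :=
  ∀ v : Fin n → V, vol v ^ 2 = |(Matrix.of fun i j => g (v i) (v j)).det|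

/-- `g` is symmetric and negative definite: a Riemannian metric in the mostly minus convention. -/
def IsNegDef (g : V →L[ℝ] V →L[ℝ] ℝ) : Prop :=
  (∀ v w, g v w = g w v) ∧ ∀ v, v ≠ 0 → g v v < 0

variable [IsTopologicalAddGroup V] [ContinuousSMul ℝ V]

/-- The wedge product
`(α ∧ β) (v₁, …) = 1 / (k! l!) ∑ σ, sign σ * α (v_σ(1), …, v_σ(k)) * β (v_σ(k+1), …)`. -/
def wedge {k l : ℕ} (α : V [⋀^Fin k]→L[ℝ] ℝ) (β : V [⋀^Fin l]→L[ℝ] ℝ) :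
    V [⋀^Fin (k + l)]→L[ℝ] ℝ :=
  ((k.factorial : ℝ) * (l.factorial : ℝ))⁻¹ • ContinuousMultilinearMap.alternatization (tensor α β)

variable [T2Space V] [FiniteDimensional ℝ V]

/-- A basis `b i` of `V`. -/
def bas (V : Type*) [AddCommGroup V] [Module ℝ V] [FiniteDimensional ℝ V] :
    Module.Basis (Fin (Module.finrank ℝ V)) ℝ V :=
  Module.finBasis ℝ V

/-- The `g`-dual basis `b♯ i = ∑ j, g^{ij} b j`, characterized by `g (b♯ i) (b j) = δ i j`. -/
def dualBas (g : V →L[ℝ] V →L[ℝ] ℝ) (i : Fin (Module.finrank ℝ V)) : V :=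
  g.inverse (LinearMap.toContinuousLinearMap ((bas V).coord i))

/-- The trace of a linear endomorphism. -/
def trc (A : V → V) : ℝ := ∑ i, (bas V).coord i (A (bas V i))

/-- `⟨α, β⟩_g = 1 / k! ∑ α_{i₁…i_k} β_{j₁…j_k} g^{i₁j₁} ⋯ g^{i_kj_k}`. -/
def formInner {k : ℕ} (g : V →L[ℝ] V →L[ℝ] ℝ) (α β : V [⋀^Fin k]→L[ℝ] ℝ) : ℝ :=
  (k.factorial : ℝ)⁻¹ * ∑ J : Fin k → Fin (Module.finrank ℝ V),
    α (fun a => bas V (J a)) * β (fun a => dualBas g (J a))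

/-- The Hodge hodge `(⋆β)_{j…} = 1 / k! ∑ β^{i₁…i_k} vol_{i₁…i_k j…}`, that is
`α ∧ ⋆β = ⟨α, β⟩ vol`. -/
def hodge {k m : ℕ} (g : V →L[ℝ] V →L[ℝ] ℝ) (vol : V [⋀^Fin (m + k)]→L[ℝ] ℝ)
    (β : V [⋀^Fin k]→L[ℝ] ℝ) : V [⋀^Fin m]→L[ℝ] ℝ :=
  (k.factorial : ℝ)⁻¹ • ∑ J : Fin k → Fin (Module.finrank ℝ V),
    β (fun a => dualBas g (J a)) • interiorMany (fun a => bas V (J a)) vol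

end Algebra

/-! ### Pseudo-Riemannian geometry of a metric `G` on an open subset of a vector space `E` -/

section Local

variable {E : Type*} [NormedAddCommGroup E] [NormedSpace ℝ E]

/-- The Christoffel symbols: `Γ_y (v, w)` is the vector with
`G (Γ (v, w), z) = 1/2 ((∂_v G) (w, z) + (∂_w G) (v, z) - (∂_z G) (v, w))` for all `z`. -/
def christoffel (G : E → E →L[ℝ] E →L[ℝ] ℝ) (y v w : E) : E :=
  (G y).inverse ((1 / 2 : ℝ) •
    (fderiv ℝ G y v w + fderiv ℝ G y w v - ((fderiv ℝ G y).flip v).flip w))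

/-- The curvature `R (z, v) w`. -/
def curvature (G : E → E →L[ℝ] E →L[ℝ] ℝ) (y z v w : E) : E :=
  fderiv ℝ (fun y' => christoffel G y' v w) y z - fderiv ℝ (fun y' => christoffel G y' z w) y v
    + christoffel G y z (christoffel G y v w) - christoffel G y v (christoffel G y z w)

variable [FiniteDimensional ℝ E]

/-- The Ricci tensor `Ric (v, w) = tr (z ↦ R (z, v) w)`. -/
def ricciLoc (G : E → E →L[ℝ] E →L[ℝ] ℝ) (y v w : E) : ℝ := trc fun z => curvature G y z v w

/-- The Laplace–Beltrami operator `G^{ij} (∂_i ∂_j φ - Γ_{ij}^k ∂_k φ)`. -/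
def laplaceLoc (G : E → E →L[ℝ] E →L[ℝ] ℝ) (φ : E → ℝ) (y : E) : ℝ :=
  ∑ i, (fderiv ℝ (fderiv ℝ φ) y (bas E i) (dualBas (G y) i)
    - fderiv ℝ φ y (christoffel G y (bas E i) (dualBas (G y) i)))

/-- For a one-parameter family `G u` of metrics, the endomorphism field `θ = G⁻¹ ∂_u G`. -/
def thetaLoc (G : ℝ → E → E →L[ℝ] E →L[ℝ] ℝ) (u : ℝ) (y : E) : E →L[ℝ] E :=
  (G u y).inverse ∘L deriv (fun s => G s y) u

/-- The divergence `∇_k θ^k_w` of `θ` with respect to the metric `G u`. -/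
def divThetaLoc (G : ℝ → E → E →L[ℝ] E →L[ℝ] ℝ) (u : ℝ) (y w : E) : ℝ :=
  trc fun z => fderiv ℝ (fun y' => thetaLoc G u y' w) y z
    + christoffel (G u) y z (thetaLoc G u y w) - thetaLoc G u y (christoffel (G u) y z w)

end Local

/-! ### Tensor fields on (boundaryless) manifolds -/

section Manifold

variable {E H : Type*} [NormedAddCommGroup E] [NormedSpace ℝ E] [TopologicalSpace H]
  (I : ModelWithCorners ℝ E H) {M : Type*} [TopologicalSpace M] [ChartedSpace H M]

instance (x : M) : T2Space (TangentSpace I x) := inferInstanceAs (T2Space E)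

instance [FiniteDimensional ℝ E] (x : M) : FiniteDimensional ℝ (TangentSpace I x) :=
  inferInstanceAs (FiniteDimensional ℝ E)

variable (M) in
/-- Fields of bilinear forms. -/
abbrev BilinField := ∀ x : M, TangentSpace I x →L[ℝ] TangentSpace I x →L[ℝ] ℝ

variable (M) in
/-- Fields of alternating `k`-forms. -/
abbrev FormField (k : ℕ) := ∀ x : M, TangentSpace I x [⋀^Fin k]→L[ℝ] ℝ

/-- The differential at `y` of the inverse of the preferred chart at `x₀`. -/
def chartInvDeriv (x₀ : M) (y : E) : E →L[ℝ] TangentSpace I ((extChartAt I x₀).symm y) :=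
  mfderiv 𝓘(ℝ, E) I (extChartAt I x₀).symm y ∘L
    ((NormedSpace.fromTangentSpace (𝕜 := ℝ) y).symm : E →L[ℝ] TangentSpace 𝓘(ℝ, E) y)

/-- A field of bilinear forms in the chart at `x₀`. -/
def bilinRep (g : BilinField I M) (x₀ : M) (y : E) : E →L[ℝ] E →L[ℝ] ℝ :=
  ContinuousLinearMap.precomp ℝ (chartInvDeriv I x₀ y) ∘L
    g ((extChartAt I x₀).symm y) ∘L chartInvDeriv I x₀ y

/-- A form in the chart at `x₀`. -/
def formRep {k : ℕ} (η : FormField I M k) (x₀ : M) (y : E) : E [⋀^Fin k]→L[ℝ] ℝ :=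
  (η ((extChartAt I x₀).symm y)).compContinuousLinearMap (chartInvDeriv I x₀ y)

def SmoothBilin (g : BilinField I M) : Prop :=
  ∀ x₀, ContDiffOn ℝ ∞ (bilinRep I g x₀) (extChartAt I x₀).target

def SmoothForm {k : ℕ} (η : FormField I M k) : Prop :=
  ∀ x₀, ContDiffOn ℝ ∞ (formRep I η x₀) (extChartAt I x₀).target

/-- Smoothness of a family `g u`, jointly in the parameter and the point. -/
def SmoothBilinFamily (g : ℝ → BilinField I M) : Prop :=
  ∀ x₀, ContDiffOn ℝ ∞ (fun p : ℝ × E => bilinRep I (g p.1) x₀ p.2)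
    (Set.univ ×ˢ (extChartAt I x₀).target)

/-- Smoothness of a family `η u`, jointly in the parameter and the point. -/
def SmoothFormFamily {k : ℕ} (η : ℝ → FormField I M k) : Prop :=
  ∀ x₀, ContDiffOn ℝ ∞ (fun p : ℝ × E => formRep I (η p.1) x₀ p.2)
    (Set.univ ×ˢ (extChartAt I x₀).target)

/-- The differential of a function, as a one-form. -/
def dFun (f : M → ℝ) : FormField I M 1 := fun x => oneForm (mvfderiv I f x)

/-- The exterior derivative, computed at `x` in the preferred chart at `x`. -/
def dForm {k : ℕ} (η : FormField I M k) : FormField I M (k + 1) := fun x =>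
  (extDeriv (formRep I η x) (extChartAt I x x)).compContinuousLinearMap
    (mvfderiv I (extChartAt I x) x)

/-- A function as a zero-form. -/
def zeroForm (f : M → ℝ) : FormField I M 0 := fun x =>
  ContinuousAlternatingMap.constOfIsEmpty ℝ (TangentSpace I x) (Fin 0) (f x)

/-- Pull-back of a field of bilinear forms. -/
def pullBilin {E' H' M' : Type*} [NormedAddCommGroup E'] [NormedSpace ℝ E'] [TopologicalSpace H']
    (I' : ModelWithCorners ℝ E' H') [TopologicalSpace M'] [ChartedSpace H' M']
    (p : M → M') (g : BilinField I' M') : BilinField I M := fun x =>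
  ContinuousLinearMap.precomp ℝ (mfderiv I I' p x) ∘L g (p x) ∘L mfderiv I I' p x

/-- Pull-back of a form. -/
def pullForm {E' H' M' : Type*} [NormedAddCommGroup E'] [NormedSpace ℝ E'] [TopologicalSpace H']
    (I' : ModelWithCorners ℝ E' H') [TopologicalSpace M'] [ChartedSpace H' M']
    {k : ℕ} (p : M → M') (η : FormField I' M' k) : FormField I M k := fun x =>
  (η (p x)).compContinuousLinearMap (mfderiv I I' p x)

variable [FiniteDimensional ℝ E]

/-- The Hodge hodge of a form on a manifold with metric `g` and volume form `vol`. -/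
def starForm {k m : ℕ} (g : BilinField I M) (vol : FormField I M (m + k)) (β : FormField I M k) :
    FormField I M m := fun x => hodge (g x) (vol x) (β x)

/-- The Ricci tensor of the metric `g`, computed at `x` in the preferred chart at `x`. -/
def ricci (g : BilinField I M) (x : M) (v w : TangentSpace I x) : ℝ :=
  ricciLoc (bilinRep I g x) (extChartAt I x x)
    (mvfderiv I (extChartAt I x) x v) (mvfderiv I (extChartAt I x) x w)

def RicciFlat (g : BilinField I M) : Prop := ∀ x v w, ricci I g x v w = 0

/-- The Laplace–Beltrami operator of `g`, computed at `x` in the preferred chart at `x`. -/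
def laplace (g : BilinField I M) (φ : M → ℝ) (x : M) : ℝ :=
  laplaceLoc (bilinRep I g x) (φ ∘ (extChartAt I x).symm) (extChartAt I x x)

/-- `vol` is a smooth volume form of `g`; this amounts to an orientation. -/
def IsOrientedVolume {n : ℕ} (g : BilinField I M) (vol : FormField I M n) : Prop :=
  SmoothForm I vol ∧ ∀ x, IsVolumeForm (g x) (vol x)

/-- A smooth family `ρ u` of Riemannian (negative definite) metrics. -/
def IsRiemannianFamily (ρ : ℝ → BilinField I M) : Prop :=
  SmoothBilinFamily I ρ ∧ ∀ u x, IsNegDef (ρ u x)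

/-- The conditions on the `u`-dependence of a family of metrics `ρ u`: with `θ = ρ⁻¹ ∂_u ρ`,
`div_ρ θ = d (tr θ)` and `∂_u (tr θ) + (1/2) tr (θ²) = 0`.
Both are trivial for a `u`-independent `ρ`. -/
def TransverseConditions (ρ : ℝ → BilinField I M) : Prop :=
  ∀ (u : ℝ) (x : M),
    (∀ w : E, divThetaLoc (fun s => bilinRep I (ρ s) x) u (extChartAt I x x) w =
      fderiv ℝ (fun y => trc (thetaLoc (fun s => bilinRep I (ρ s) x) u y)) (extChartAt I x x) w) ∧
    deriv (fun s => trc (thetaLoc (fun s' => bilinRep I (ρ s') x) s (extChartAt I x x))) u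
      + (1 / 2) * trc (fun z => thetaLoc (fun s => bilinRep I (ρ s) x) u (extChartAt I x x)
          (thetaLoc (fun s => bilinRep I (ρ s) x) u (extChartAt I x x) z)) = 0

/-- The bosonic equations of eleven-dimensional supergravity (mostly minus convention) for a
metric `h`, a volume form `vol` of `h` and a four-form `F`: closedness `dF = 0`, the Maxwell
equation `d ⋆ F = 1/2 F ∧ F`, and the Einstein equation
`Ric (X, Y) = -1/2 ⟨X ⌟ F, Y ⌟ F⟩ + 1/6 h (X, Y) ‖F‖²`. -/
structure IsBosonicBackground (h : BilinField I M) (vol : FormField I M 11)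
    (F : FormField I M 4) : Prop where
  closed : ∀ x, dForm I F x = 0
  maxwell : ∀ x, dForm I (starForm I (k := 4) (m := 7) h vol F) x
    = (1 / 2 : ℝ) • wedge (F x) (F x)
  einstein : ∀ x (v w : TangentSpace I x), ricci I h x v w =
    -(1 / 2) * formInner (h x) (iprod v (F x)) (iprod w (F x))
      + (1 / 6) * h x v w * formInner (h x) (F x) (F x)

end Manifold

/-! ### The product of a five-dimensional Walker manifold and a six-manifold -/

/-- The model of three-dimensional manifolds. -/
abbrev I3 := 𝓡 3

/-- The model of six-dimensional manifolds. -/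
abbrev I6 := 𝓡 6

/-- The model of `ℝ × N³ × ℝ`. -/
abbrev I5 := 𝓘(ℝ, ℝ).prod (I3.prod 𝓘(ℝ, ℝ))

/-- The model of `(ℝ × N³ × ℝ) × M⁶`. -/
abbrev I11 := I5.prod I6

section Walker

variable {N : Type*} [TopologicalSpace N] [ChartedSpace (EuclideanSpace ℝ (Fin 3)) N]

/-- `du` at a point of `ℝ × N × ℝ`, whose points are written `(u, x, v)`. -/
def du (p : ℝ × N × ℝ) : TangentSpace I5 p →L[ℝ] ℝ := mvfderiv I5 (fun q : ℝ × N × ℝ => q.1) p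

/-- `dv` at a point of `ℝ × N × ℝ`. -/
def dv (p : ℝ × N × ℝ) : TangentSpace I5 p →L[ℝ] ℝ :=
  mvfderiv I5 (fun q : ℝ × N × ℝ => q.2.2) p

/-- The Walker metric `2 du dv + ρ + H du²`, with `H` independent of `v`. -/
def walker (ρ : ℝ → BilinField I3 N) (H : ℝ → N → ℝ) : BilinField I5 (ℝ × N × ℝ) := fun p =>
  (du p).smulRight (dv p) + (dv p).smulRight (du p)
    + pullBilin I5 I3 (fun q : ℝ × N × ℝ => q.2.1) (ρ p.1) p
    + H p.1 p.2.1 • (du p).smulRight (du p)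

/-- The form `du ∧ η(u)` on `ℝ × N × ℝ`, for a family of `k`-forms `η(u)` on `N`. -/
def duWedge {k : ℕ} (η : ℝ → FormField I3 N k) : FormField I5 (ℝ × N × ℝ) (1 + k) := fun p =>
  wedge (oneForm (du p)) (pullForm I5 I3 (fun q : ℝ × N × ℝ => q.2.1) (η p.1) p)

/-- `α̃ = du ∧ f vol_ρ`. -/
def alphaForm (vol : ℝ → FormField I3 N 3) (f : ℝ → N → ℝ) : FormField I5 (ℝ × N × ℝ) 4 :=
  duWedge (k := 3) fun u x => f u x • vol u x

/-- `η(u) = -(1/c) ⋆_ρ d_N f`. -/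
def omegaForm (ρ : ℝ → BilinField I3 N) (vol : ℝ → FormField I3 N 3) (c : ℝ) (f : ℝ → N → ℝ) :
    ℝ → FormField I3 N 2 := fun u x =>
  -(1 / c) • starForm I3 (k := 1) (m := 2) (ρ u) (vol u) (dFun I3 (f u)) x

/-- `β̃ = du ∧ η(u)`. -/
def betaForm (η : ℝ → FormField I3 N 2) : FormField I5 (ℝ × N × ℝ) 3 := duWedge (k := 2) η

variable {M : Type*} [TopologicalSpace M] [ChartedSpace (EuclideanSpace ℝ (Fin 6)) M]

/-- The product metric `h = g̃ + g`. -/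
def prodMetric (gt : BilinField I5 (ℝ × N × ℝ)) (g : BilinField I6 M) :
    BilinField I11 ((ℝ × N × ℝ) × M) := fun p =>
  pullBilin I11 I5 Prod.fst gt p + pullBilin I11 I6 Prod.snd g p

/-- The flux form `F = φ α̃ + β̃ ∧ ν`. -/
def fluxForm (φ : M → ℝ) (α : FormField I5 (ℝ × N × ℝ) 4) (β : FormField I5 (ℝ × N × ℝ) 3)
    (ν : FormField I6 M 1) : FormField I11 ((ℝ × N × ℝ) × M) 4 := fun p =>
  φ p.2 • pullForm I11 I5 Prod.fst α p
    + wedge (pullForm I11 I5 Prod.fst β p) (pullForm I11 I6 Prod.snd ν p)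

end Walker

end Sugra

end

/-! The flux has a null factor. Since `β̃ ∧ ν = du ∧ ν ∧ ω`, one has `F = du ∧ Φ` with `Φ = φ f
vol_ρ + ν ∧ ω` (`preFlux`), and the gradient of `u` for `h` is `∂_v`, which annihilates both `du`
and `Φ`. Contracting with `∂_v` gives `‖F‖² = 0` and `⟨Y ⌟ F, Z ⌟ F⟩ = du(Y) du(Z) ‖Φ‖²`
(`formInner_flux_self`, `formInner_iprod_flux`). The two summands of `Φ` are orthogonal and
`‖vol_ρ‖² = (-1)³`, so `‖Φ‖² = ‖ω‖² ‖ν‖² - f² φ²`. Also `F ∧ F = 0`, because `du` occurs twice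
(`wedge_flux_self`).

On the geometric side, `∂_v` is parallel, so the Christoffel symbols of `h` have no `∂_u`-component
and vanish when one argument is `∂_v`. The Ricci tensor is therefore a trace over the directions of
`N` plus the Ricci tensor of `g` (`ricciLoc_hF`). In that trace the purely transverse part is the
Ricci tensor of `ρ`, the part linear in `du` is half of `div θ - d tr θ`, and the `du²` part is `-½
Δ_ρ H - ½ (∂_u tr θ + ½ tr θ²)` (`trc_transverse`). The hypotheses on `ρ` and `g` leave `Ric_h = -½
Δ_ρ H du²` (`ricci_prodMetric`), so the Einstein equation is precisely the scalar equation for `H`.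

The other two equations hold irrespective of `H`. Under `du ∧` all `u`-derivatives disappear. On
top-degree forms of a negative definite metric in dimension `n` the star of `vol` is `(-1)ⁿ`, so the
equation for `f` says `d_N ω = κ f vol_ρ`, and the equation on `M` says `d ⋆ ν = λ φ vol_M`. With
`dφ = κ ν`, the terms `dφ ∧ f vol_ρ` and `ν ∧ d_N ω` cancel in `dF` (`extDeriv_flux`). Up to an
orientation sign `⋆F` is `du ∧ (φ f vol_M + λ⁻¹ d_N f ∧ ⋆ν)` (`hodge_flux`), and its two
contributions to the differential cancel in the same way (`extDeriv_star_flux`). Hence `d ⋆ F = 0 =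
½ F ∧ F`.

The cases (1) and (2) are the instances `ν = dφ / κ` and `κ = 0, φ = 1` of one statement,
`isBosonicBackground_iff`, whose hypotheses are `dν = 0`, `dφ = κ ν`, `⋆ d ⋆ ν = λ φ` and the
equation for `f`. For the last claim, at a point with `ω ≠ 0` the norm of `ω` is nonzero by
definiteness, and the scalar equation there determines `‖ν‖²` at every point of `M`.

All fields are computed in preferred charts. The chart of the product is the product of the charts,
and its differential at the base point is the identity, so each claim reduces to calculus on the
model space `(ℝ × A × ℝ) × B`. -/

set_option linter.unusedSectionVars false

noncomputable section

namespace Sugra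

/-! ### Exterior multiplication by covectors, interior products and the wedge. -/

section AlternatingAlgebra

variable {V : Type*} [NormedAddCommGroup V] [NormedSpace ℝ V]
  {W : Type*} [NormedAddCommGroup W] [NormedSpace ℝ W]

open ContinuousAlternatingMap in
/-- The exterior product `ξ ∧ η` of a covector and a form. -/
def lw {k : ℕ} (ξ : V →L[ℝ] ℝ) (η : V [⋀^Fin k]→L[ℝ] ℝ) : V [⋀^Fin (k + 1)]→L[ℝ] ℝ :=
  alternatizeUncurryFin (ξ.smulRight η)

theorem lw_apply {k : ℕ} (ξ : V →L[ℝ] ℝ) (η : V [⋀^Fin k]→L[ℝ] ℝ) (v : Fin (k + 1) → V) :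
    lw ξ η v = ∑ i : Fin (k + 1), (-1) ^ (i : ℕ) * (ξ (v i) * η (i.removeNth v)) := by
  rw [lw, ContinuousAlternatingMap.alternatizeUncurryFin_apply]
  refine Finset.sum_congr rfl fun i _ => ?_
  simp [zsmul_eq_mul]

@[simp] theorem iprod_apply {V : Type*} [AddCommGroup V] [Module ℝ V] [TopologicalSpace V] {k : ℕ}
    (v : V) (η : V [⋀^Fin (k + 1)]→L[ℝ] ℝ) (w : Fin k → V) :
    iprod v η w = η (Fin.cons v w) := rfl

theorem lw_add {k : ℕ} (ξ : V →L[ℝ] ℝ) (η η' : V [⋀^Fin k]→L[ℝ] ℝ) :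
    lw ξ (η + η') = lw ξ η + lw ξ η' := by
  ext v; simp [lw_apply, mul_add, Finset.sum_add_distrib]

theorem lw_smul {k : ℕ} (c : ℝ) (ξ : V →L[ℝ] ℝ) (η : V [⋀^Fin k]→L[ℝ] ℝ) :
    lw ξ (c • η) = c • lw ξ η := by
  ext v; simp only [lw_apply, ContinuousAlternatingMap.smul_apply, smul_eq_mul, Finset.mul_sum]
  exact Finset.sum_congr rfl fun i _ => by ring

theorem lw_zero {k : ℕ} (ξ : V →L[ℝ] ℝ) : lw ξ (0 : V [⋀^Fin k]→L[ℝ] ℝ) = 0 := by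
  ext v; simp [lw_apply]

theorem lw_neg {k : ℕ} (ξ : V →L[ℝ] ℝ) (η : V [⋀^Fin k]→L[ℝ] ℝ) : lw ξ (-η) = -lw ξ η := by
  ext v; simp [lw_apply]

theorem add_lw {k : ℕ} (ξ ξ' : V →L[ℝ] ℝ) (η : V [⋀^Fin k]→L[ℝ] ℝ) :
    lw (ξ + ξ') η = lw ξ η + lw ξ' η := by
  ext v; simp [lw_apply, mul_add, add_mul, Finset.sum_add_distrib]

theorem smul_lw {k : ℕ} (c : ℝ) (ξ : V →L[ℝ] ℝ) (η : V [⋀^Fin k]→L[ℝ] ℝ) :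
    lw (c • ξ) η = c • lw ξ η := by
  ext v; simp only [lw_apply, ContinuousAlternatingMap.smul_apply, smul_eq_mul, Finset.mul_sum,
    _root_.smul_apply]
  exact Finset.sum_congr rfl fun i _ => by ring

/-- Exterior multiplication by a covector as a continuous bilinear map. -/
def lwL (k : ℕ) : (V →L[ℝ] ℝ) →L[ℝ] (V [⋀^Fin k]→L[ℝ] ℝ) →L[ℝ] V [⋀^Fin (k + 1)]→L[ℝ] ℝ :=
  (ContinuousLinearMap.compL ℝ _ _ _
      (ContinuousAlternatingMap.alternatizeUncurryFinCLM ℝ V ℝ)) ∘L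
    ContinuousLinearMap.smulRightL ℝ V (V [⋀^Fin k]→L[ℝ] ℝ)

@[simp] theorem lwL_apply {k : ℕ} (ξ : V →L[ℝ] ℝ) (η : V [⋀^Fin k]→L[ℝ] ℝ) :
    lwL k ξ η = lw ξ η := rfl

/-- A symmetric bilinear family alternates to zero, and `f + f.flip` is symmetric. This is the
source of every anticommutation sign below. -/
theorem alternatizeUncurryFin_swap {k : ℕ} (f : V →L[ℝ] V →L[ℝ] V [⋀^Fin k]→L[ℝ] ℝ) :
    ContinuousAlternatingMap.alternatizeUncurryFin
        (ContinuousAlternatingMap.alternatizeUncurryFinCLM ℝ V ℝ ∘L f) =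
      -ContinuousAlternatingMap.alternatizeUncurryFin
        (ContinuousAlternatingMap.alternatizeUncurryFinCLM ℝ V ℝ ∘L f.flip) := by
  rw [eq_neg_iff_add_eq_zero, ← ContinuousAlternatingMap.alternatizeUncurryFin_add,
    ← ContinuousLinearMap.comp_add]
  exact ContinuousAlternatingMap.alternatizeUncurryFin_alternatizeUncurryFinCLM_comp_of_symmetric
    fun x y => by simp [add_comm]

/-- The swap lemma for the decomposable family `ξ ⊗ ζ ⊗ η`, whose flip is `ζ ⊗ ξ ⊗ η`. -/
theorem lw_lw {k : ℕ} (ξ ζ : V →L[ℝ] ℝ) (η : V [⋀^Fin k]→L[ℝ] ℝ) :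
    lw ξ (lw ζ η) = -lw ζ (lw ξ η) := by
  have h := alternatizeUncurryFin_swap (ξ.smulRight (ζ.smulRight η))
  have h1 : ContinuousAlternatingMap.alternatizeUncurryFinCLM ℝ V ℝ ∘L
      ξ.smulRight (ζ.smulRight η) = ξ.smulRight (lw ζ η) := by
    ext x v; simp [lw]
  have h2 : ContinuousAlternatingMap.alternatizeUncurryFinCLM ℝ V ℝ ∘L
      (ξ.smulRight (ζ.smulRight η)).flip = ζ.smulRight (lw ξ η) := by
    ext x v
    have : (ξ.smulRight (ζ.smulRight η)).flip x = ζ x • ξ.smulRight η := by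
      ext y w; simp; ring
    simp [lw, this]
  rwa [h1, h2] at h

theorem lw_self {k : ℕ} (ξ : V →L[ℝ] ℝ) (η : V [⋀^Fin k]→L[ℝ] ℝ) : lw ξ (lw ξ η) = 0 := by
  ext v
  have := congrArg (fun z => z v) (lw_lw ξ ξ η)
  simp only [ContinuousAlternatingMap.neg_apply] at this
  simpa using self_eq_neg.mp this

theorem iprod_add {k : ℕ} (v : V) (η η' : V [⋀^Fin (k + 1)]→L[ℝ] ℝ) :
    iprod v (η + η') = iprod v η + iprod v η' := rfl

theorem iprod_smul {k : ℕ} (v : V) (c : ℝ) (η : V [⋀^Fin (k + 1)]→L[ℝ] ℝ) :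
    iprod v (c • η) = c • iprod v η := rfl

theorem iprod_neg {k : ℕ} (v : V) (η : V [⋀^Fin (k + 1)]→L[ℝ] ℝ) :
    iprod v (-η) = -iprod v η := rfl

theorem iprod_zero {k : ℕ} (v : V) : iprod v (0 : V [⋀^Fin (k + 1)]→L[ℝ] ℝ) = 0 := rfl

theorem iprod_lw {k : ℕ} (v : V) (ξ : V →L[ℝ] ℝ) (η : V [⋀^Fin (k + 1)]→L[ℝ] ℝ) :
    iprod v (lw ξ η) = ξ v • η - lw ξ (iprod v η) := by
  ext w
  rw [ContinuousAlternatingMap.sub_apply, ContinuousAlternatingMap.smul_apply, iprod_apply,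
    lw_apply, Fin.sum_univ_succ, lw_apply, sub_eq_add_neg, ← Finset.sum_neg_distrib]
  congr 1
  · simp
  · refine Finset.sum_congr rfl fun i _ => ?_
    have : i.succ.removeNth (α := fun _ => V) (Fin.cons v w : Fin (k + 2) → V)
        = (Fin.cons v (i.removeNth w) : Fin (k + 1) → V) := by
      funext j
      refine Fin.cases ?_ (fun j => ?_) j
      · simp [Fin.removeNth]
      · simp [Fin.removeNth]
    rw [this, iprod_apply]
    simp [pow_succ]

theorem iprod_lw_zero (v : V) (ξ : V →L[ℝ] ℝ) (η : V [⋀^Fin 0]→L[ℝ] ℝ) :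
    iprod v (lw ξ η) = ξ v • η := by
  ext w
  rw [iprod_apply, lw_apply]
  simp only [Nat.reduceAdd, Finset.univ_unique, Fin.default_eq_zero, Finset.sum_singleton,
    ContinuousAlternatingMap.smul_apply, smul_eq_mul]
  simp

theorem iprod_iprod {k : ℕ} (v w : V) (η : V [⋀^Fin (k + 2)]→L[ℝ] ℝ) :
    iprod v (iprod w η) = -iprod w (iprod v η) := by
  ext z
  simp only [iprod_apply, ContinuousAlternatingMap.neg_apply]
  have := η.toAlternatingMap.map_swap (Fin.cons v (Fin.cons w z : Fin (k + 1) → V) : Fin (k + 2) → V)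
    (i := 0) (j := 1) (by simp)
  change η _ = - η _ at this
  rw [← this]
  congr 1
  funext j
  refine Fin.cases ?_ (fun j => Fin.cases ?_ (fun j => ?_) j) j
  · simp [Equiv.swap_apply_left]
  · simp [Equiv.swap_apply_right]
  · rw [Function.comp_apply, Equiv.swap_apply_of_ne_of_ne]
    · simp
    · exact Fin.succ_ne_zero _
    · intro h
      have := Fin.succ_injective _ (h.trans (Fin.succ_zero_eq_one).symm)
      exact Fin.succ_ne_zero _ this

theorem lw_compContinuousLinearMap {k : ℕ} (π : W →L[ℝ] V) (ξ : V →L[ℝ] ℝ)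
    (η : V [⋀^Fin k]→L[ℝ] ℝ) :
    (lw ξ η).compContinuousLinearMap π = lw (ξ ∘L π) (η.compContinuousLinearMap π) := by
  ext v
  simp only [ContinuousAlternatingMap.compContinuousLinearMap_apply, lw_apply]
  rfl

theorem iprod_compContinuousLinearMap {V W : Type*} [AddCommGroup V] [Module ℝ V]
    [TopologicalSpace V] [AddCommGroup W] [Module ℝ W] [TopologicalSpace W]
    {k : ℕ} (π : W →L[ℝ] V) (w : W) (η : V [⋀^Fin (k + 1)]→L[ℝ] ℝ) :
    iprod w (η.compContinuousLinearMap π) = (iprod (π w) η).compContinuousLinearMap π := by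
  ext v
  simp only [ContinuousAlternatingMap.compContinuousLinearMap_apply, iprod_apply]
  congr 1
  funext j
  refine Fin.cases ?_ (fun j => ?_) j <;> simp

/-- A form of degree exceeding the dimension vanishes. -/
theorem form_eq_zero_of_finrank_lt [FiniteDimensional ℝ V] {k : ℕ} (η : V [⋀^Fin k]→L[ℝ] ℝ)
    (h : Module.finrank ℝ V < k) : η = 0 := by
  ext v
  have hv : ¬ LinearIndependent ℝ v := fun hv => by
    have := hv.fintype_card_le_finrank
    simp at this
    omega
  exact η.toAlternatingMap.map_linearDependent v hv

/-- Connects the permutation sum in `wedge` with the shuffle sum in `lw`. Precomposing with the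
cycle that brings slot `i` to the front costs `(-1)^i`, so all `k + 1` choices of the slot fed to
`ξ` give the same sum up to sign. The first and the last slot serve the wedge with a one-form on the
left and on the right. -/
theorem sum_perm_covector_mul {k : ℕ} (ξ : V →L[ℝ] ℝ) (η : V [⋀^Fin k]→L[ℝ] ℝ)
    (v : Fin (k + 1) → V) (i : Fin (k + 1)) :
    ∑ σ : Equiv.Perm (Fin (k + 1)), ((Equiv.Perm.sign σ : ℤ) : ℝ) *
        (ξ (v (σ i)) * η (fun j => v (σ (i.succAbove j)))) =
      (-1) ^ (i : ℕ) * (k.factorial * lw ξ η v) := by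
  set S := ∑ σ : Equiv.Perm (Fin (k + 1)), ((Equiv.Perm.sign σ : ℤ) : ℝ) *
        (ξ (v (σ 0)) * η (fun j => v (σ j.succ))) with hS
  have key : ∀ i : Fin (k + 1), ∑ σ : Equiv.Perm (Fin (k + 1)), ((Equiv.Perm.sign σ : ℤ) : ℝ) *
        (ξ (v (σ i)) * η (fun j => v (σ (i.succAbove j)))) = (-1) ^ (i : ℕ) * S := by
    intro i
    rw [hS, Finset.mul_sum]
    symm
    rw [← Equiv.sum_comp (Equiv.mulRight (i.cycleRange.symm))]
    refine Finset.sum_congr rfl fun σ _ => ?_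
    simp only [Equiv.coe_mulRight, Equiv.Perm.sign_mul, Equiv.Perm.sign_symm, Fin.sign_cycleRange,
      Equiv.Perm.coe_mul, Function.comp_apply, Fin.cycleRange_symm_zero, Fin.cycleRange_symm_succ]
    push_cast
    have : ((-1 : ℝ) ^ (i : ℕ)) * (-1) ^ (i : ℕ) = 1 := by
      rw [← mul_pow]; simp
    linear_combination (((Equiv.Perm.sign σ : ℤ) : ℝ) * (ξ (v (σ i)) *
      η (fun j => v (σ (i.succAbove j))))) * this
  -- Averaging `lw ξ η` over all permutations does not change it; expanding each of the `k + 1`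
  -- terms gives the sum `S` again.
  have tot : ((k + 1).factorial : ℝ) * lw ξ η v = (k + 1) * S := by
    have h1 : ∀ σ : Equiv.Perm (Fin (k + 1)),
        ((Equiv.Perm.sign σ : ℤ) : ℝ) * lw ξ η (v ∘ σ) = lw ξ η v := by
      intro σ
      have := (lw ξ η).toAlternatingMap.map_perm v σ
      change lw ξ η (v ∘ σ) = _ • lw ξ η v at this
      rw [this]
      rcases Int.units_eq_one_or (Equiv.Perm.sign σ) with h | h <;> simp [h]
    have h2 : ((k + 1).factorial : ℝ) * lw ξ η v = ∑ σ : Equiv.Perm (Fin (k + 1)),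
        ((Equiv.Perm.sign σ : ℤ) : ℝ) * lw ξ η (v ∘ σ) := by
      rw [Finset.sum_congr rfl fun σ _ => h1 σ]
      simp [Fintype.card_perm]
    rw [h2]
    simp only [lw_apply, Finset.mul_sum]
    rw [Finset.sum_comm]
    have : ∀ i : Fin (k + 1), ∑ σ : Equiv.Perm (Fin (k + 1)), ((Equiv.Perm.sign σ : ℤ) : ℝ) *
        ((-1) ^ (i : ℕ) * (ξ ((v ∘ σ) i) * η (i.removeNth (v ∘ σ)))) = S := by
      intro i
      have h3 : (-1 : ℝ) ^ (i : ℕ) * ((-1) ^ (i : ℕ) * S) = S := by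
        rw [← mul_assoc, ← mul_pow]; simp
      rw [← h3, ← key i, Finset.mul_sum]
      refine Finset.sum_congr rfl fun σ _ => ?_
      have : i.removeNth (v ∘ σ) = fun j => v (σ (i.succAbove j)) := rfl
      rw [this, Function.comp_apply]
      ring
    rw [Finset.sum_congr rfl fun i _ => this i]
    simp
  rw [key i]
  congr 1
  rw [Nat.factorial_succ] at tot
  push_cast at tot
  have hk : (k + 1 : ℝ) ≠ 0 := by positivity
  apply mul_left_cancel₀ hk
  linarith

theorem wedge_apply {k l : ℕ} (α : V [⋀^Fin k]→L[ℝ] ℝ) (β : V [⋀^Fin l]→L[ℝ] ℝ)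
    (v : Fin (k + l) → V) :
    wedge α β v = ((k.factorial : ℝ) * (l.factorial : ℝ))⁻¹ *
      ∑ σ : Equiv.Perm (Fin (k + l)), ((Equiv.Perm.sign σ : ℤ) : ℝ) *
        (α (fun i => v (σ (Fin.castAdd l i))) * β (fun i => v (σ (Fin.natAdd k i)))) := by
  rw [wedge, ContinuousAlternatingMap.smul_apply, smul_eq_mul,
    ContinuousMultilinearMap.alternatization_apply_apply]
  congr 1
  refine Finset.sum_congr rfl fun σ _ => ?_
  rw [tensor_apply]
  rcases Int.units_eq_one_or (Equiv.Perm.sign σ) with h | h <;> simp [h]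

theorem wedge_oneForm_right {k : ℕ} (ξ : V →L[ℝ] ℝ) (η : V [⋀^Fin k]→L[ℝ] ℝ) :
    wedge η (oneForm ξ) = (-1 : ℝ) ^ k • lw ξ η := by
  ext v
  have h := sum_perm_covector_mul ξ η v (Fin.last k)
  rw [wedge_apply, ContinuousAlternatingMap.smul_apply, smul_eq_mul]
  have hk : (k.factorial : ℝ) ≠ 0 := by positivity
  rw [Nat.factorial_one, Nat.cast_one, mul_one, inv_mul_eq_iff_eq_mul₀ hk]
  rw [Fin.val_last] at h
  rw [mul_left_comm, ← h]
  refine Finset.sum_congr rfl fun σ _ => ?_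
  rw [mul_comm (η _)]
  congr 2
  congr 1
  funext j
  simp only [Fin.succAbove_last]
  rfl

/-- Stated on vectors, because the degrees `1 + k` and `k + 1` agree only after a cast. -/
theorem wedge_oneForm_left {k : ℕ} (ξ : V →L[ℝ] ℝ) (η : V [⋀^Fin k]→L[ℝ] ℝ) (v : Fin (1 + k) → V) :
    wedge (oneForm ξ) η v = lw ξ η (v ∘ Fin.cast (add_comm k 1)) := by
  have h := sum_perm_covector_mul ξ η (v ∘ Fin.cast (add_comm k 1)) 0
  have hk : (k.factorial : ℝ) ≠ 0 := by positivity
  rw [wedge_apply, Nat.factorial_one, Nat.cast_one, one_mul, inv_mul_eq_iff_eq_mul₀ hk]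
  rw [Fin.val_zero, pow_zero, one_mul] at h
  rw [← h, ← Equiv.sum_comp (finCongr (add_comm k 1)).permCongr]
  refine Finset.sum_congr rfl fun σ _ => ?_
  rw [Equiv.Perm.sign_permCongr]
  congr 2
  congr 1
  funext j
  simp [Equiv.permCongr_apply]

end AlternatingAlgebra

end Sugra

end

noncomputable section

namespace Sugra

/-! ### Leibniz rules and pull-backs for the exterior derivative on a vector space. -/

section ExteriorDerivative

variable {V : Type*} [NormedAddCommGroup V] [NormedSpace ℝ V]
  {A : Type*} [NormedAddCommGroup A] [NormedSpace ℝ A]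

open ContinuousAlternatingMap

theorem alternatizeUncurryFin_pull {k : ℕ} (π : V →L[ℝ] A) (L : A →L[ℝ] A [⋀^Fin k]→L[ℝ] ℝ) :
    alternatizeUncurryFin (compContinuousLinearMapCLM π ∘L L ∘L π) =
      (alternatizeUncurryFin L).compContinuousLinearMap π := by
  ext v
  simp only [alternatizeUncurryFin_apply, compContinuousLinearMap_apply]
  rfl

theorem extDeriv_smul_fun {k : ℕ} {g : V → ℝ} {η : V → V [⋀^Fin k]→L[ℝ] ℝ} {x : V}
    (hg : DifferentiableAt ℝ g x) (hη : DifferentiableAt ℝ η x) :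
    extDeriv (fun y => g y • η y) x = lw (fderiv ℝ g x) (η x) + g x • extDeriv η x := by
  rw [extDeriv, fderiv_fun_smul hg hη, alternatizeUncurryFin_add, alternatizeUncurryFin_smul]
  exact add_comm _ _

/-- The sign comes from moving the differentiation slot past `ξ`. -/
theorem alternatizeUncurryFin_lw {k : ℕ} (ξ : V →L[ℝ] ℝ) (L : V →L[ℝ] V [⋀^Fin k]→L[ℝ] ℝ) :
    alternatizeUncurryFin (lwL k ξ ∘L L) = -lw ξ (alternatizeUncurryFin L) := by
  have h := alternatizeUncurryFin_swap
    (ContinuousLinearMap.smulRightL ℝ V (V [⋀^Fin k]→L[ℝ] ℝ) ξ ∘L L)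
  have h2 : alternatizeUncurryFinCLM ℝ V ℝ ∘L
      (ContinuousLinearMap.smulRightL ℝ V (V [⋀^Fin k]→L[ℝ] ℝ) ξ ∘L L).flip =
        ξ.smulRight (alternatizeUncurryFin L) := by
    ext x v
    have : (ContinuousLinearMap.smulRightL ℝ V (V [⋀^Fin k]→L[ℝ] ℝ) ξ ∘L L).flip x = ξ x • L := by
      ext y w; simp
    simp [this]
  rw [h2] at h
  exact h

/-- The Leibniz rule for a closed one-form: the term that differentiates `ν` is a double
alternatization of a map symmetric by `hsymm`, so only the term with `dβ` survives. -/
theorem extDeriv_lw {k : ℕ} {ν : V → V →L[ℝ] ℝ} {β : V → V [⋀^Fin k]→L[ℝ] ℝ} {x : V}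
    (hν : DifferentiableAt ℝ ν x) (hβ : DifferentiableAt ℝ β x)
    (hsymm : ∀ v w, fderiv ℝ ν x v w = fderiv ℝ ν x w v) :
    extDeriv (fun y => lw (ν y) (β y)) x = -lw (ν x) (extDeriv β x) := by
  have h := (lwL (V := V) k).hasFDerivAt_of_bilinear hν.hasFDerivAt hβ.hasFDerivAt
  have h' : fderiv ℝ (fun y => lw (ν y) (β y)) x = lwL k (ν x) ∘L fderiv ℝ β x +
      (lwL k).flip (β x) ∘L fderiv ℝ ν x := h.fderiv
  rw [extDeriv, h', alternatizeUncurryFin_add, alternatizeUncurryFin_lw, extDeriv]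
  have h2 : (lwL k).flip (β x) ∘L fderiv ℝ ν x = alternatizeUncurryFinCLM ℝ V ℝ ∘L
      ((ContinuousLinearMap.smulRightL ℝ V (V [⋀^Fin k]→L[ℝ] ℝ)).flip (β x) ∘L fderiv ℝ ν x) := by
    ext v w
    rfl
  rw [h2, alternatizeUncurryFin_alternatizeUncurryFinCLM_comp_of_symmetric, add_zero]
  intro v w
  ext z
  simp [hsymm v w]

theorem extDeriv_const_lw {k : ℕ} (ξ : V →L[ℝ] ℝ) {β : V → V [⋀^Fin k]→L[ℝ] ℝ} {x : V}
    (hβ : DifferentiableAt ℝ β x) :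
    extDeriv (fun y => lw ξ (β y)) x = -lw ξ (extDeriv β x) :=
  extDeriv_lw (differentiableAt_const ξ) hβ (by simp)

theorem extDeriv_pull {k : ℕ} (π : V →L[ℝ] A) {b : A → A [⋀^Fin k]→L[ℝ] ℝ} {x : V}
    (hb : DifferentiableAt ℝ b (π x)) :
    extDeriv (fun y => (b (π y)).compContinuousLinearMap π) x =
      (extDeriv b (π x)).compContinuousLinearMap π := by
  rw [extDeriv, extDeriv, ← alternatizeUncurryFin_pull]
  congr 1
  exact ((compContinuousLinearMapCLM π).hasFDerivAt.comp x
    (hb.hasFDerivAt.comp x π.hasFDerivAt)).fderiv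

/-- The derivative of the family along `μ` contributes a multiple of `μ`, which `μ ∧` kills. This is
why arbitrary `u`-dependence of `ρ` and `f` does no harm to the form equations. -/
theorem lw_extDeriv_pull_family {k : ℕ} (μ : V →L[ℝ] ℝ) (π : V →L[ℝ] A)
    {a : ℝ × A → A [⋀^Fin k]→L[ℝ] ℝ} {x : V} (ha : DifferentiableAt ℝ a (μ x, π x)) :
    lw μ (extDeriv (fun y => (a (μ y, π y)).compContinuousLinearMap π) x) =
      lw μ ((extDeriv (fun z => a (μ x, z)) (π x)).compContinuousLinearMap π) := by
  have h : fderiv ℝ (fun y => (a (μ y, π y)).compContinuousLinearMap π) x =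
      compContinuousLinearMapCLM π ∘L fderiv ℝ a (μ x, π x) ∘L (μ.prod π) := by
    have h0 : HasFDerivAt (fun y => a (μ y, π y)) (fderiv ℝ a (μ x, π x) ∘L (μ.prod π)) x :=
      ha.hasFDerivAt.comp (f := fun y => (μ y, π y)) x (μ.prod π).hasFDerivAt
    have h1 : HasFDerivAt (fun η : A [⋀^Fin k]→L[ℝ] ℝ => η.compContinuousLinearMap π)
        (compContinuousLinearMapCLM π) (a (μ x, π x)) :=
      (compContinuousLinearMapCLM π : (A [⋀^Fin k]→L[ℝ] ℝ) →L[ℝ] _).hasFDerivAt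
    exact (h1.comp x h0).fderiv
  have h2 : fderiv ℝ (fun z => a (μ x, z)) (π x) =
      fderiv ℝ a (μ x, π x) ∘L ContinuousLinearMap.inr ℝ ℝ A :=
    (ha.hasFDerivAt.comp (π x) (hasFDerivAt_prodMk_right (μ x) (π x))).fderiv
  have h3 : compContinuousLinearMapCLM π ∘L fderiv ℝ a (μ x, π x) ∘L (μ.prod π) =
      μ.smulRight (compContinuousLinearMapCLM π (fderiv ℝ a (μ x, π x) (1, 0))) +
      compContinuousLinearMapCLM π ∘L fderiv ℝ (fun z => a (μ x, z)) (π x) ∘L π := by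
    rw [h2]
    ext v w
    have : ((μ v, π v) : ℝ × A) = μ v • (1, 0) + (0, π v) := by simp
    simp only [ContinuousLinearMap.comp_apply, ContinuousLinearMap.prod_apply]
    rw [this, map_add, map_smul]
    simp
  rw [extDeriv, h, h3, alternatizeUncurryFin_add, alternatizeUncurryFin_pull, lw_add]
  change lw μ (lw μ _) + _ = _
  rw [lw_self, zero_add]
  rfl

end ExteriorDerivative

end Sugra

end

noncomputable section

namespace Sugra

/-! ### Multi-index contractions. -/

section Contraction

variable {V : Type*} [AddCommGroup V] [Module ℝ V]

theorem sum_multiIndex_succ {k : ℕ} {ι : Type*} [Fintype ι] (F : (Fin (k + 1) → ι) → ℝ) :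
    ∑ J : Fin (k + 1) → ι, F J = ∑ i, ∑ J : Fin k → ι, F (Fin.cons i J) := by
  rw [← (Fin.consEquiv fun _ => ι).sum_comp, Fintype.sum_prod_type]
  rfl

theorem comp_fin_cons {k : ℕ} {ι : Type*} (p : ι → V) (i : ι) (J : Fin k → ι) :
    (fun a => p ((Fin.cons i J : Fin (k + 1) → ι) a)) = Fin.cons (p i) (fun a => p (J a)) := by
  funext a
  refine Fin.cases ?_ (fun a => ?_) a <;> simp

/-- Sums over multi-indices `∑ α (p_J) β (q_J)` depend only on the tensor `∑ p_i ⊗ q_i`. -/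
theorem sum_multiIndex_congr {ι κ : Type*} [Fintype ι] [Fintype κ] {p q : ι → V} {r s : κ → V}
    (h : ∀ ξ ζ : V →ₗ[ℝ] ℝ, ∑ i, ξ (p i) * ζ (q i) = ∑ j, ξ (r j) * ζ (s j)) :
    ∀ {k : ℕ} (α β : MultilinearMap ℝ (fun _ : Fin k => V) ℝ),
      ∑ J : Fin k → ι, α (fun a => p (J a)) * β (fun a => q (J a)) =
        ∑ J : Fin k → κ, α (fun a => r (J a)) * β (fun a => s (J a)) := by
  intro k
  induction k with
  | zero =>
    intro α β
    simp only [Finset.univ_unique, Finset.sum_singleton]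
    congr 2 <;> exact Subsingleton.elim _ _
  | succ k ih =>
    intro α β
    simp only [sum_multiIndex_succ, comp_fin_cons]
    -- With the first arguments frozen, the induction hypothesis changes the remaining slots; after
    -- exchanging the sums, `h` changes the first slot.
    have : ∀ i, ∑ J : Fin k → ι, α (Fin.cons (p i) (fun a => p (J a))) *
            β (Fin.cons (q i) (fun a => q (J a))) =
          ∑ J : Fin k → κ, α (Fin.cons (p i) (fun a => r (J a))) *
            β (Fin.cons (q i) (fun a => s (J a))) :=
      fun i => ih (α.curryLeft (p i)) (β.curryLeft (q i))
    rw [Finset.sum_congr rfl fun i _ => this i, Finset.sum_comm, Finset.sum_comm (γ := κ)]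
    refine Finset.sum_congr rfl fun J _ => ?_
    simpa [MultilinearMap.toLinearMap, Fin.update_cons_zero] using
      h (α.toLinearMap (Fin.cons 0 (fun a => r (J a))) 0)
        (β.toLinearMap (Fin.cons 0 (fun a => s (J a))) 0)

end Contraction

section ContractionNormed

variable {V : Type*} [NormedAddCommGroup V] [NormedSpace ℝ V]

/-- Moving slot `l` of `Φ` to the front costs `(-1)^l`, which cancels the sign of the `l`-th term of
`lw`. All `k + 1` terms thus contribute equally, with the index of `ξ` raised. Both the adjunction
`formInner_lw_left` and the star of a product `hodge_lw` rest on this. -/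
theorem sum_multiIndex_lw {ι : Type*} [Fintype ι] (p q : ι → V) {k : ℕ} (ξ : V →L[ℝ] ℝ)
    (β : V [⋀^Fin k]→L[ℝ] ℝ) (Φ : V [⋀^Fin (k + 1)]→ₗ[ℝ] ℝ) :
    ∑ J : Fin (k + 1) → ι, lw ξ β (fun a => p (J a)) * Φ (fun a => q (J a)) =
      (k + 1) * ∑ J : Fin k → ι, β (fun a => p (J a)) *
        Φ (Fin.cons (∑ i, ξ (p i) • q i) (fun a => q (J a))) := by
  have h1 : ∀ l : Fin (k + 1), ∑ J : Fin (k + 1) → ι,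
      (-1 : ℝ) ^ (l : ℕ) * (ξ (p (J l)) * β (l.removeNth fun a => p (J a))) *
        Φ (fun a => q (J a)) = ∑ J : Fin k → ι, β (fun a => p (J a)) *
        Φ (Fin.cons (∑ i, ξ (p i) • q i) (fun a => q (J a))) := by
    intro l
    rw [← (Fin.insertNthEquiv (fun _ => ι) l).sum_comp, Fintype.sum_prod_type, Finset.sum_comm]
    refine Finset.sum_congr rfl fun J _ => ?_
    have h2 : Φ (Fin.cons (∑ i, ξ (p i) • q i) (fun a => q (J a))) =
        ∑ i, ξ (p i) * Φ (Fin.cons (q i) (fun a => q (J a))) := by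
      have hL : ∀ x, Φ.toMultilinearMap.toLinearMap (Fin.cons 0 (fun a => q (J a))) 0 x =
          Φ (Fin.cons x (fun a => q (J a))) := fun x => by
        simp [MultilinearMap.toLinearMap, Fin.update_cons_zero]
      rw [← hL, map_sum]
      refine Finset.sum_congr rfl fun i _ => ?_
      rw [map_smul, hL, smul_eq_mul]
    rw [h2, Finset.mul_sum]
    refine Finset.sum_congr rfl fun i _ => ?_
    have h3 : (fun a => q (Fin.insertNthEquiv (fun _ => ι) l (i, J) a)) =
        l.insertNth (q i) (fun a => q (J a)) := by
      funext a
      refine Fin.succAboveCases l ?_ (fun a => ?_) a <;> simp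
    have h4 : (l.removeNth fun a => p (Fin.insertNthEquiv (fun _ => ι) l (i, J) a)) =
        fun a => p (J a) := by
      funext a
      simp [Fin.removeNth]
    have h5 : (-1 : ℝ) ^ (l : ℕ) * Φ (l.insertNth (q i) (fun a => q (J a))) =
        Φ (Fin.cons (q i) (fun a => q (J a))) := by
      have := Φ.neg_one_pow_smul_map_insertNth l (q i) (fun a => q (J a))
      rw [zsmul_eq_mul] at this
      push_cast at this
      exact this
    rw [h3, h4, ← h5]
    simp only [Fin.insertNthEquiv_apply, Fin.insertNth_apply_same]
    ring
  simp only [lw_apply, Finset.sum_mul]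
  rw [Finset.sum_comm, Finset.sum_congr rfl fun l _ => h1 l]
  simp

end ContractionNormed

/-! ### Insertion of several vectors as an alternating map. -/

section Insertion

variable {V : Type*} [AddCommGroup V] [Module ℝ V] [TopologicalSpace V]

/-- The tuple `(v 0, …, v (k - 1), w 0, …, w (m - 1))`. -/
def prependTuple {m k : ℕ} (v : Fin k → V) (w : Fin m → V) (i : Fin (m + k)) : V :=
  if h : (i : ℕ) < k then v ⟨i, h⟩ else w ⟨i - k, by omega⟩

theorem interiorMany_apply {m : ℕ} : ∀ {k : ℕ} (v : Fin k → V) (vol : V [⋀^Fin (m + k)]→L[ℝ] ℝ)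
    (w : Fin m → V), interiorMany v vol w = vol (prependTuple v w)
  | 0, v, vol, w => by
    simp only [interiorMany]
    congr 1
  | k + 1, v, vol, w => by
    simp only [interiorMany]
    rw [interiorMany_apply, iprod_apply]
    congr 1
    funext i
    refine Fin.cases ?_ (fun i => ?_) i
    · simp [prependTuple]
    · simp only [Fin.cons_succ, prependTuple, Fin.val_succ, Fin.tail]
      by_cases h : (i : ℕ) < k
      · simp [h]
      · have h' : ¬ (i : ℕ) + 1 < k + 1 := by omega
        simp only [h, h', dite_false]
        congr 1
        apply Fin.ext
        simp

theorem prependTuple_update {m k : ℕ} [DecidableEq (Fin k)] (v : Fin k → V) (w : Fin m → V)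
    (i : Fin k) (x : V) :
    prependTuple (Function.update v i x) w =
      Function.update (prependTuple v w) ⟨i, by omega⟩ x := by
  funext j
  by_cases hj : (j : ℕ) < k
  · by_cases hij : i = ⟨j, hj⟩
    · subst hij
      simp [prependTuple, hj]
    · have h1 : (⟨j, hj⟩ : Fin k) ≠ i := fun h => hij h.symm
      have h2 : j ≠ (⟨i, by omega⟩ : Fin (m + k)) := fun h => hij (by apply Fin.ext; simp [h])
      simp [prependTuple, hj, Function.update_of_ne h1, Function.update_of_ne h2]
  · have h2 : j ≠ (⟨i, by omega⟩ : Fin (m + k)) := fun h => hj (by rw [h]; exact i.2)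
    simp [prependTuple, hj, Function.update_of_ne h2]

/-- The value of `interiorMany v vol` at `w`, as an alternating function of `v`. -/
def interiorAlt {m k : ℕ} (vol : V [⋀^Fin (m + k)]→L[ℝ] ℝ) (w : Fin m → V) :
    V [⋀^Fin k]→ₗ[ℝ] ℝ where
  toFun v := interiorMany v vol w
  map_update_add' v i x y := by
    simp only [interiorMany_apply, prependTuple_update]
    exact vol.map_update_add _ _ _ _
  map_update_smul' v i c x := by
    simp only [interiorMany_apply, prependTuple_update]
    exact vol.map_update_smul _ _ _ _
  map_eq_zero_of_eq' v i j hij hne := by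
    rw [interiorMany_apply]
    refine vol.map_eq_zero_of_eq _ (i := ⟨i, by omega⟩) (j := ⟨j, by omega⟩) ?_ ?_
    · simpa [prependTuple] using hij
    · intro h
      apply hne
      apply Fin.ext
      simpa using h

@[simp] theorem interiorAlt_apply {m k : ℕ} (vol : V [⋀^Fin (m + k)]→L[ℝ] ℝ) (w : Fin m → V)
    (v : Fin k → V) : interiorAlt vol w v = interiorMany v vol w := rfl

theorem interiorMany_compContinuousLinearMap {W : Type*} [AddCommGroup W] [Module ℝ W]
    [TopologicalSpace W] {m k : ℕ} (π : W →L[ℝ] V) (vol : V [⋀^Fin (m + k)]→L[ℝ] ℝ)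
    (v : Fin k → W) (w : Fin m → W) :
    interiorMany v (vol.compContinuousLinearMap π) w =
      interiorMany (fun a => π (v a)) vol (fun a => π (w a)) := by
  rw [interiorMany_apply, interiorMany_apply, ContinuousAlternatingMap.compContinuousLinearMap_apply]
  congr 1
  funext i
  by_cases h : (i : ℕ) < k <;> simp [prependTuple, h]

end Insertion

/-! ### Inner products and Hodge stars through the inverse metric. -/

section Metric

variable {V : Type*} [AddCommGroup V] [Module ℝ V] [TopologicalSpace V] [IsTopologicalAddGroup V]
  [ContinuousSMul ℝ V] [T2Space V] [FiniteDimensional ℝ V]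
  {W : Type*} [AddCommGroup W] [Module ℝ W] [TopologicalSpace W] [IsTopologicalAddGroup W]
  [ContinuousSMul ℝ W] [T2Space W] [FiniteDimensional ℝ W]

theorem sum_coord_dualBas (G : V →L[ℝ] V →L[ℝ] ℝ) (ξ : V →L[ℝ] ℝ) :
    ∑ i, ξ (bas V i) • dualBas G i = G.inverse ξ := by
  simp only [dualBas, ← map_smul, ← map_sum]
  congr 1
  ext v
  conv_rhs => rw [← (bas V).sum_repr v, map_sum]
  simp [mul_comm]

theorem sum_mul_dualBas (G : V →L[ℝ] V →L[ℝ] ℝ) (ξ ζ : V →ₗ[ℝ] ℝ) :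
    ∑ i, ξ (bas V i) * ζ (dualBas G i) = ζ (G.inverse ξ.toContinuousLinearMap) := by
  rw [← sum_coord_dualBas]
  simp

/-- Only the tensor `∑ p i ⊗ q i` matters, so any two families representing the inverse metric may
replace a basis and its dual: an orthonormal basis and its negative, or the images of such families
under a projection. -/
theorem formInner_eq_of_sum {k : ℕ} {ι : Type*} [Fintype ι] {p q : ι → V}
    {G : V →L[ℝ] V →L[ℝ] ℝ}
    (h : ∀ ξ ζ : V →ₗ[ℝ] ℝ, ∑ i, ξ (p i) * ζ (q i) = ζ (G.inverse ξ.toContinuousLinearMap))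
    (α β : V [⋀^Fin k]→L[ℝ] ℝ) :
    formInner G α β = (k.factorial : ℝ)⁻¹ * ∑ J : Fin k → ι,
      α (fun a => p (J a)) * β (fun a => q (J a)) := by
  rw [formInner]
  congr 1
  exact sum_multiIndex_congr (fun ξ ζ => by rw [h, sum_mul_dualBas])
    α.toMultilinearMap β.toMultilinearMap

theorem hodge_apply {k m : ℕ} (G : V →L[ℝ] V →L[ℝ] ℝ) (vol : V [⋀^Fin (m + k)]→L[ℝ] ℝ)
    (β : V [⋀^Fin k]→L[ℝ] ℝ) (w : Fin m → V) :
    hodge G vol β w = (k.factorial : ℝ)⁻¹ * ∑ J : Fin k → Fin (Module.finrank ℝ V),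
      β (fun a => dualBas G (J a)) * interiorAlt vol w (fun a => bas V (J a)) := by
  simp [hodge, ContinuousAlternatingMap.sum_apply]

theorem hodge_apply_of_sum {k m : ℕ} {ι : Type*} [Fintype ι] {p q : ι → V}
    {G : V →L[ℝ] V →L[ℝ] ℝ}
    (h : ∀ ξ ζ : V →ₗ[ℝ] ℝ, ∑ i, ξ (p i) * ζ (q i) = ζ (G.inverse ξ.toContinuousLinearMap))
    (vol : V [⋀^Fin (m + k)]→L[ℝ] ℝ) (β : V [⋀^Fin k]→L[ℝ] ℝ) (w : Fin m → V) :
    hodge G vol β w = (k.factorial : ℝ)⁻¹ * ∑ J : Fin k → ι,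
      β (fun a => q (J a)) * interiorAlt vol w (fun a => p (J a)) := by
  rw [hodge_apply]
  congr 1
  refine sum_multiIndex_congr (fun ξ ζ => ?_)
    β.toMultilinearMap (interiorAlt vol w).toMultilinearMap
  simp only [mul_comm (ξ _)]
  rw [h, sum_mul_dualBas]

/-- `π` is compatible with the inverse metrics. -/
def IsCoisometry (π : W →L[ℝ] V) (G' : W →L[ℝ] W →L[ℝ] ℝ) (G : V →L[ℝ] V →L[ℝ] ℝ) : Prop :=
  ∀ ξ : V →L[ℝ] ℝ, π (G'.inverse (ξ ∘L π)) = G.inverse ξ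

theorem IsCoisometry.sum_mul {π : W →L[ℝ] V} {G' : W →L[ℝ] W →L[ℝ] ℝ} {G : V →L[ℝ] V →L[ℝ] ℝ}
    (h : IsCoisometry π G' G) (ξ ζ : V →ₗ[ℝ] ℝ) :
    ∑ i, ξ (π (bas W i)) * ζ (π (dualBas G' i)) = ζ (G.inverse ξ.toContinuousLinearMap) := by
  have := sum_mul_dualBas G' (ξ ∘ₗ π.toLinearMap) (ζ ∘ₗ π.toLinearMap)
  simp only [LinearMap.comp_apply, ContinuousLinearMap.coe_coe] at this
  rw [this, ← h]
  congr 3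

/-- The images under `π` of a basis of `W` and of its dual need not be bases of `V`, but they still
represent the inverse metric of `G`. -/
theorem IsCoisometry.formInner_comp {π : W →L[ℝ] V} {G' : W →L[ℝ] W →L[ℝ] ℝ}
    {G : V →L[ℝ] V →L[ℝ] ℝ} (h : IsCoisometry π G' G) {k : ℕ} (α β : V [⋀^Fin k]→L[ℝ] ℝ) :
    formInner G' (α.compContinuousLinearMap π) (β.compContinuousLinearMap π) =
      formInner G α β := by
  rw [formInner_eq_of_sum h.sum_mul]
  rfl

theorem IsCoisometry.hodge_comp {π : W →L[ℝ] V} {G' : W →L[ℝ] W →L[ℝ] ℝ}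
    {G : V →L[ℝ] V →L[ℝ] ℝ} (h : IsCoisometry π G' G) {k m : ℕ} (vol : V [⋀^Fin (m + k)]→L[ℝ] ℝ)
    (β : V [⋀^Fin k]→L[ℝ] ℝ) :
    hodge G' (vol.compContinuousLinearMap π) (β.compContinuousLinearMap π) =
      (hodge G vol β).compContinuousLinearMap π := by
  ext w
  rw [ContinuousAlternatingMap.compContinuousLinearMap_apply, hodge_apply_of_sum h.sum_mul,
    hodge_apply]
  congr 1
  refine Finset.sum_congr rfl fun J _ => ?_
  simp only [interiorAlt_apply, interiorMany_compContinuousLinearMap]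
  rfl

/-- A nondegenerate bilinear form on a finite-dimensional space is invertible. -/
theorem isInvertible_of_nondegenerate {G : V →L[ℝ] V →L[ℝ] ℝ}
    (h : ∀ v, (∀ w, G v w = 0) → v = 0) : G.IsInvertible := by
  have hinj : Function.Injective (G.toLinearMap) := by
    rw [← LinearMap.ker_eq_bot, LinearMap.ker_eq_bot']
    intro v hv
    exact h v fun w => by
      have := congrArg (fun L : V →L[ℝ] ℝ => L w) hv
      simpa using this
  have hdim : Module.finrank ℝ V = Module.finrank ℝ (V →L[ℝ] ℝ) := by
    rw [← Subspace.dual_finrank_eq (K := ℝ) (V := V)]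
    exact (LinearMap.toContinuousLinearMap (𝕜 := ℝ) (E := V) (F' := ℝ)).finrank_eq
  have : FiniteDimensional ℝ (V →L[ℝ] ℝ) :=
    (LinearMap.toContinuousLinearMap (𝕜 := ℝ) (E := V) (F' := ℝ)).finiteDimensional
  let e := (LinearEquiv.ofInjectiveOfFinrankEq G.toLinearMap hinj hdim).toContinuousLinearEquiv
  exact ⟨e, by ext v w; rfl⟩

theorem IsNegDef.isInvertible {G : V →L[ℝ] V →L[ℝ] ℝ} (h : IsNegDef G) : G.IsInvertible :=
  isInvertible_of_nondegenerate fun v hv => by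
    by_contra hne
    exact absurd (hv v) (h.2 v hne).ne

/-- The pullback of a bilinear form by a linear map. -/
def pullB (π : W →L[ℝ] V) (G : V →L[ℝ] V →L[ℝ] ℝ) : W →L[ℝ] W →L[ℝ] ℝ :=
  ContinuousLinearMap.precomp ℝ π ∘L G ∘L π

@[simp] theorem pullB_apply (π : W →L[ℝ] V) (G : V →L[ℝ] V →L[ℝ] ℝ) (v w : W) :
    pullB π G v w = G (π v) (π w) := rfl

/-- Makes the star natural under chart differentials. -/
theorem isCoisometry_of_equiv (e : W ≃L[ℝ] V) {G : V →L[ℝ] V →L[ℝ] ℝ} (hG : G.IsInvertible) :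
    IsCoisometry (e : W →L[ℝ] V) (pullB (e : W →L[ℝ] V) G) G := by
  intro ξ
  have hinv : (pullB (e : W →L[ℝ] V) G).IsInvertible :=
    isInvertible_of_nondegenerate fun v hv => by
      have h0 : G (e v) = 0 := by
        ext w
        simpa using hv (e.symm w)
      have := hG.injective (h0.trans (map_zero G).symm)
      simpa using this
  have : (pullB (e : W →L[ℝ] V) G).inverse (ξ ∘L (e : W →L[ℝ] V)) = e.symm (G.inverse ξ) := by
    rw [hinv.inverse_apply_eq]
    ext w
    simp [hG.self_apply_inverse]
  rw [this]
  simp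

theorem inverse_symm {G : V →L[ℝ] V →L[ℝ] ℝ} (hG : G.IsInvertible) (hs : ∀ v w, G v w = G w v)
    (ξ ζ : V →L[ℝ] ℝ) : ξ (G.inverse ζ) = ζ (G.inverse ξ) := by
  conv_lhs => rw [← hG.self_apply_inverse ξ]
  conv_rhs => rw [← hG.self_apply_inverse ζ]
  rw [hs]

theorem sum_dualBas_coord {G : V →L[ℝ] V →L[ℝ] ℝ} (hG : G.IsInvertible)
    (hs : ∀ v w, G v w = G w v) (ξ : V →L[ℝ] ℝ) :
    ∑ i, ξ (dualBas G i) • bas V i = G.inverse ξ := by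
  conv_rhs => rw [← (bas V).sum_repr (G.inverse ξ)]
  refine Finset.sum_congr rfl fun i _ => ?_
  congr 1
  rw [dualBas, inverse_symm hG hs]
  rfl

theorem formInner_comm {G : V →L[ℝ] V →L[ℝ] ℝ} (hG : G.IsInvertible)
    (hs : ∀ v w, G v w = G w v) {k : ℕ} (α β : V [⋀^Fin k]→L[ℝ] ℝ) :
    formInner G α β = formInner G β α := by
  rw [formInner, formInner_eq_of_sum (p := dualBas G) (q := bas V)]
  · simp only [mul_comm (α _)]
  · intro ξ ζ
    have := sum_dualBas_coord hG hs ξ.toContinuousLinearMap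
    rw [← this]
    simp

theorem formInner_add_left {k : ℕ} (G : V →L[ℝ] V →L[ℝ] ℝ) (α α' β : V [⋀^Fin k]→L[ℝ] ℝ) :
    formInner G (α + α') β = formInner G α β + formInner G α' β := by
  simp [formInner, add_mul, Finset.sum_add_distrib, mul_add]

theorem formInner_smul_left {k : ℕ} (G : V →L[ℝ] V →L[ℝ] ℝ) (c : ℝ) (α β : V [⋀^Fin k]→L[ℝ] ℝ) :
    formInner G (c • α) β = c * formInner G α β := by
  simp only [formInner, ContinuousAlternatingMap.smul_apply, smul_eq_mul, mul_assoc,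
    ← Finset.mul_sum]
  ring

theorem formInner_add_right {k : ℕ} (G : V →L[ℝ] V →L[ℝ] ℝ) (α β β' : V [⋀^Fin k]→L[ℝ] ℝ) :
    formInner G α (β + β') = formInner G α β + formInner G α β' := by
  simp [formInner, mul_add, Finset.sum_add_distrib]

theorem formInner_smul_right {k : ℕ} (G : V →L[ℝ] V →L[ℝ] ℝ) (c : ℝ)
    (α β : V [⋀^Fin k]→L[ℝ] ℝ) : formInner G α (c • β) = c * formInner G α β := by
  simp only [formInner, ContinuousAlternatingMap.smul_apply, smul_eq_mul, mul_left_comm _ c,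
    ← Finset.mul_sum]

theorem formInner_zero_right {k : ℕ} (G : V →L[ℝ] V →L[ℝ] ℝ) (α : V [⋀^Fin k]→L[ℝ] ℝ) :
    formInner G α 0 = 0 := by
  simp [formInner]

theorem hodge_add {k m : ℕ} (G : V →L[ℝ] V →L[ℝ] ℝ) (vol : V [⋀^Fin (m + k)]→L[ℝ] ℝ)
    (β β' : V [⋀^Fin k]→L[ℝ] ℝ) : hodge G vol (β + β') = hodge G vol β + hodge G vol β' := by
  simp [hodge, add_smul, Finset.sum_add_distrib]

theorem hodge_smul {k m : ℕ} (G : V →L[ℝ] V →L[ℝ] ℝ) (vol : V [⋀^Fin (m + k)]→L[ℝ] ℝ) (c : ℝ)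
    (β : V [⋀^Fin k]→L[ℝ] ℝ) : hodge G vol (c • β) = c • hodge G vol β := by
  ext w
  simp only [hodge_apply, ContinuousAlternatingMap.smul_apply, smul_eq_mul, mul_assoc,
    ← Finset.mul_sum]
  ring

theorem hodge_smul_vol {k m : ℕ} (G : V →L[ℝ] V →L[ℝ] ℝ) (vol : V [⋀^Fin (m + k)]→L[ℝ] ℝ)
    (c : ℝ) (β : V [⋀^Fin k]→L[ℝ] ℝ) : hodge G (c • vol) β = c • hodge G vol β := by
  ext w
  have : ∀ v : Fin k → V, interiorAlt (c • vol) w v = c * interiorAlt vol w v := fun v => by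
    simp [interiorMany_apply]
  simp only [hodge_apply, ContinuousAlternatingMap.smul_apply, smul_eq_mul, this,
    mul_left_comm _ c, ← Finset.mul_sum]

theorem hodge_constOfIsEmpty {m : ℕ} (G : V →L[ℝ] V →L[ℝ] ℝ) (vol : V [⋀^Fin m]→L[ℝ] ℝ)
    (β : V [⋀^Fin 0]→L[ℝ] ℝ) : hodge (k := 0) G vol β = β ![] • vol := by
  ext w
  rw [hodge_apply]
  simp [interiorMany]
  left
  congr 1
  exact Subsingleton.elim _ _

/-- A negative definite metric has an orthonormal basis. -/
theorem IsNegDef.exists_orthonormal {n : ℕ} (hn : Module.finrank ℝ V = n)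
    {G : V →L[ℝ] V →L[ℝ] ℝ} (hG : IsNegDef G) :
    ∃ e : Module.Basis (Fin n) ℝ V, ∀ i j, G (e i) (e j) = if i = j then -1 else 0 := by
  subst hn
  let B : LinearMap.BilinForm ℝ V := LinearMap.mk₂ ℝ (fun v w => G v w)
    (by simp) (by simp) (by simp) (by simp)
  have hB : LinearMap.IsSymm B := ⟨fun v w => hG.1 v w⟩
  obtain ⟨v, hv⟩ := LinearMap.BilinForm.exists_orthogonal_basis hB
  have hneg : ∀ i, G (v i) (v i) < 0 := fun i => hG.2 _ (v.ne_zero i)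
  -- The metric is negative, so a vector is normalised to square norm `-1` by the root of minus its
  -- square norm.
  have hunit : ∀ i, IsUnit ((Real.sqrt (-G (v i) (v i)))⁻¹) := fun i =>
    (inv_ne_zero (Real.sqrt_ne_zero'.mpr (by linarith [hneg i]))).isUnit
  refine ⟨v.isUnitSMul hunit, fun i j => ?_⟩
  simp only [Module.Basis.isUnitSMul_apply, map_smul, _root_.smul_apply, smul_eq_mul]
  by_cases h : i = j
  · subst h
    have h1 := Real.mul_self_sqrt (show 0 ≤ -G (v i) (v i) by linarith [hneg i])
    have h2 : Real.sqrt (-G (v i) (v i)) ≠ 0 := Real.sqrt_ne_zero'.mpr (by linarith [hneg i])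
    simp only [if_true]
    field_simp
    linarith
  · have : G (v i) (v j) = 0 := hv h
    simp [h, this]

end Metric

/-! ### Adjunction between exterior and interior multiplication. -/

section MetricNormed

variable {V : Type*} [NormedAddCommGroup V] [NormedSpace ℝ V] [FiniteDimensional ℝ V]

theorem formInner_lw_left {k : ℕ} (G : V →L[ℝ] V →L[ℝ] ℝ) (ξ : V →L[ℝ] ℝ)
    (β : V [⋀^Fin k]→L[ℝ] ℝ) (X : V [⋀^Fin (k + 1)]→L[ℝ] ℝ) :
    formInner G (lw ξ β) X = formInner G β (iprod (G.inverse ξ) X) := by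
  have h := sum_multiIndex_lw (bas V) (dualBas G) ξ β X.toAlternatingMap
  rw [sum_coord_dualBas] at h
  rw [formInner, formInner, Nat.factorial_succ]
  have h' : ∑ J : Fin (k + 1) → Fin (Module.finrank ℝ V), lw ξ β (fun a => bas V (J a)) *
      X (fun a => dualBas G (J a)) = (k + 1) * ∑ J : Fin k → Fin (Module.finrank ℝ V),
        β (fun a => bas V (J a)) * iprod (G.inverse ξ) X (fun a => dualBas G (J a)) := h
  rw [h']
  push_cast
  have : (k + 1 : ℝ) ≠ 0 := by positivity
  field_simp

/-- Reduces the star of a decomposable form to iterated contractions of `vol`. Nothing requires the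
contracted form to be a volume form: `hodge` makes sense with any form of degree `m + k` in that
place. -/
theorem hodge_lw {k m : ℕ} {G : V →L[ℝ] V →L[ℝ] ℝ} (hG : G.IsInvertible)
    (hs : ∀ v w, G v w = G w v) (ξ : V →L[ℝ] ℝ) (β : V [⋀^Fin k]→L[ℝ] ℝ)
    (vol : V [⋀^Fin (m + (k + 1))]→L[ℝ] ℝ) :
    hodge G vol (lw ξ β) = hodge (m := m) G (iprod (k := m + k) (G.inverse ξ) vol) β := by
  ext w
  have h := sum_multiIndex_lw (dualBas G) (bas V) ξ β (interiorAlt vol w)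
  rw [sum_dualBas_coord hG hs] at h
  rw [hodge_apply, hodge_apply, Nat.factorial_succ, h]
  have h2 : ∀ v : Fin k → V, interiorAlt vol w (Fin.cons (G.inverse ξ) v) =
      interiorAlt (iprod (k := m + k) (G.inverse ξ) vol) w v := fun v => by
    simp [interiorMany]
  simp only [h2]
  push_cast
  have : (k + 1 : ℝ) ≠ 0 := by positivity
  field_simp

theorem hodge_oneForm {m : ℕ} {G : V →L[ℝ] V →L[ℝ] ℝ} (hG : G.IsInvertible)
    (hs : ∀ v w, G v w = G w v) (ξ : V →L[ℝ] ℝ) (vol : V [⋀^Fin (m + 1)]→L[ℝ] ℝ) :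
    hodge G vol (oneForm ξ) = iprod (G.inverse ξ) vol := by
  have h1 : oneForm ξ = lw ξ (ContinuousAlternatingMap.constOfIsEmpty ℝ V (Fin 0) (1 : ℝ)) := by
    ext v
    simp [oneForm, lw_apply]
  rw [h1, hodge_lw hG hs, hodge_constOfIsEmpty]
  simp

/-- The square norm of the volume form of a negative definite metric. -/
theorem formInner_vol {n : ℕ} (hn : Module.finrank ℝ V = n) {G : V →L[ℝ] V →L[ℝ] ℝ}
    (hG : IsNegDef G) {vol : V [⋀^Fin n]→L[ℝ] ℝ} (hvol : IsVolumeForm G vol) :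
    formInner G vol vol = (-1) ^ n := by
  obtain ⟨e, he⟩ := hG.exists_orthonormal hn
  -- The basis dual to `e` is `-e` because `G (e i) (e i) = -1`; these signs produce the factor
  -- `(-1) ^ n`.
  have hsum : ∀ ξ ζ : V →ₗ[ℝ] ℝ, ∑ i, ξ (e i) * ζ (-e i) =
      ζ (G.inverse ξ.toContinuousLinearMap) := by
    intro ξ ζ
    have : G.inverse ξ.toContinuousLinearMap = ∑ i, ξ (e i) • (-e i) := by
      rw [hG.isInvertible.inverse_apply_eq]
      apply ContinuousLinearMap.coe_injective
      refine e.ext fun j => ?_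
      simp [he]
    rw [this]
    simp
  rw [formInner_eq_of_sum hsum]
  -- For injective `J` the Gram matrix is `-1`; a repeated index makes two rows equal. Only the `n!`
  -- injective multi-indices count.
  have hterm : ∀ J : Fin n → Fin n, vol (fun a => e (J a)) * vol (fun a => -e (J a)) =
      (-1) ^ n * if Function.Injective J then 1 else 0 := by
    intro J
    have h1 : vol (fun a => -e (J a)) = (-1) ^ n * vol (fun a => e (J a)) := by
      have := vol.map_smul_univ (fun _ => (-1 : ℝ)) (fun a => e (J a))
      simpa using this
    rw [h1, mul_left_comm, ← pow_two, hvol]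
    congr 1
    split_ifs with h
    · have : (Matrix.of fun i j => G (e (J i)) (e (J j))) = (-1 : Matrix (Fin n) (Fin n) ℝ) := by
        ext i j
        simp [he, h.eq_iff, Matrix.one_apply]
        split_ifs <;> simp
      rw [this, Matrix.det_neg]
      simp
    · simp only [Function.Injective, not_forall] at h
      obtain ⟨i, j, hij, hne⟩ := h
      rw [abs_eq_zero]
      exact Matrix.det_zero_of_row_eq hne (by ext l; simp [hij])
  rw [Finset.sum_congr rfl fun J _ => hterm J, ← Finset.mul_sum]
  have hcard : ∑ J : Fin n → Fin n, (if Function.Injective J then (1 : ℝ) else 0) =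
      n.factorial := by
    rw [Finset.sum_boole]
    norm_cast
    rw [← Fintype.card_subtype,
      Fintype.card_congr (Equiv.subtypeInjectiveEquivEmbedding (Fin n) (Fin n)),
      Fintype.card_embedding_eq]
    simp [Nat.descFactorial_self]
  rw [hcard]
  field_simp

end MetricNormed

end Sugra

end

noncomputable section

namespace Sugra

theorem iprod_zero_left {V : Type*} [AddCommGroup V] [Module ℝ V] [TopologicalSpace V] {k : ℕ}
    (η : V [⋀^Fin (k + 1)]→L[ℝ] ℝ) : iprod (0 : V) η = 0 := by
  ext w
  rw [iprod_apply]
  exact η.map_coord_zero 0 rfl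

theorem iprod_neg_left {V : Type*} [AddCommGroup V] [Module ℝ V] [TopologicalSpace V] {k : ℕ}
    (v : V) (η : V [⋀^Fin (k + 1)]→L[ℝ] ℝ) : iprod (-v) η = -iprod v η := by
  ext w
  rw [ContinuousAlternatingMap.neg_apply, iprod_apply, iprod_apply]
  have := η.cons_smul w (-1) v
  simpa using this

/-- Top-degree forms are a line, and a tuple on which one of them is nonzero is a basis that
measures their ratio. -/
theorem top_form_eq_smul {V : Type*} [NormedAddCommGroup V] [NormedSpace ℝ V]
    [FiniteDimensional ℝ V] {n : ℕ} (hn : Module.finrank ℝ V = n) (α β : V [⋀^Fin n]→L[ℝ] ℝ)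
    (b : Fin n → V) (hβ : β b ≠ 0) : α = (α b / β b) • β := by
  have hli : LinearIndependent ℝ b := by
    by_contra h
    exact hβ (β.toAlternatingMap.map_linearDependent b h)
  -- Degree zero is separate, as the basis built from an independent family needs a nonempty index
  -- type.
  obtain _ | n := n
  · ext w
    have : w = b := Subsingleton.elim _ _
    rw [this]
    simp [hβ]
  · let e := basisOfLinearIndependentOfCardEqFinrank hli (by simp [hn])
    have he : ⇑e = b := coe_basisOfLinearIndependentOfCardEqFinrank _ _
    apply ContinuousAlternatingMap.toAlternatingMap_injective
    refine Module.Basis.ext_alternating e fun v hv => ?_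
    have hb : Function.Bijective v := Finite.injective_iff_bijective.mp hv
    have hperm := fun γ : V [⋀^Fin (n + 1)]→ₗ[ℝ] ℝ => γ.map_perm b (Equiv.ofBijective v hb)
    have hv' : (fun i => e (v i)) = b ∘ Equiv.ofBijective v hb := by
      funext i; simp [he]
    rw [hv', hperm, hperm]
    congr 1
    change α b = (α b / β b) * β b
    field_simp

/-! ### The metric and the flux on the model space at one point. -/

section Model

variable (A B : Type*) [NormedAddCommGroup A] [NormedSpace ℝ A] [NormedAddCommGroup B]
  [NormedSpace ℝ B]

/-- The model `(ℝ × A × ℝ) × B` of the eleven-dimensional manifold. -/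
abbrev Tot : Type _ := (ℝ × (A × ℝ)) × B

/-- The coordinate `u`. -/
def cu : Tot A B →L[ℝ] ℝ := ContinuousLinearMap.fst ℝ ℝ (A × ℝ) ∘L ContinuousLinearMap.fst ℝ _ B

/-- The coordinate `v`. -/
def cv : Tot A B →L[ℝ] ℝ :=
  ContinuousLinearMap.snd ℝ A ℝ ∘L ContinuousLinearMap.snd ℝ ℝ (A × ℝ) ∘L
    ContinuousLinearMap.fst ℝ _ B

/-- The projection to `A`. -/
def pA : Tot A B →L[ℝ] A :=
  ContinuousLinearMap.fst ℝ A ℝ ∘L ContinuousLinearMap.snd ℝ ℝ (A × ℝ) ∘L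
    ContinuousLinearMap.fst ℝ _ B

/-- The projection to `B`. -/
def pB : Tot A B →L[ℝ] B := ContinuousLinearMap.snd ℝ _ B

/-- The inclusion of `A`. -/
def iA (a : A) : Tot A B := ((0, (a, 0)), 0)

/-- The inclusion of `B`. -/
def iB (b : B) : Tot A B := (0, b)

/-- The coordinate vector `∂_u`. -/
def eu : Tot A B := ((1, (0, 0)), 0)

/-- The coordinate vector `∂_v`. -/
def ev : Tot A B := ((0, (0, 1)), 0)

variable {A B}

@[simp] theorem cu_apply (p : Tot A B) : cu A B p = p.1.1 := rfl
@[simp] theorem cv_apply (p : Tot A B) : cv A B p = p.1.2.2 := rfl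
@[simp] theorem pA_apply (p : Tot A B) : pA A B p = p.1.2.1 := rfl
@[simp] theorem pB_apply (p : Tot A B) : pB A B p = p.2 := rfl

/-- The metric `2 du dv + r + H du² + g` at a point. -/
def hT (r : A →L[ℝ] A →L[ℝ] ℝ) (H : ℝ) (g : B →L[ℝ] B →L[ℝ] ℝ) :
    Tot A B →L[ℝ] Tot A B →L[ℝ] ℝ :=
  ((cu A B).smulRight (cv A B) + (cv A B).smulRight (cu A B) + pullB (pA A B) r
    + H • (cu A B).smulRight (cu A B)) + pullB (pB A B) g

theorem hT_apply (r : A →L[ℝ] A →L[ℝ] ℝ) (H : ℝ) (g : B →L[ℝ] B →L[ℝ] ℝ) (v w : Tot A B) :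
    hT r H g v w = v.1.1 * w.1.2.2 + v.1.2.2 * w.1.1 + r v.1.2.1 w.1.2.1 + H * (v.1.1 * w.1.1)
      + g v.2 w.2 := by
  simp only [hT, add_apply, smul_apply, ContinuousLinearMap.smulRight_apply, smul_eq_mul,
    cu_apply, cv_apply]
  rfl

variable [FiniteDimensional ℝ A] [FiniteDimensional ℝ B]
  {r : A →L[ℝ] A →L[ℝ] ℝ} {H : ℝ} {g : B →L[ℝ] B →L[ℝ] ℝ}

theorem hT_symm (hr : ∀ v w, r v w = r w v) (hg : ∀ v w, g v w = g w v) (v w : Tot A B) :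
    hT r H g v w = hT r H g w v := by
  rw [hT_apply, hT_apply, hr, hg]; ring

theorem hT_isInvertible (hr : r.IsInvertible) (hg : g.IsInvertible) :
    (hT r H g).IsInvertible := by
  refine isInvertible_of_nondegenerate fun v hv => ?_
  simp only [hT_apply] at hv
  have h1 : v.1.1 = 0 := by simpa [ev] using hv (ev A B)
  have h2 : v.1.2.2 = 0 := by simpa [h1, eu] using hv (eu A B)
  have h3 : v.1.2.1 = 0 := by
    refine hr.injective ?_
    rw [map_zero]
    ext a
    simpa [h1, h2, iA] using hv (iA A B a)
  have h4 : v.2 = 0 := by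
    refine hg.injective ?_
    rw [map_zero]
    ext a
    simpa [h1, h2, iB] using hv (iB A B a)
  exact Prod.ext (Prod.ext h1 (Prod.ext h3 h2)) h4

/-- The null direction: the gradient of `u` is `∂_v`, whatever `H` is. -/
theorem hT_inverse_cu (hr : r.IsInvertible) (hg : g.IsInvertible) :
    (hT r H g).inverse (cu A B) = ev A B := by
  rw [(hT_isInvertible hr hg).inverse_apply_eq]
  ext w <;> simp [hT_apply, ev]

theorem hT_inverse_pA (hr : r.IsInvertible) (hg : g.IsInvertible) (ξ : A →L[ℝ] ℝ) :
    (hT r H g).inverse (ξ ∘L pA A B) = iA A B (r.inverse ξ) := by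
  rw [(hT_isInvertible hr hg).inverse_apply_eq]
  refine ContinuousLinearMap.ext fun w => ?_
  simp [hT_apply, iA, hr.self_apply_inverse]

theorem hT_inverse_pB (hr : r.IsInvertible) (hg : g.IsInvertible) (ξ : B →L[ℝ] ℝ) :
    (hT r H g).inverse (ξ ∘L pB A B) = iB A B (g.inverse ξ) := by
  rw [(hT_isInvertible hr hg).inverse_apply_eq]
  refine ContinuousLinearMap.ext fun w => ?_
  simp [hT_apply, iB, hg.self_apply_inverse]

theorem isCoisometry_pA (hr : r.IsInvertible) (hg : g.IsInvertible) :
    IsCoisometry (pA A B) (hT r H g) r := fun ξ => by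
  rw [hT_inverse_pA hr hg]; rfl

theorem iprod_pull_eq_zero {V W : Type*} [AddCommGroup V] [Module ℝ V] [TopologicalSpace V]
    [AddCommGroup W] [Module ℝ W] [TopologicalSpace W] {k : ℕ} (π : V →L[ℝ] W) {v : V}
    (hv : π v = 0) (η : W [⋀^Fin (k + 1)]→L[ℝ] ℝ) :
    iprod v (η.compContinuousLinearMap π) = 0 := by
  rw [iprod_compContinuousLinearMap, hv, iprod_zero_left]
  rfl

/-- By adjunction the inner product contracts `X` with `∂_v`. -/
theorem formInner_lw_cu (hr : r.IsInvertible) (hg : g.IsInvertible) {k : ℕ}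
    (β : Tot A B [⋀^Fin k]→L[ℝ] ℝ) (X : Tot A B [⋀^Fin (k + 1)]→L[ℝ] ℝ)
    (hX : iprod (ev A B) X = 0) : formInner (hT r H g) (lw (cu A B) β) X = 0 := by
  rw [formInner_lw_left, hT_inverse_cu hr hg, hX, formInner_zero_right]

section Flux

variable (a : A [⋀^Fin 3]→L[ℝ] ℝ) (ψ : A [⋀^Fin 2]→L[ℝ] ℝ) (ν : B →L[ℝ] ℝ) (φ : ℝ)

/-- The three-form `φ a + ν ∧ ψ`. -/
def preFlux : Tot A B [⋀^Fin 3]→L[ℝ] ℝ :=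
  φ • a.compContinuousLinearMap (pA A B) +
    lw (ν ∘L pB A B) (ψ.compContinuousLinearMap (pA A B))

theorem iprod_ev_preFlux : iprod (ev A B) (preFlux a ψ ν φ) = 0 := by
  rw [preFlux, iprod_add, iprod_smul, iprod_lw, iprod_pull_eq_zero _ (by simp [ev]),
    iprod_pull_eq_zero _ (by simp [ev])]
  simp [ev, lw_zero]

theorem iprod_ev_iprod_flux (w : Tot A B) :
    iprod (ev A B) (iprod w (lw (cu A B) (preFlux a ψ ν φ))) = 0 := by
  rw [iprod_iprod, iprod_lw, iprod_ev_preFlux]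
  simp [ev, lw_zero, iprod_zero]

/-- `∂_v` kills both `du` and the three-form, hence the flux is null. -/
theorem formInner_flux_self (hr : r.IsInvertible) (hg : g.IsInvertible) :
    formInner (hT r H g) (lw (cu A B) (preFlux a ψ ν φ)) (lw (cu A B) (preFlux a ψ ν φ)) = 0 := by
  apply formInner_lw_cu hr hg
  rw [iprod_lw, iprod_ev_preFlux]
  simp [ev, lw_zero]

/-- The cross terms vanish because raising the index of `ν` gives a vector tangent to `B`, which
annihilates forms pulled back from `A`. -/
theorem formInner_preFlux (hr : r.IsInvertible) (hrs : ∀ v w, r v w = r w v)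
    (hg : g.IsInvertible) (hgs : ∀ v w, g v w = g w v) :
    formInner (hT r H g) (preFlux a ψ ν φ) (preFlux a ψ ν φ) =
      φ ^ 2 * formInner r a a + formInner r ψ ψ * formInner g (oneForm ν) (oneForm ν) := by
  have hco := isCoisometry_pA (H := H) hr hg
  have h1 : formInner (hT r H g) (lw (ν ∘L pB A B) (ψ.compContinuousLinearMap (pA A B)))
      (a.compContinuousLinearMap (pA A B)) = 0 := by
    rw [formInner_lw_left, hT_inverse_pB hr hg, iprod_pull_eq_zero _ (by simp [iB]),
      formInner_zero_right]
  have h2 : formInner (hT r H g) (lw (ν ∘L pB A B) (ψ.compContinuousLinearMap (pA A B)))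
      (lw (ν ∘L pB A B) (ψ.compContinuousLinearMap (pA A B))) =
      formInner r ψ ψ * ν (g.inverse ν) := by
    rw [formInner_lw_left, hT_inverse_pB hr hg, iprod_lw, iprod_pull_eq_zero _ (by simp [iB]),
      lw_zero, sub_zero, formInner_smul_right, hco.formInner_comp]
    simp [iB, mul_comm]
  have h3 : formInner g (oneForm ν) (oneForm ν) = ν (g.inverse ν) := by
    have : oneForm ν = lw ν (ContinuousAlternatingMap.constOfIsEmpty ℝ B (Fin 0) (1 : ℝ)) := by
      ext v
      simp [oneForm, lw_apply]
    conv_lhs => rw [this]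
    rw [formInner_lw_left, iprod_lw_zero, formInner_smul_right]
    simp [formInner]
  have h4 := formInner_comm (hT_isInvertible hr hg) (hT_symm (H := H) hrs hgs)
    (lw (ν ∘L pB A B) (ψ.compContinuousLinearMap (pA A B)))
    (a.compContinuousLinearMap (pA A B))
  rw [h1] at h4
  rw [preFlux, formInner_add_left, formInner_add_right, formInner_add_right, formInner_smul_left,
    formInner_smul_right, formInner_smul_left, formInner_smul_right, hco.formInner_comp, h1, h2,
    h3, ← h4]
  ring

/-- Contraction gives `v ⌟ F = du(v) Φ - du ∧ (v ⌟ Φ)`. The second part is orthogonal to every form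
annihilated by `∂_v`, in particular to `Φ` and to `w ⌟ F`. -/
theorem formInner_iprod_flux (hr : r.IsInvertible) (hrs : ∀ v w, r v w = r w v)
    (hg : g.IsInvertible) (hgs : ∀ v w, g v w = g w v) (v w : Tot A B) :
    formInner (hT r H g) (iprod v (lw (cu A B) (preFlux a ψ ν φ)))
        (iprod w (lw (cu A B) (preFlux a ψ ν φ))) =
      v.1.1 * w.1.1 *
        (φ ^ 2 * formInner r a a + formInner r ψ ψ * formInner g (oneForm ν) (oneForm ν)) := by
  have hsub : ∀ v : Tot A B, iprod v (lw (cu A B) (preFlux a ψ ν φ)) = v.1.1 • preFlux a ψ ν φ +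
      lw (cu A B) ((-1 : ℝ) • iprod v (preFlux a ψ ν φ)) := fun v => by
    rw [iprod_lw, lw_smul]
    ext z
    simp only [ContinuousAlternatingMap.sub_apply, ContinuousAlternatingMap.add_apply,
      ContinuousAlternatingMap.smul_apply, smul_eq_mul, cu_apply]
    ring
  have hcomm := formInner_comm (hT_isInvertible hr hg) (hT_symm (H := H) hrs hgs)
    (preFlux a ψ ν φ) (lw (cu A B) ((-1 : ℝ) • iprod w (preFlux a ψ ν φ)))
  rw [formInner_lw_cu hr hg _ _ (iprod_ev_preFlux a ψ ν φ)] at hcomm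
  conv_lhs => rw [hsub v]
  rw [formInner_add_left, formInner_lw_cu hr hg _ _ (iprod_ev_iprod_flux a ψ ν φ w), hsub w,
    formInner_smul_left, formInner_add_right, formInner_smul_right, hcomm,
    formInner_preFlux a ψ ν φ hr hrs hg hgs]
  ring

end Flux

end Model

end Sugra

end

noncomputable section

namespace Sugra

theorem iprod_sub {V : Type*} [NormedAddCommGroup V] [NormedSpace ℝ V] {k : ℕ} (v : V)
    (η η' : V [⋀^Fin (k + 1)]→L[ℝ] ℝ) : iprod v (η - η') = iprod v η - iprod v η' := rfl

theorem lw_sub {V : Type*} [NormedAddCommGroup V] [NormedSpace ℝ V] {k : ℕ} (ξ : V →L[ℝ] ℝ)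
    (η η' : V [⋀^Fin k]→L[ℝ] ℝ) : lw ξ (η - η') = lw ξ η - lw ξ η' := by
  ext v; simp [lw_apply, mul_sub, Finset.sum_sub_distrib]

/-- The constant zero-form `1`. -/
def oneZeroForm (V : Type*) [NormedAddCommGroup V] [NormedSpace ℝ V] : V [⋀^Fin 0]→L[ℝ] ℝ :=
  ContinuousAlternatingMap.constOfIsEmpty ℝ V (Fin 0) (1 : ℝ)

theorem oneZeroForm_apply {V : Type*} [NormedAddCommGroup V] [NormedSpace ℝ V] (v : Fin 0 → V) :
    oneZeroForm V v = 1 := rfl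

/-! ### Pseudo-orthonormal frames. -/

section Gram

variable {V : Type*} [NormedAddCommGroup V] [NormedSpace ℝ V]

/-- A tuple of pairwise orthogonal vectors of square norm `±1`. -/
def PseudoOrthonormal {n : ℕ} (G : V →L[ℝ] V →L[ℝ] ℝ) (b : Fin n → V) : Prop :=
  (∀ i j, i ≠ j → G (b i) (b j) = 0) ∧ ∀ i, |G (b i) (b i)| = 1

theorem PseudoOrthonormal.cons {n : ℕ} {G : V →L[ℝ] V →L[ℝ] ℝ} (hs : ∀ v w, G v w = G w v)
    {b : Fin n → V} (hb : PseudoOrthonormal G b) {x : V} (hx : |G x x| = 1)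
    (hxb : ∀ j, G x (b j) = 0) : PseudoOrthonormal G (Fin.cons x b : Fin (n + 1) → V) := by
  refine ⟨fun i j => ?_, fun i => ?_⟩
  · refine Fin.cases ?_ (fun i => ?_) i <;> refine Fin.cases ?_ (fun j => ?_) j
    · intro h; exact absurd rfl h
    · intro _; simpa using hxb j
    · intro _; simpa using (hs _ _).trans (hxb i)
    · intro h; simpa using hb.1 i j fun hij => h (by rw [hij])
  · refine Fin.cases ?_ (fun i => ?_) i
    · simpa using hx
    · simpa using hb.2 i

theorem PseudoOrthonormal.abs_det {n : ℕ} {G : V →L[ℝ] V →L[ℝ] ℝ} {b : Fin n → V}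
    (hb : PseudoOrthonormal G b) : |(Matrix.of fun i j => G (b i) (b j)).det| = 1 := by
  have : (Matrix.of fun i j => G (b i) (b j)) = Matrix.diagonal fun i => G (b i) (b i) := by
    ext i j
    by_cases h : i = j
    · subst h; simp
    · simp [h, hb.1 i j h]
  rw [this, Matrix.det_diagonal, Finset.abs_prod]
  exact Finset.prod_eq_one fun i _ => hb.2 i

end Gram

section HodgeLow

variable {V : Type*} [NormedAddCommGroup V] [NormedSpace ℝ V] [FiniteDimensional ℝ V]
  {G : V →L[ℝ] V →L[ℝ] ℝ}

theorem hodge_lw_lw {m : ℕ} (hG : G.IsInvertible) (hs : ∀ v w, G v w = G w v)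
    (ξ₀ ξ₁ : V →L[ℝ] ℝ) (vol : V [⋀^Fin (m + 2)]→L[ℝ] ℝ) :
    hodge G vol (lw ξ₀ (lw ξ₁ (oneZeroForm V))) =
      iprod (G.inverse ξ₁) (iprod (k := m + 1) (G.inverse ξ₀) vol) := by
  rw [hodge_lw hG hs, hodge_lw hG hs, hodge_constOfIsEmpty, oneZeroForm_apply, one_smul]

theorem hodge_lw_lw_lw {m : ℕ} (hG : G.IsInvertible) (hs : ∀ v w, G v w = G w v)
    (ξ₀ ξ₁ ξ₂ : V →L[ℝ] ℝ) (vol : V [⋀^Fin (m + 3)]→L[ℝ] ℝ) :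
    hodge G vol (lw ξ₀ (lw ξ₁ (lw ξ₂ (oneZeroForm V)))) =
      iprod (G.inverse ξ₂) (iprod (k := m + 1) (G.inverse ξ₁)
        (iprod (k := m + 2) (G.inverse ξ₀) vol)) := by
  rw [hodge_lw hG hs, hodge_lw_lw hG hs]

end HodgeLow

/-! ### Contractions of a product of covectors with dual vectors. -/

section DualContraction

variable {V : Type*} [NormedAddCommGroup V] [NormedSpace ℝ V]

theorem iprod_lw_of_eq_zero {k : ℕ} {v : V} {ξ : V →L[ℝ] ℝ} (h : ξ v = 0)
    (η : V [⋀^Fin (k + 1)]→L[ℝ] ℝ) : iprod v (lw ξ η) = -lw ξ (iprod v η) := by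
  rw [iprod_lw, h]
  ext w
  simp

theorem iprod_lw_eq_zero {k : ℕ} {v : V} {ξ : V →L[ℝ] ℝ} (h : ξ v = 0)
    {η : V [⋀^Fin (k + 1)]→L[ℝ] ℝ} (hη : iprod v η = 0) : iprod v (lw ξ η) = 0 := by
  rw [iprod_lw_of_eq_zero h, hη, lw_zero, neg_zero]

theorem iprod_lw_of_eq_one {k : ℕ} {v : V} {ξ : V →L[ℝ] ℝ} (h : ξ v = 1)
    {η : V [⋀^Fin (k + 1)]→L[ℝ] ℝ} (hη : iprod v η = 0) : iprod v (lw ξ η) = η := by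
  rw [iprod_lw, h, hη, lw_zero]
  ext w
  simp

variable {k : ℕ} {c : V →L[ℝ] ℝ} {X : Fin 3 → V →L[ℝ] ℝ} {x : Fin 3 → V}
  {Q : V [⋀^Fin (k + 1)]→L[ℝ] ℝ}

/-- This and the next five lemmas tabulate the signs needed for the star: each contraction picks up
a sign for every covector it crosses, the leading `c` included. -/
theorem iprod_dual_zero (hc : ∀ i, c (x i) = 0) (hX : ∀ i, X i (x i) = 1)
    (hX' : ∀ i j, i ≠ j → X i (x j) = 0) (hQ : ∀ i, iprod (x i) Q = 0) :
    iprod (k := k + 4) (x 0) (lw c (lw (X 0) (lw (X 1) (lw (X 2) Q)))) =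
    -lw c (lw (X 1) (lw (X 2) Q)) := by
  rw [iprod_lw_of_eq_zero (hc 0), iprod_lw_of_eq_one (hX 0)
    (iprod_lw_eq_zero (hX' 1 0 (by decide)) (iprod_lw_eq_zero (hX' 2 0 (by decide)) (hQ 0)))]

theorem iprod_dual_one (hc : ∀ i, c (x i) = 0) (hX : ∀ i, X i (x i) = 1)
    (hX' : ∀ i j, i ≠ j → X i (x j) = 0) (hQ : ∀ i, iprod (x i) Q = 0) :
    iprod (k := k + 4) (x 1) (lw c (lw (X 0) (lw (X 1) (lw (X 2) Q)))) =
    lw c (lw (X 0) (lw (X 2) Q)) := by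
  rw [iprod_lw_of_eq_zero (hc 1), iprod_lw_of_eq_zero (hX' 0 1 (by decide)),
    iprod_lw_of_eq_one (hX 1) (iprod_lw_eq_zero (hX' 2 1 (by decide)) (hQ 1)), lw_neg, neg_neg]

theorem iprod_dual_zero_one (hc : ∀ i, c (x i) = 0) (hX : ∀ i, X i (x i) = 1)
    (hX' : ∀ i j, i ≠ j → X i (x j) = 0) (hQ : ∀ i, iprod (x i) Q = 0) :
    iprod (k := k + 3) (x 1) (iprod (k := k + 4) (x 0)
    (lw c (lw (X 0) (lw (X 1) (lw (X 2) Q))))) = lw c (lw (X 2) Q) := by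
  rw [iprod_dual_zero hc hX hX' hQ, iprod_neg, iprod_lw_of_eq_zero (hc 1),
    iprod_lw_of_eq_one (hX 1) (iprod_lw_eq_zero (hX' 2 1 (by decide)) (hQ 1)), neg_neg]

theorem iprod_dual_zero_two (hc : ∀ i, c (x i) = 0) (hX : ∀ i, X i (x i) = 1)
    (hX' : ∀ i j, i ≠ j → X i (x j) = 0) (hQ : ∀ i, iprod (x i) Q = 0) :
    iprod (k := k + 3) (x 2) (iprod (k := k + 4) (x 0)
    (lw c (lw (X 0) (lw (X 1) (lw (X 2) Q))))) = -lw c (lw (X 1) Q) := by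
  rw [iprod_dual_zero hc hX hX' hQ, iprod_neg, iprod_lw_of_eq_zero (hc 2),
    iprod_lw_of_eq_zero (hX' 1 2 (by decide)), iprod_lw_of_eq_one (hX 2) (hQ 2), lw_neg, neg_neg]

theorem iprod_dual_one_two (hc : ∀ i, c (x i) = 0) (hX : ∀ i, X i (x i) = 1)
    (hX' : ∀ i j, i ≠ j → X i (x j) = 0) (hQ : ∀ i, iprod (x i) Q = 0) :
    iprod (k := k + 3) (x 2) (iprod (k := k + 4) (x 1)
    (lw c (lw (X 0) (lw (X 1) (lw (X 2) Q))))) = lw c (lw (X 0) Q) := by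
  rw [iprod_dual_one hc hX hX' hQ, iprod_lw_of_eq_zero (hc 2),
    iprod_lw_of_eq_zero (hX' 0 2 (by decide)), iprod_lw_of_eq_one (hX 2) (hQ 2), lw_neg, neg_neg]

theorem iprod_dual_zero_one_two (hc : ∀ i, c (x i) = 0) (hX : ∀ i, X i (x i) = 1)
    (hX' : ∀ i j, i ≠ j → X i (x j) = 0) (hQ : ∀ i, iprod (x i) Q = 0) :
    iprod (k := k + 2) (x 2) (iprod (k := k + 3) (x 1)
    (iprod (k := k + 4) (x 0) (lw c (lw (X 0) (lw (X 1) (lw (X 2) Q)))))) = -lw c Q := by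
  rw [iprod_dual_zero_one hc hX hX' hQ, iprod_lw_of_eq_zero (hc 2),
    iprod_lw_of_eq_one (hX 2) (hQ 2)]

end DualContraction

/-! ### The Hodge star of the flux form at one point. -/

section Star

variable {A B : Type*} [NormedAddCommGroup A] [NormedSpace ℝ A] [NormedAddCommGroup B]
  [NormedSpace ℝ B]

/-- The tuple `(∂_u, ∂_v, a₀, a₁, a₂, b₀, b₁, …)`. -/
def frame {k : ℕ} (a : Fin 3 → A) (b : Fin k → B) : Fin (k + 5) → Tot A B :=
  Fin.cons (eu A B) (Fin.cons (ev A B) (Fin.cons (iA A B (a 0)) (Fin.cons (iA A B (a 1))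
    (Fin.cons (iA A B (a 2)) fun i => iB A B (b i)))))

/-- The form `ξ₀ ∧ ξ₁ ∧ ξ₂ ∧ Q` on the total space. -/
def tripleForm {k : ℕ} (ξ : Fin 3 → A →L[ℝ] ℝ) (Q : Tot A B [⋀^Fin k]→L[ℝ] ℝ) :
    Tot A B [⋀^Fin (k + 3)]→L[ℝ] ℝ :=
  lw (ξ 0 ∘L pA A B) (lw (ξ 1 ∘L pA A B) (lw (ξ 2 ∘L pA A B) Q))

theorem iprod_tripleForm {k : ℕ} (ξ : Fin 3 → A →L[ℝ] ℝ) (Q : Tot A B [⋀^Fin (k + 1)]→L[ℝ] ℝ)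
    {x : Tot A B} (hx : x.1.2.1 = 0) :
    iprod (k := k + 3) x (tripleForm ξ Q) = -tripleForm ξ (iprod x Q) := by
  simp [tripleForm, iprod_lw, hx, lw_neg]

theorem tripleForm_zero {k : ℕ} (ξ : Fin 3 → A →L[ℝ] ℝ) :
    tripleForm ξ (0 : Tot A B [⋀^Fin k]→L[ℝ] ℝ) = 0 := by
  simp [tripleForm, lw_zero]

/-- Vectors tangent to `A` annihilate `Q`, so the three contractions only see the `ξ i`. -/
theorem iprod_tripleForm_iA {k : ℕ} (ξ : Fin 3 → A →L[ℝ] ℝ)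
    (Q : B [⋀^Fin (k + 1)]→L[ℝ] ℝ) (a : Fin 3 → A) (b : Fin (k + 1) → B) :
    iprod (iA A B (a 2)) (iprod (k := k + 2) (iA A B (a 1)) (iprod (k := k + 3) (iA A B (a 0))
      (tripleForm ξ (Q.compContinuousLinearMap (pB A B))))) (fun i => iB A B (b i)) =
      lw (ξ 0) (lw (ξ 1) (lw (ξ 2) (oneZeroForm A))) a * Q b := by
  have hQ : ∀ a : A, iprod (iA A B a) (Q.compContinuousLinearMap (pB A B)) = 0 := fun a =>
    iprod_pull_eq_zero _ (by simp [iA]) Q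
  have ha : a = Fin.cons (a 0) (Fin.cons (a 1) (Fin.cons (a 2) ![])) := by
    funext i
    fin_cases i <;> rfl
  have h2 : lw (ξ 0) (lw (ξ 1) (lw (ξ 2) (oneZeroForm A))) a =
      iprod (a 2) (iprod (a 1) (iprod (a 0) (lw (ξ 0) (lw (ξ 1) (lw (ξ 2) (oneZeroForm A))))))
        ![] := by
    conv_lhs => rw [ha]
    rfl
  rw [h2]
  simp only [tripleForm, iprod_lw, iprod_sub, iprod_smul, lw_sub, lw_smul, iprod_lw_zero, hQ,
    lw_zero, iprod_zero, ContinuousAlternatingMap.sub_apply, ContinuousAlternatingMap.smul_apply,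
    smul_eq_mul, oneZeroForm_apply, ContinuousAlternatingMap.compContinuousLinearMap_apply,
    ContinuousLinearMap.comp_apply]
  simp [iA, iB, Function.comp_def]
  ring

theorem pull_frame_apply {k : ℕ} (ξ : Fin 3 → A →L[ℝ] ℝ)
    (Q : B [⋀^Fin (k + 1)]→L[ℝ] ℝ) (a : Fin 3 → A) (b : Fin (k + 1) → B) :
    lw (cu A B) (lw (cv A B) (tripleForm ξ (Q.compContinuousLinearMap (pB A B)))) (frame a b) =
      lw (ξ 0) (lw (ξ 1) (lw (ξ 2) (oneZeroForm A))) a * Q b := by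
  rw [← iprod_tripleForm_iA (B := B) ξ Q a b]
  have h1 : iprod (k := k + 4) (ev A B) (iprod (k := k + 5) (eu A B) (lw (cu A B) (lw (cv A B)
      (tripleForm ξ (Q.compContinuousLinearMap (pB A B)))))) =
      tripleForm ξ (Q.compContinuousLinearMap (pB A B)) := by
    have h2 : ∀ x : Tot A B, x.1.2.1 = 0 → x.2 = 0 → iprod (k := k + 3) x
        (tripleForm ξ (Q.compContinuousLinearMap (pB A B))) = 0 := fun x h h' => by
      rw [iprod_tripleForm ξ _ h, iprod_pull_eq_zero _ h', tripleForm_zero, neg_zero]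
    have hu := h2 (eu A B) rfl rfl
    have hv := h2 (ev A B) rfl rfl
    rw [iprod_lw, iprod_lw, hu]
    simp only [iprod_sub, iprod_smul, lw_zero, iprod_lw, hv, sub_zero]
    simp [eu, ev, lw_zero]
  conv_rhs => rw [← h1]
  rfl


variable [FiniteDimensional ℝ A] [FiniteDimensional ℝ B]
  {r : A →L[ℝ] A →L[ℝ] ℝ} {H : ℝ} {g : B →L[ℝ] B →L[ℝ] ℝ}

theorem IsVolumeForm.sq_eq_one {V : Type*} [NormedAddCommGroup V] [NormedSpace ℝ V] {n : ℕ}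
    {G : V →L[ℝ] V →L[ℝ] ℝ} {vol : V [⋀^Fin n]→L[ℝ] ℝ} (hvol : IsVolumeForm G vol)
    {b : Fin n → V} (hb : PseudoOrthonormal G b) : vol b ^ 2 = 1 :=
  (hvol b).trans hb.abs_det

theorem pseudoOrthonormal_of_basis {V : Type*} [NormedAddCommGroup V] [NormedSpace ℝ V] {n : ℕ}
    {G : V →L[ℝ] V →L[ℝ] ℝ} {e : Fin n → V}
    (he : ∀ i j, G (e i) (e j) = if i = j then -1 else 0) : PseudoOrthonormal G e :=
  ⟨fun i j h => by simp [he, h], fun i => by simp [he]⟩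

/-- A pseudo-orthonormal frame of the total space. -/
def orthoFrame (H : ℝ) {k : ℕ} (a : Fin 3 → A) (b : Fin k → B) : Fin (k + 5) → Tot A B :=
  Fin.cons ((1, (0, (1 - H) / 2)), 0) (Fin.cons ((1, (0, (-1 - H) / 2)), 0)
    (Fin.cons (iA A B (a 0)) (Fin.cons (iA A B (a 1))
      (Fin.cons (iA A B (a 2)) fun i => iB A B (b i)))))

/-- The first two vectors are `∂_u + c ∂_v` with `c = (±1 - H) / 2`, so that `2 c + H = ±1`, while
the two values of `c` add up to `-H` and make them orthogonal. -/
theorem pseudoOrthonormal_orthoFrame (hrs : ∀ v w, r v w = r w v) (hgs : ∀ v w, g v w = g w v)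
    {k : ℕ} {a : Fin 3 → A} {b : Fin k → B} (ha : PseudoOrthonormal r a)
    (hb : PseudoOrthonormal g b) :
    PseudoOrthonormal (hT r H g) (orthoFrame H a b) := by
  have hs := hT_symm (H := H) hrs hgs
  have h0 : PseudoOrthonormal (hT r H g) fun i => iB A B (b i) :=
    ⟨fun i j h => by simpa [hT_apply, iB] using hb.1 i j h,
      fun i => by simpa [hT_apply, iB] using hb.2 i⟩
  refine PseudoOrthonormal.cons hs (PseudoOrthonormal.cons hs (PseudoOrthonormal.cons hs
    (PseudoOrthonormal.cons hs (PseudoOrthonormal.cons hs h0 ?_ ?_) ?_ ?_) ?_ ?_) ?_ ?_) ?_ ?_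
  · simpa [hT_apply, iA] using ha.2 2
  · intro j; simp [hT_apply, iA, iB]
  · simpa [hT_apply, iA] using ha.2 1
  · intro j
    refine Fin.cases ?_ (fun j => ?_) j
    · simpa [hT_apply, iA] using ha.1 1 2 (by decide)
    · simp [hT_apply, iA, iB]
  · simpa [hT_apply, iA] using ha.2 0
  · intro j
    refine Fin.cases ?_ (fun j => Fin.cases ?_ (fun j => ?_) j) j
    · simpa [hT_apply, iA] using ha.1 0 1 (by decide)
    · simpa [hT_apply, iA] using ha.1 0 2 (by decide)
    · simp [hT_apply, iA, iB]
  · have : (-1 - H) / 2 + (-1 - H) / 2 + H = -1 := by ring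
    simp only [hT_apply, map_zero, mul_one, one_mul, add_zero, this]
    simp
  · intro j
    refine Fin.cases ?_ (fun j => Fin.cases ?_ (fun j => Fin.cases ?_ (fun j => ?_) j) j) j <;>
      simp only [Fin.cons_succ, Fin.cons_zero, hT_apply, iA, iB] <;> simp
  · have : (1 - H) / 2 + (1 - H) / 2 + H = 1 := by ring
    simp only [hT_apply, map_zero, mul_one, one_mul, add_zero, this]
    simp
  · intro j
    refine Fin.cases ?_ (fun j => Fin.cases ?_ (fun j => Fin.cases ?_ (fun j =>
      Fin.cases ?_ (fun j => ?_) j) j) j) j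
    · simp [hT_apply]; ring
    all_goals
      simp only [Fin.cons_succ, Fin.cons_zero, hT_apply, iA, iB]
      simp

/-- The minus sign is the value of `du ∧ dv` on the first two vectors, `(-1 - H) / 2 - (1 - H) / 2 =
-1`. -/
theorem pull_orthoFrame_apply {k : ℕ} (ξ : Fin 3 → A →L[ℝ] ℝ)
    (Q : B [⋀^Fin (k + 1)]→L[ℝ] ℝ) (a : Fin 3 → A) (b : Fin (k + 1) → B) :
    lw (cu A B) (lw (cv A B) (tripleForm ξ (Q.compContinuousLinearMap (pB A B))))
      (orthoFrame H a b) = -(lw (ξ 0) (lw (ξ 1) (lw (ξ 2) (oneZeroForm A))) a * Q b) := by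
  rw [← iprod_tripleForm_iA (B := B) ξ Q a b]
  have h2 : ∀ x : Tot A B, x.1.2.1 = 0 → x.2 = 0 → iprod (k := k + 3) x
      (tripleForm ξ (Q.compContinuousLinearMap (pB A B))) = 0 := fun x h h' => by
    rw [iprod_tripleForm ξ _ h, iprod_pull_eq_zero _ h', tripleForm_zero, neg_zero]
  have h1 : iprod (k := k + 4) ((1, (0, (-1 - H) / 2)), 0) (iprod (k := k + 5)
      ((1, (0, (1 - H) / 2)), 0) (lw (cu A B) (lw (cv A B)
      (tripleForm ξ (Q.compContinuousLinearMap (pB A B)))))) =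
      -tripleForm ξ (Q.compContinuousLinearMap (pB A B)) := by
    have hu := h2 ((1, (0, (-1 - H) / 2)), 0) rfl rfl
    have hv := h2 ((1, (0, (1 - H) / 2)), 0) rfl rfl
    rw [iprod_lw, iprod_lw, hv]
    simp only [iprod_sub, iprod_smul, lw_zero, iprod_lw, hu, sub_zero, lw_smul]
    ext w
    simp only [ContinuousAlternatingMap.sub_apply, ContinuousAlternatingMap.smul_apply,
      ContinuousAlternatingMap.neg_apply, smul_eq_mul, cu_apply, cv_apply]
    ring
  have h3 := congrArg (fun η => iprod (iA A B (a 2)) (iprod (k := k + 2) (iA A B (a 1))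
    (iprod (k := k + 3) (iA A B (a 0)) η)) (fun i => iB A B (b i))) h1
  exact h3

/-- The forms compared are of top degree, and each takes a value of square one on a
pseudo-orthonormal frame; the ratios are therefore signs, recording the orientations. -/
theorem volume_decomposition {k : ℕ} (hA : Module.finrank ℝ A = 3)
    (hB : Module.finrank ℝ B = k + 1) (hr : IsNegDef r) (hg : IsNegDef g)
    {volA : A [⋀^Fin 3]→L[ℝ] ℝ} (hvolA : IsVolumeForm r volA)
    {volB : B [⋀^Fin (k + 1)]→L[ℝ] ℝ} (hvolB : IsVolumeForm g volB)
    {volX : Tot A B [⋀^Fin (k + 6)]→L[ℝ] ℝ} (hvolX : IsVolumeForm (hT r H g) volX) :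
    ∃ (e : Module.Basis (Fin 3) ℝ A) (ξ : Fin 3 → A →L[ℝ] ℝ) (σ s : ℝ),
      (∀ i j, r (e i) (e j) = if i = j then -1 else 0) ∧
      (∀ i j, ξ i (e j) = if i = j then 1 else 0) ∧ σ ^ 2 = 1 ∧ s ^ 2 = 1 ∧
      volA = s • lw (ξ 0) (lw (ξ 1) (lw (ξ 2) (oneZeroForm A))) ∧
      volX = σ • lw (cu A B) (lw (cv A B)
        (tripleForm ξ (volB.compContinuousLinearMap (pB A B)))) := by
  obtain ⟨e, he⟩ := hr.exists_orthonormal hA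
  obtain ⟨m, hm⟩ := hg.exists_orthonormal hB
  let ξ : Fin 3 → A →L[ℝ] ℝ := fun i => (e.coord i).toContinuousLinearMap
  have hξ : ∀ i j, ξ i (e j) = if i = j then 1 else 0 := fun i j => by
    simp [ξ, Finsupp.single_apply, eq_comm]
  have h3 : lw (ξ 0) (lw (ξ 1) (lw (ξ 2) (oneZeroForm A))) e = 1 := by
    have ha : ⇑e = Fin.cons (e 0) (Fin.cons (e 1) (Fin.cons (e 2) ![])) := by
      funext i
      fin_cases i <;> rfl
    have h2 : lw (ξ 0) (lw (ξ 1) (lw (ξ 2) (oneZeroForm A))) e =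
        iprod (e 2) (iprod (e 1) (iprod (e 0) (lw (ξ 0) (lw (ξ 1) (lw (ξ 2) (oneZeroForm A))))))
          ![] := by
      conv_lhs => rw [ha]
      rfl
    rw [h2]
    simp [iprod_lw, iprod_lw_zero, hξ, lw_zero, oneZeroForm_apply]
  have hs := hvolA.sq_eq_one (pseudoOrthonormal_of_basis he)
  have hmB := hvolB.sq_eq_one (pseudoOrthonormal_of_basis hm)
  have hX := hvolX.sq_eq_one (pseudoOrthonormal_orthoFrame (H := H) hr.1 hg.1
    (pseudoOrthonormal_of_basis he) (pseudoOrthonormal_of_basis hm))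
  have hΩ := pull_orthoFrame_apply (H := H) ξ volB e m
  rw [h3, one_mul] at hΩ
  have hmB0 : volB m ≠ 0 := fun h => by simp [h] at hmB
  have hdim : Module.finrank ℝ (Tot A B) = k + 6 := by
    simp only [Module.finrank_prod, Module.finrank_self, hA, hB]
    omega
  have hΩ0 : lw (cu A B) (lw (cv A B) (tripleForm ξ (volB.compContinuousLinearMap (pB A B))))
      (orthoFrame H e m) ≠ 0 := by
    rw [hΩ]
    exact neg_ne_zero.mpr hmB0
  -- `σ` is the ratio of the two top forms on the frame, filled in by `top_form_eq_smul`.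
  refine ⟨e, ξ, _, volA e, he, hξ, ?_, hs, ?_, top_form_eq_smul hdim volX
    (lw (cu A B) (lw (cv A B) (tripleForm ξ (volB.compContinuousLinearMap (pB A B)))))
    (orthoFrame H e m) hΩ0⟩
  · rw [hΩ, div_pow, neg_sq, hX, hmB, div_one]
  · have := top_form_eq_smul hA volA (lw (ξ 0) (lw (ξ 1) (lw (ξ 2) (oneZeroForm A)))) e
      (by rw [h3]; exact one_ne_zero)
    rwa [h3, div_one] at this

-- Contracting `volX` with `∂_v` accounts for the factor `du` of the flux; the star of what remains
-- is an iterated contraction in the coframe `ξ`. The sign `τ` depends on neither the functions nor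
-- the covectors and is read off from `volX` on a `frame`, which is what later makes it locally
-- constant.
set_option maxHeartbeats 1600000 in
theorem hodge_flux {k : ℕ} (hA : Module.finrank ℝ A = 3)
    (hB : Module.finrank ℝ B = k + 2) (hr : IsNegDef r) (hg : IsNegDef g)
    {volA : A [⋀^Fin 3]→L[ℝ] ℝ} (hvolA : IsVolumeForm r volA)
    {volB : B [⋀^Fin (k + 2)]→L[ℝ] ℝ} (hvolB : IsVolumeForm g volB)
    {volX : Tot A B [⋀^Fin (k + 3 + 4)]→L[ℝ] ℝ} (hvolX : IsVolumeForm (hT r H g) volX) :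
    ∃ τ : ℝ, τ ^ 2 = 1 ∧ (∀ a b, volX (frame a b) = τ * (volA a * volB b)) ∧
      ∀ (f φ l : ℝ) (df : A →L[ℝ] ℝ) (ν : B →L[ℝ] ℝ),
        hodge (m := k + 3) (hT r H g) volX (lw (cu A B) (preFlux (f • volA)
            (-(1 / l) • hodge (k := 1) (m := 2) r volA (oneForm df)) ν φ)) =
          (-τ) • lw (cu A B) ((φ * f) • volB.compContinuousLinearMap (pB A B) +
            (1 / l) • lw (df ∘L pA A B) ((hodge (k := 1) (m := k + 1) g volB
              (oneForm ν)).compContinuousLinearMap (pB A B))) := by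
  obtain ⟨e, ξ, σ, s, he, hξ, hσ, hs, hvA, hvX⟩ :=
    volume_decomposition hA hB hr hg hvolA hvolB hvolX
  refine ⟨σ * s, by rw [mul_pow, hσ, hs, one_mul], fun a b => ?_, fun f φ l df ν => ?_⟩
  · have hX : volX (frame a b) = σ * lw (cu A B) (lw (cv A B) (tripleForm ξ
        (volB.compContinuousLinearMap (pB A B)))) (frame a b) := by rw [hvX]; rfl
    have ha : volA a = s * lw (ξ 0) (lw (ξ 1) (lw (ξ 2) (oneZeroForm A))) a := by rw [hvA]; rfl
    rw [hX, ha, pull_frame_apply]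
    linear_combination (-(σ * (lw (ξ 0) (lw (ξ 1) (lw (ξ 2) (oneZeroForm A))) a * volB b))) * hs
  · have hri := hr.isInvertible
    have hgi := hg.isInvertible
    have hG : (hT r H g).IsInvertible := hT_isInvertible hri hgi
    have hGs := hT_symm (H := H) hr.1 hg.1
    set Q := volB.compContinuousLinearMap (pB A B) with hQ
    set ξ' : Fin 3 → Tot A B →L[ℝ] ℝ := fun i => ξ i ∘L pA A B with hξ'
    -- `∂_v` crosses `du` before it meets `dv`, whence the sign.
    have hW : iprod (k := k + 3 + 3) (ev A B) volX = (-σ) • lw (cu A B) (tripleForm ξ Q) := by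
      have h1 : iprod (k := k + 4) (ev A B) (tripleForm ξ Q) = 0 := by
        rw [iprod_tripleForm ξ _ rfl, hQ, iprod_pull_eq_zero _ rfl, tripleForm_zero, neg_zero]
      have h2 : iprod (k := k + 6) (ev A B) (lw (cu A B) (lw (cv A B) (tripleForm ξ Q))) =
          (-1 : ℝ) • lw (cu A B) (tripleForm ξ Q) := by
        rw [iprod_lw, iprod_lw, h1]
        ext w
        simp [ev, lw_zero]
      rw [hvX]
      change σ • iprod (k := k + 6) (ev A B) (lw (cu A B) (lw (cv A B) (tripleForm ξ Q))) = _
      rw [h2, smul_smul, mul_neg_one]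
    have hpull1 : (oneZeroForm A).compContinuousLinearMap (pA A B) = oneZeroForm (Tot A B) := rfl
    have hpA : (f • volA).compContinuousLinearMap (pA A B) =
        (f * s) • lw (ξ' 0) (lw (ξ' 1) (lw (ξ' 2) (oneZeroForm (Tot A B)))) := by
      rw [hvA, smul_smul, ← hpull1, ← lw_compContinuousLinearMap, ← lw_compContinuousLinearMap,
        ← lw_compContinuousLinearMap]
      rfl
    set d : Fin 3 → ℝ := fun i => ξ i (r.inverse df) with hd
    -- The `d i` are the components of the gradient; the metric is negative, so lowering the index
    -- changes the sign.
    have hdf : df ∘L pA A B = (-1 : ℝ) • (d 0 • ξ' 0 + d 1 • ξ' 1 + d 2 • ξ' 2) := by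
      have h1 : df = (-1 : ℝ) • (d 0 • ξ 0 + d 1 • ξ 1 + d 2 • ξ 2) := by
        have hD : r.inverse df = ∑ i, d i • e i := by
          have hξe : ∀ i, ξ i = (e.coord i).toContinuousLinearMap := fun i => by
            apply ContinuousLinearMap.coe_injective
            refine e.ext fun j => ?_
            simp [hξ, Finsupp.single_apply, eq_comm]
          conv_lhs => rw [← e.sum_repr (r.inverse df)]
          refine Finset.sum_congr rfl fun i _ => ?_
          simp [hd, hξe]
        conv_lhs => rw [← hri.self_apply_inverse df, hD]
        apply ContinuousLinearMap.coe_injective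
        refine e.ext fun j => ?_
        simp only [Fin.sum_univ_three]
        fin_cases j <;> simp [he, hξ]
      conv_lhs => rw [h1]
      rfl
    have hψ : (-(1 / l) • hodge (k := 1) (m := 2) r volA (oneForm df)).compContinuousLinearMap
        (pA A B) = (-(1 / l) * s) • (d 0 • lw (ξ' 1) (lw (ξ' 2) (oneZeroForm (Tot A B))) -
          d 1 • lw (ξ' 0) (lw (ξ' 2) (oneZeroForm (Tot A B))) +
          d 2 • lw (ξ' 0) (lw (ξ' 1) (oneZeroForm (Tot A B)))) := by
      have h1 : iprod (r.inverse df) (lw (ξ 0) (lw (ξ 1) (lw (ξ 2) (oneZeroForm A)))) =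
          d 0 • lw (ξ 1) (lw (ξ 2) (oneZeroForm A)) - d 1 • lw (ξ 0) (lw (ξ 2) (oneZeroForm A)) +
          d 2 • lw (ξ 0) (lw (ξ 1) (oneZeroForm A)) := by
        rw [iprod_lw, iprod_lw, iprod_lw_zero]
        simp only [lw_sub, lw_smul]
        ext w
        simp only [ContinuousAlternatingMap.sub_apply, ContinuousAlternatingMap.add_apply,
          ContinuousAlternatingMap.smul_apply, smul_eq_mul, hd]
        ring
      have h2 : hodge (k := 1) (m := 2) r volA (oneForm df) = iprod (r.inverse df) volA :=
        hodge_oneForm hri hr.1 df volA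
      rw [h2, hvA, iprod_smul, h1, smul_smul, ← hpull1]
      simp only [hξ', ← lw_compContinuousLinearMap]
      rfl
    have hsharp : ∀ i, (hT r H g).inverse (ξ' i) = -iA A B (e i) := fun i => by
      have : r.inverse (ξ i) = -e i := by
        rw [hri.inverse_apply_eq]
        apply ContinuousLinearMap.coe_injective
        refine e.ext fun j => ?_
        simp only [ContinuousLinearMap.coe_coe, map_neg, _root_.neg_apply, he, hξ]
        split_ifs <;> simp
      rw [hξ', hT_inverse_pA hri hgi, this]
      simp [iA]
    have hstep : hodge (m := k + 3) (hT r H g) volX (lw (cu A B) (preFlux (f • volA)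
            (-(1 / l) • hodge (k := 1) (m := 2) r volA (oneForm df)) ν φ)) =
        (-σ) • hodge (m := k + 3) (k := 3) (hT r H g) (lw (cu A B) (tripleForm ξ Q))
          (preFlux (f • volA) (-(1 / l) • hodge (k := 1) (m := 2) r volA (oneForm df)) ν φ) := by
      have h1 := hodge_lw (m := k + 3) (k := 3) hG hGs (cu A B) (preFlux (f • volA)
            (-(1 / l) • hodge (k := 1) (m := 2) r volA (oneForm df)) ν φ) volX
      rw [hT_inverse_cu hri hgi, hW, hodge_smul_vol] at h1
      exact h1
    have hξ1 : ∀ i, ξ' i (iA A B (e i)) = 1 := fun i => (hξ i i).trans (if_pos rfl)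
    have hξ0 : ∀ i j, i ≠ j → ξ' i (iA A B (e j)) = 0 := fun i j h => (hξ i j).trans (if_neg h)
    have t3 : hodge (m := k + 3) (k := 3) (hT r H g) (lw (cu A B) (tripleForm ξ Q))
        (lw (ξ' 0) (lw (ξ' 1) (lw (ξ' 2) (oneZeroForm (Tot A B))))) = lw (cu A B) Q := by
      have h1 := hodge_lw_lw_lw (m := k + 3) hG hGs (ξ' 0) (ξ' 1) (ξ' 2)
        (lw (cu A B) (tripleForm ξ Q))
      rw [hsharp, hsharp, hsharp] at h1
      rw [h1]
      have hQ0 : ∀ a : A, iprod (iA A B a) Q = 0 := fun a => iprod_pull_eq_zero _ rfl volB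
      rw [iprod_neg_left, iprod_neg_left, iprod_neg_left, iprod_neg, iprod_neg, iprod_neg, neg_neg,
        neg_eq_iff_eq_neg]
      exact iprod_dual_zero_one_two (X := ξ') (x := fun i => iA A B (e i)) (fun i => rfl) hξ1 hξ0
        fun i => hQ0 _
    -- The signs in the expansion of the contracted volume match those of the double contractions,
    -- so the three terms reassemble into one covector built from `d`.
    have t2 : ∀ Q' : Tot A B [⋀^Fin (k + 1)]→L[ℝ] ℝ, (∀ a : A, iprod (iA A B a) Q' = 0) →
        hodge (m := k + 3) (k := 2) (hT r H g) (lw (cu A B) (tripleForm ξ Q'))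
          (d 0 • lw (ξ' 1) (lw (ξ' 2) (oneZeroForm (Tot A B))) -
            d 1 • lw (ξ' 0) (lw (ξ' 2) (oneZeroForm (Tot A B))) +
            d 2 • lw (ξ' 0) (lw (ξ' 1) (oneZeroForm (Tot A B)))) =
          lw (cu A B) (lw (d 0 • ξ' 0 + d 1 • ξ' 1 + d 2 • ξ' 2) Q') := by
      intro Q' hQ'
      have h1 : ∀ i j : Fin 3, hodge (m := k + 3) (k := 2) (hT r H g)
          (lw (cu A B) (tripleForm ξ Q')) (lw (ξ' i) (lw (ξ' j) (oneZeroForm (Tot A B)))) =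
          iprod (k := k + 3) (iA A B (e j)) (iprod (k := k + 4) (iA A B (e i))
            (lw (cu A B) (tripleForm ξ Q'))) := fun i j => by
        have h2 := hodge_lw_lw (m := k + 3) hG hGs (ξ' i) (ξ' j)
          (lw (cu A B) (tripleForm ξ Q'))
        rw [hsharp, hsharp, iprod_neg_left, iprod_neg_left, iprod_neg, neg_neg] at h2
        exact h2
      have hc : ∀ i, cu A B (iA A B (e i)) = 0 := fun _ => rfl
      have hQ'' : ∀ i, iprod (iA A B (e i)) Q' = 0 := fun i => hQ' _
      have h12 := (h1 1 2).trans
        (iprod_dual_one_two (X := ξ') (x := fun i => iA A B (e i)) hc hξ1 hξ0 hQ'')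
      have h02 := (h1 0 2).trans
        (iprod_dual_zero_two (X := ξ') (x := fun i => iA A B (e i)) hc hξ1 hξ0 hQ'')
      have h01 := (h1 0 1).trans
        (iprod_dual_zero_one (X := ξ') (x := fun i => iA A B (e i)) hc hξ1 hξ0 hQ'')
      rw [hodge_add, sub_eq_add_neg, hodge_add, ← neg_one_smul ℝ (d 1 • _), smul_smul, hodge_smul,
        hodge_smul, hodge_smul, h12, h02, h01, add_lw, add_lw, smul_lw, smul_lw, smul_lw, lw_add,
        lw_add, lw_smul, lw_smul, lw_smul]
      ext w
      simp only [ContinuousAlternatingMap.add_apply,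
        ContinuousAlternatingMap.smul_apply, ContinuousAlternatingMap.neg_apply, smul_eq_mul]
      ring
    -- The gradient of `ν` crosses `du` and three `ξ i`; the four signs cancel.
    have t1 : iprod (k := k + 5) (iB A B (g.inverse ν)) (lw (cu A B) (tripleForm ξ Q)) =
        lw (cu A B) (tripleForm ξ ((hodge (k := 1) (m := k + 1) g volB
              (oneForm ν)).compContinuousLinearMap (pB A B))) := by
      have h1 : hodge (k := 1) (m := k + 1) g volB (oneForm ν) = iprod (g.inverse ν) volB :=
        hodge_oneForm hgi hg.1 ν volB
      rw [iprod_lw, iprod_tripleForm ξ _ rfl, hQ, iprod_compContinuousLinearMap, h1, lw_neg]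
      simp [iB]
    rw [hstep, preFlux, hodge_add, hodge_smul, hpA, hodge_smul, hψ, t3]
    have t4 := hodge_lw (m := k + 3) (k := 2) hG hGs (ν ∘L pB A B) ((-(1 / l) * s) •
      (d 0 • lw (ξ' 1) (lw (ξ' 2) (oneZeroForm (Tot A B))) -
        d 1 • lw (ξ' 0) (lw (ξ' 2) (oneZeroForm (Tot A B))) +
        d 2 • lw (ξ' 0) (lw (ξ' 1) (oneZeroForm (Tot A B))))) (lw (cu A B) (tripleForm ξ Q))
    have t5 := t2 ((hodge (k := 1) (m := k + 1) g volB
              (oneForm ν)).compContinuousLinearMap (pB A B)) fun a => iprod_pull_eq_zero _ rfl _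
    rw [hT_inverse_pB hri hgi, t1, hodge_smul, t5] at t4
    rw [t4, hdf, smul_lw]
    simp only [lw_add, lw_smul]
    ext w
    simp only [ContinuousAlternatingMap.add_apply, ContinuousAlternatingMap.smul_apply,
      smul_eq_mul]
    ring

end Star

end Sugra

end

noncomputable section

namespace Sugra

/-! ### Closedness of the flux and of its star on the model space. -/

section LocalFlux

variable {A B : Type*} [NormedAddCommGroup A] [NormedSpace ℝ A] [NormedAddCommGroup B]
  [NormedSpace ℝ B]

open ContinuousAlternatingMap

theorem differentiableAt_pull_family {k : ℕ} {a : ℝ × A → A [⋀^Fin k]→L[ℝ] ℝ} {y : Tot A B}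
    (ha : DifferentiableAt ℝ a (cu A B y, pA A B y)) :
    DifferentiableAt ℝ (fun y => (a (cu A B y, pA A B y)).compContinuousLinearMap (pA A B)) y := by
  have h1 : DifferentiableAt ℝ (fun y => a (cu A B y, pA A B y)) y :=
    ha.comp (f := fun y => (cu A B y, pA A B y)) y ((cu A B).prod (pA A B)).differentiableAt
  exact (compContinuousLinearMapCLM (pA A B) :
    (A [⋀^Fin k]→L[ℝ] ℝ) →L[ℝ] _).differentiableAt.comp y h1

theorem differentiableAt_pull_pB {k : ℕ} {b : B → B [⋀^Fin k]→L[ℝ] ℝ} {y : Tot A B}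
    (hb : DifferentiableAt ℝ b (pB A B y)) :
    DifferentiableAt ℝ (fun y => (b (pB A B y)).compContinuousLinearMap (pB A B)) y :=
  (compContinuousLinearMapCLM (pB A B) :
    (B [⋀^Fin k]→L[ℝ] ℝ) →L[ℝ] _).differentiableAt.comp y (hb.comp y (pB A B).differentiableAt)

theorem differentiableAt_lw {V : Type*} [NormedAddCommGroup V] [NormedSpace ℝ V] {k : ℕ}
    {ν : V → V →L[ℝ] ℝ} {β : V → V [⋀^Fin k]→L[ℝ] ℝ} {x : V}
    (hν : DifferentiableAt ℝ ν x) (hβ : DifferentiableAt ℝ β x) :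
    DifferentiableAt ℝ (fun y => lw (ν y) (β y)) x :=
  ((lwL (V := V) k).hasFDerivAt_of_bilinear hν.hasFDerivAt hβ.hasFDerivAt).differentiableAt

/-- Under `du ∧` only derivatives along `A` and `B` count. The form `d_N a` vanishes for degree
reasons, `dφ ∧ a` equals `κ ν ∧ a`, and `d (ν ∧ ψ)` gives `-ν ∧ dψ = -κ ν ∧ a`. -/
theorem extDeriv_flux [FiniteDimensional ℝ A] (hA : Module.finrank ℝ A = 3)
    {a : ℝ × A → A [⋀^Fin 3]→L[ℝ] ℝ} {ψ : ℝ × A → A [⋀^Fin 2]→L[ℝ] ℝ} {ν : B → B →L[ℝ] ℝ}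
    {φ : B → ℝ} {κ : ℝ} {y : Tot A B} (ha : DifferentiableAt ℝ a (cu A B y, pA A B y))
    (hψ : DifferentiableAt ℝ ψ (cu A B y, pA A B y)) (hν : DifferentiableAt ℝ ν (pB A B y))
    (hφ : DifferentiableAt ℝ φ (pB A B y))
    (hsymm : ∀ v w, fderiv ℝ ν (pB A B y) v w = fderiv ℝ ν (pB A B y) w v)
    (hφν : fderiv ℝ φ (pB A B y) = κ • ν (pB A B y))
    (hψa : extDeriv (fun x => ψ (cu A B y, x)) (pA A B y) = κ • a (cu A B y, pA A B y)) :
    extDeriv (fun y => lw (cu A B) (preFlux (a (cu A B y, pA A B y)) (ψ (cu A B y, pA A B y))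
      (ν (pB A B y)) (φ (pB A B y)))) y = 0 := by
  have hp : HasFDerivAt (fun L : B →L[ℝ] ℝ => L ∘L pB A B)
      (ContinuousLinearMap.precomp ℝ (pB A B)) (ν (pB A B y)) :=
    (ContinuousLinearMap.precomp ℝ (pB A B)).hasFDerivAt
  have hνc : HasFDerivAt (fun y => ν (pB A B y) ∘L pB A B)
      (ContinuousLinearMap.precomp ℝ (pB A B) ∘L fderiv ℝ ν (pB A B y) ∘L pB A B) y :=
    hp.comp (f := fun y => ν (pB A B y)) y (hν.hasFDerivAt.comp y (pB A B).hasFDerivAt)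
  have hν' := hνc.differentiableAt
  have hφ' : HasFDerivAt (fun y => φ (pB A B y)) (κ • ν (pB A B y) ∘L pB A B) y := by
    have := hφ.hasFDerivAt.comp y (pB A B).hasFDerivAt
    rwa [hφν] at this
  have ha' := differentiableAt_pull_family (B := B) ha
  have hψ' := differentiableAt_pull_family (B := B) hψ
  have hs' : ∀ v w, fderiv ℝ (fun y => ν (pB A B y) ∘L pB A B) y v w =
      fderiv ℝ (fun y => ν (pB A B y) ∘L pB A B) y w v := by
    intro v w
    rw [hνc.fderiv]
    exact hsymm (pB A B v) (pB A B w)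
  have hd1 : DifferentiableAt ℝ (fun y => φ (pB A B y) •
      (a (cu A B y, pA A B y)).compContinuousLinearMap (pA A B)) y :=
    hφ'.differentiableAt.smul ha'
  have hd2 := differentiableAt_lw hν' hψ'
  have hd12 : DifferentiableAt ℝ (fun y => φ (pB A B y) •
      (a (cu A B y, pA A B y)).compContinuousLinearMap (pA A B) + lw (ν (pB A B y) ∘L pB A B)
        ((ψ (cu A B y, pA A B y)).compContinuousLinearMap (pA A B))) y := hd1.add hd2
  simp only [preFlux]
  rw [extDeriv_const_lw (cu A B) hd12, extDeriv_fun_add hd1 hd2,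
    extDeriv_smul_fun hφ'.differentiableAt ha', extDeriv_lw hν' hψ' hs', hφ'.fderiv,
    lw_add, lw_add, lw_smul, lw_neg, lw_lw (cu A B) (ν _ ∘L pB A B), neg_neg,
    lw_extDeriv_pull_family (cu A B) (pA A B) ha, lw_extDeriv_pull_family (cu A B) (pA A B) hψ, hψa,
    form_eq_zero_of_finrank_lt (extDeriv (fun z => a (cu A B y, z)) (pA A B y)) (by omega)]
  have e1 : (0 : A [⋀^Fin (3 + 1)]→L[ℝ] ℝ).compContinuousLinearMap (pA A B) = 0 := rfl
  have e2 : (κ • a (cu A B y, pA A B y)).compContinuousLinearMap (pA A B) =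
    κ • (a (cu A B y, pA A B y)).compContinuousLinearMap (pA A B) := rfl
  rw [e1, e2, lw_zero, lw_smul, lw_smul, smul_lw, lw_smul, lw_lw (cu A B)]
  ext w
  simp

/-- The derivative of `φ f vol_B` is `φ df ∧ vol_B`, since `dφ ∧ vol_B` exceeds the dimension of
`B`; the derivative of `l⁻¹ df ∧ μ` is `-l⁻¹ df ∧ dμ`, its opposite by `hμv`. -/
theorem extDeriv_star_flux [FiniteDimensional ℝ B] {k : ℕ} (hB : Module.finrank ℝ B = k + 1)
    {f : ℝ × A → ℝ} {φ : B → ℝ} {volB : B → B [⋀^Fin (k + 1)]→L[ℝ] ℝ}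
    {μ : B → B [⋀^Fin k]→L[ℝ] ℝ} {l τ : ℝ} (hl : l ≠ 0) {y : Tot A B}
    (hf : ContDiffAt ℝ 2 f (cu A B y, pA A B y)) (hφ : DifferentiableAt ℝ φ (pB A B y))
    (hvol : DifferentiableAt ℝ volB (pB A B y)) (hμ : DifferentiableAt ℝ μ (pB A B y))
    (hμv : extDeriv μ (pB A B y) = (l * φ (pB A B y)) • volB (pB A B y)) :
    extDeriv (fun y => (-τ) • lw (cu A B) ((φ (pB A B y) * f (cu A B y, pA A B y)) •
      (volB (pB A B y)).compContinuousLinearMap (pB A B) +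
      (1 / l) • lw (fderiv ℝ (fun x => f (cu A B y, x)) (pA A B y) ∘L pA A B)
        ((μ (pB A B y)).compContinuousLinearMap (pB A B)))) y = 0 := by
  let F : Tot A B → ℝ := fun y => f (cu A B y, pA A B y)
  have hF : ContDiffAt ℝ 2 F y :=
    hf.comp (f := fun y => (cu A B y, pA A B y)) y ((cu A B).prod (pA A B)).contDiff.contDiffAt
  have hev : ∀ᶠ z in nhds y, DifferentiableAt ℝ f (cu A B z, pA A B z) := by
    have h1 : ∀ᶠ p in nhds (cu A B y, pA A B y), ContDiffAt ℝ 2 f p :=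
      hf.eventually (by simp)
    have h2 : Filter.Tendsto (fun z => (cu A B z, pA A B z)) (nhds y)
        (nhds (cu A B y, pA A B y)) := ((cu A B).prod (pA A B)).continuous.continuousAt
    exact (h2.eventually h1).mono fun z hz => hz.differentiableAt (by norm_num)
  have hD : ∀ z, DifferentiableAt ℝ f (cu A B z, pA A B z) →
      fderiv ℝ F z = fderiv ℝ f (cu A B z, pA A B z) (1, 0) • cu A B +
        fderiv ℝ (fun x => f (cu A B z, x)) (pA A B z) ∘L pA A B := by
    intro z hz
    have h1 : fderiv ℝ F z = fderiv ℝ f (cu A B z, pA A B z) ∘L (cu A B).prod (pA A B) :=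
      (hz.hasFDerivAt.comp (f := fun y => (cu A B y, pA A B y)) z
        ((cu A B).prod (pA A B)).hasFDerivAt).fderiv
    have h2 : fderiv ℝ (fun x => f (cu A B z, x)) (pA A B z) =
        fderiv ℝ f (cu A B z, pA A B z) ∘L ContinuousLinearMap.inr ℝ ℝ A :=
      (hz.hasFDerivAt.comp (pA A B z) (hasFDerivAt_prodMk_right (cu A B z) (pA A B z))).fderiv
    rw [h1, h2]
    refine ContinuousLinearMap.ext fun v => ?_
    have : ((cu A B v, pA A B v) : ℝ × A) = cu A B v • (1, 0) + (0, pA A B v) := by simp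
    simp only [ContinuousLinearMap.comp_apply, ContinuousLinearMap.prod_apply]
    rw [this, map_add, map_smul]
    simp [mul_comm]
  -- Behind `du ∧` the transverse differential of `f` may be replaced by the full differential of
  -- `F`, which is closed on the whole space.
  have hcongr : (fun y => (-τ) • lw (cu A B) ((φ (pB A B y) * f (cu A B y, pA A B y)) •
      (volB (pB A B y)).compContinuousLinearMap (pB A B) +
      (1 / l) • lw (fderiv ℝ (fun x => f (cu A B y, x)) (pA A B y) ∘L pA A B)
        ((μ (pB A B y)).compContinuousLinearMap (pB A B)))) =ᶠ[nhds y]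
      fun y => (-τ) • lw (cu A B) ((φ (pB A B y) * F y) •
      (volB (pB A B y)).compContinuousLinearMap (pB A B) +
      (1 / l) • lw (fderiv ℝ F y) ((μ (pB A B y)).compContinuousLinearMap (pB A B))) := by
    filter_upwards [hev] with z hz
    rw [hD z hz, add_lw, smul_lw, lw_add, lw_add, lw_smul _ (cu A B) (_ + _), lw_add,
      lw_smul _ (cu A B) (lw (cu A B) _), lw_self, lw_smul _ (cu A B) (lw _ _)]
    simp [F]
  rw [hcongr.extDeriv_eq]
  have hφ' : HasFDerivAt (fun y => φ (pB A B y)) (fderiv ℝ φ (pB A B y) ∘L pB A B) y :=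
    hφ.hasFDerivAt.comp y (pB A B).hasFDerivAt
  have hFd : DifferentiableAt ℝ F y := hF.differentiableAt (by norm_num)
  have hdF : DifferentiableAt ℝ (fderiv ℝ F) y :=
    (hF.fderiv_right (m := 1) (by norm_num)).differentiableAt (by norm_num)
  have hs : ∀ v w, fderiv ℝ (fderiv ℝ F) y v w = fderiv ℝ (fderiv ℝ F) y w v := by
    intro v w
    exact (hF.isSymmSndFDerivAt (by simp)).eq v w
  have hvol' := differentiableAt_pull_pB (A := A) hvol
  have hμ' := differentiableAt_pull_pB (A := A) hμ
  have hφF : DifferentiableAt ℝ (fun y => φ (pB A B y) * F y) y := hφ'.differentiableAt.mul hFd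
  have hd1 : DifferentiableAt ℝ (fun y => (φ (pB A B y) * F y) •
      (volB (pB A B y)).compContinuousLinearMap (pB A B)) y := hφF.smul hvol'
  have hd2 := differentiableAt_lw hdF hμ'
  have hd2' : DifferentiableAt ℝ (fun y => (1 / l) • lw (fderiv ℝ F y)
    ((μ (pB A B y)).compContinuousLinearMap (pB A B))) y := hd2.fun_const_smul (1 / l)
  have hmul : fderiv ℝ (fun y => φ (pB A B y) * F y) y = φ (pB A B y) • fderiv ℝ F y +
      F y • (fderiv ℝ φ (pB A B y) ∘L pB A B) := by
    rw [fderiv_fun_mul hφ'.differentiableAt hFd, hφ'.fderiv]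
  have htop : lw (fderiv ℝ φ (pB A B y) ∘L pB A B)
      ((volB (pB A B y)).compContinuousLinearMap (pB A B)) = 0 := by
    rw [← lw_compContinuousLinearMap, form_eq_zero_of_finrank_lt (lw _ _) (by omega)]
    rfl
  have hdvol : extDeriv volB (pB A B y) = 0 := form_eq_zero_of_finrank_lt _ (by omega)
  have key : extDeriv (fun y => (φ (pB A B y) * F y) •
      (volB (pB A B y)).compContinuousLinearMap (pB A B) +
      (1 / l) • lw (fderiv ℝ F y) ((μ (pB A B y)).compContinuousLinearMap (pB A B))) y = 0 := by
    have h1 := extDeriv_fun_smul (x := y) (1 / l) fun y => lw (fderiv ℝ F y)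
      ((μ (pB A B y)).compContinuousLinearMap (pB A B))
    rw [extDeriv_fun_add hd1 hd2']
    erw [h1]
    rw [extDeriv_smul_fun hφF hvol', extDeriv_lw hdF hμ' hs, extDeriv_pull (pB A B) hμ,
      extDeriv_pull (pB A B) hvol, hμv, hdvol, hmul, add_lw, smul_lw, smul_lw, htop]
    have e1 : (0 : B [⋀^Fin (k + 1 + 1)]→L[ℝ] ℝ).compContinuousLinearMap (pB A B) = 0 := rfl
    have e2 : ((l * φ (pB A B y)) • volB (pB A B y)).compContinuousLinearMap (pB A B) =
      (l * φ (pB A B y)) • (volB (pB A B y)).compContinuousLinearMap (pB A B) := rfl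
    rw [e1, e2, lw_smul]
    ext w
    simp
    field_simp
    ring
  have hc := extDeriv_fun_smul (x := y) (-τ) fun y => lw (cu A B) ((φ (pB A B y) * F y) •
      (volB (pB A B y)).compContinuousLinearMap (pB A B) +
      (1 / l) • lw (fderiv ℝ F y) ((μ (pB A B y)).compContinuousLinearMap (pB A B)))
  erw [hc]
  have hd12 : DifferentiableAt ℝ (fun y => (φ (pB A B y) * F y) •
      (volB (pB A B y)).compContinuousLinearMap (pB A B) +
      (1 / l) • lw (fderiv ℝ F y) ((μ (pB A B y)).compContinuousLinearMap (pB A B))) y :=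
    hd1.add hd2'
  rw [extDeriv_const_lw (cu A B) hd12, key, lw_zero]
  simp

end LocalFlux

end Sugra

end

noncomputable section

namespace Sugra

set_option maxSynthPendingDepth 3

/-! ### Traces on the model space. -/

section Trace

variable {V : Type*} [NormedAddCommGroup V] [NormedSpace ℝ V] [FiniteDimensional ℝ V]

theorem trc_eq_trace (L : V →ₗ[ℝ] V) : trc (fun z => L z) = LinearMap.trace ℝ V L := by
  rw [LinearMap.trace_eq_matrix_trace ℝ (bas V), Matrix.trace]
  simp [trc, LinearMap.toMatrix_apply]

theorem trc_add (S T : V → V) : trc (fun z => S z + T z) = trc S + trc T := by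
  simp [trc, Finset.sum_add_distrib]

theorem trc_sub (S T : V → V) : trc (fun z => S z - T z) = trc S - trc T := by
  simp [trc, Finset.sum_sub_distrib]

theorem trc_smul (c : ℝ) (T : V → V) : trc (fun z => c • T z) = c * trc T := by
  simp [trc, Finset.mul_sum]

theorem trc_comp_comm (S T : V →ₗ[ℝ] V) : trc (fun z => S (T z)) = trc fun z => T (S z) := by
  have h1 := trc_eq_trace (S ∘ₗ T)
  have h2 := trc_eq_trace (T ∘ₗ S)
  rw [LinearMap.trace_comp_comm' T S, ← h2] at h1
  exact h1

theorem hasFDerivAt_trc {P : Type*} [NormedAddCommGroup P] [NormedSpace ℝ P] {T : P → V → V}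
    {p : P} (hT : ∀ v, DifferentiableAt ℝ (fun q => T q v) p) :
    HasFDerivAt (fun q => trc (T q)) (∑ i, LinearMap.toContinuousLinearMap ((bas V).coord i) ∘L
      fderiv ℝ (fun q => T q (bas V i)) p) p := by
  have h := HasFDerivAt.fun_sum (u := Finset.univ) fun i _ =>
    (LinearMap.toContinuousLinearMap ((bas V).coord i)).hasFDerivAt.comp p
      (hT (bas V i)).hasFDerivAt
  exact h

theorem fderiv_trc {P : Type*} [NormedAddCommGroup P] [NormedSpace ℝ P] {T : P → V → V}
    {p : P} (hT : ∀ v, DifferentiableAt ℝ (fun q => T q v) p) (ξ : P) :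
    fderiv ℝ (fun q => trc (T q)) p ξ = trc fun v => fderiv ℝ (fun q => T q v) p ξ := by
  rw [(hasFDerivAt_trc hT).fderiv]
  simp [trc]

/-- Insert the identity as the sum of the two projections and use cyclicity. -/
theorem trace_prod {X Y : Type*} [NormedAddCommGroup X] [NormedSpace ℝ X] [FiniteDimensional ℝ X]
    [NormedAddCommGroup Y] [NormedSpace ℝ Y] [FiniteDimensional ℝ Y] (L : X × Y →ₗ[ℝ] X × Y) :
    LinearMap.trace ℝ _ L = LinearMap.trace ℝ _ (LinearMap.fst ℝ X Y ∘ₗ L ∘ₗ LinearMap.inl ℝ X Y) +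
      LinearMap.trace ℝ _ (LinearMap.snd ℝ X Y ∘ₗ L ∘ₗ LinearMap.inr ℝ X Y) := by
  rw [LinearMap.trace_comp_comm' _ (LinearMap.fst ℝ X Y), LinearMap.trace_comp_comm' _
    (LinearMap.snd ℝ X Y), ← map_add]
  congr 1
  apply LinearMap.ext
  rintro ⟨x, y⟩
  simp [← map_add]

variable {A B : Type*} [NormedAddCommGroup A] [NormedSpace ℝ A] [FiniteDimensional ℝ A]
  [NormedAddCommGroup B] [NormedSpace ℝ B] [FiniteDimensional ℝ B]

theorem trc_tot {T : Tot A B → Tot A B} (hT : IsLinearMap ℝ T) :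
    trc T = (T (eu A B)).1.1 + trc (fun a => (T (iA A B a)).1.2.1) + (T (ev A B)).1.2.2 +
      trc fun b => (T (iB A B b)).2 := by
  have h0 := trc_eq_trace (hT.mk' T)
  have hr : ∀ L : ℝ →ₗ[ℝ] ℝ, LinearMap.trace ℝ ℝ L = L 1 := fun L => by
    rw [LinearMap.trace_eq_matrix_trace ℝ (Module.Basis.singleton Unit ℝ), Matrix.trace]
    simp [LinearMap.toMatrix_apply]
  rw [trace_prod, trace_prod, trace_prod, hr, hr, ← trc_eq_trace, ← trc_eq_trace] at h0
  refine h0.trans ?_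
  simp only [LinearMap.comp_apply, LinearMap.fst_apply, LinearMap.snd_apply, LinearMap.inl_apply,
    LinearMap.inr_apply, IsLinearMap.mk'_apply, eu, ev, iA, iB, Prod.zero_eq_mk]
  ring

end Trace

/-! ### Partial derivatives in the parameter and on the slice. -/

section Slices

variable {A F : Type*} [NormedAddCommGroup A] [NormedSpace ℝ A] [NormedAddCommGroup F]
  [NormedSpace ℝ F]

theorem fderiv_slice_right {f : ℝ × A → F} {p : ℝ × A} (hf : DifferentiableAt ℝ f p) :
    fderiv ℝ (fun x => f (p.1, x)) p.2 = fderiv ℝ f p ∘L ContinuousLinearMap.inr ℝ ℝ A :=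
  (HasFDerivAt.comp p.2 (f := fun x => (p.1, x)) (g := f) hf.hasFDerivAt
    (hasFDerivAt_prodMk_right p.1 p.2)).fderiv

theorem deriv_slice_left {f : ℝ × A → F} {p : ℝ × A} (hf : DifferentiableAt ℝ f p) :
    deriv (fun s => f (s, p.2)) p.1 = fderiv ℝ f p (1, 0) := by
  have := (HasFDerivAt.comp p.1 (f := fun x => (x, p.2)) (g := f) hf.hasFDerivAt
    (hasFDerivAt_prodMk_left p.1 p.2)).hasDerivAt.deriv
  exact this.trans (by simp)

end Slices

/-! ### Christoffel symbols as an algebraic expression in the inverse metric and its first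
derivatives. -/

section Christoffel

variable {A : Type*} [NormedAddCommGroup A] [NormedSpace ℝ A]

/-- The Christoffel symbols in terms of the inverse metric and the derivative of the metric. -/
def chr (R : (A →L[ℝ] ℝ) →L[ℝ] A) (D : A →L[ℝ] A →L[ℝ] A →L[ℝ] ℝ) (v w : A) : A :=
  R ((1 / 2 : ℝ) • (D v w + D w v - (D.flip v).flip w))

theorem christoffel_eq_chr (G : A → A →L[ℝ] A →L[ℝ] ℝ) (y v w : A) :
    christoffel G y v w = chr (G y).inverse (fderiv ℝ G y) v w := rfl

theorem chr_add_left (R : (A →L[ℝ] ℝ) →L[ℝ] A) (D : A →L[ℝ] A →L[ℝ] A →L[ℝ] ℝ) (v v' w : A) :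
    chr R D (v + v') w = chr R D v w + chr R D v' w := by
  simp only [chr, ← map_add, ← smul_add]
  congr 2
  ext z
  simp
  ring

theorem chr_add_right (R : (A →L[ℝ] ℝ) →L[ℝ] A) (D : A →L[ℝ] A →L[ℝ] A →L[ℝ] ℝ) (v w w' : A) :
    chr R D v (w + w') = chr R D v w + chr R D v w' := by
  simp only [chr, ← map_add, ← smul_add]
  congr 2
  ext z
  simp
  ring

theorem chr_smul_left (R : (A →L[ℝ] ℝ) →L[ℝ] A) (D : A →L[ℝ] A →L[ℝ] A →L[ℝ] ℝ) (c : ℝ)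
    (v w : A) : chr R D (c • v) w = c • chr R D v w := by
  simp only [chr, ← map_smul]
  congr 1
  ext z
  simp
  ring

theorem chr_smul_right (R : (A →L[ℝ] ℝ) →L[ℝ] A) (D : A →L[ℝ] A →L[ℝ] A →L[ℝ] ℝ) (c : ℝ)
    (v w : A) : chr R D v (c • w) = c • chr R D v w := by
  simp only [chr, ← map_smul]
  congr 1
  ext z
  simp
  ring

theorem chr_comm (R : (A →L[ℝ] ℝ) →L[ℝ] A) {D : A →L[ℝ] A →L[ℝ] A →L[ℝ] ℝ}
    (hD : ∀ z v w, D z v w = D z w v) (v w : A) : chr R D v w = chr R D w v := by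
  simp only [chr]
  congr 2
  ext z
  simp [hD z v w]
  ring

/-- The Christoffel symbols as a linear map of the first argument. -/
def chrL (R : (A →L[ℝ] ℝ) →L[ℝ] A) (D : A →L[ℝ] A →L[ℝ] A →L[ℝ] ℝ) (w : A) : A →ₗ[ℝ] A where
  toFun v := chr R D v w
  map_add' v v' := chr_add_left R D v v' w
  map_smul' c v := chr_smul_left R D c v w

/-- The Christoffel symbols as a linear map of the second argument. -/
def chrR (R : (A →L[ℝ] ℝ) →L[ℝ] A) (D : A →L[ℝ] A →L[ℝ] A →L[ℝ] ℝ) (v : A) : A →ₗ[ℝ] A where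
  toFun w := chr R D v w
  map_add' w w' := chr_add_right R D v w w'
  map_smul' c w := chr_smul_right R D c v w

theorem differentiableAt_chr {P : Type*} [NormedAddCommGroup P] [NormedSpace ℝ P]
    {R : P → (A →L[ℝ] ℝ) →L[ℝ] A} {D : P → A →L[ℝ] A →L[ℝ] A →L[ℝ] ℝ} {p : P}
    (hR : DifferentiableAt ℝ R p) (hD : DifferentiableAt ℝ D p) (v w : A) :
    DifferentiableAt ℝ (fun q => chr (R q) (D q) v w) p := by
  have hc : ∀ z : A, DifferentiableAt ℝ (fun _ : P => z) p := fun z => differentiableAt_const z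
  have hff : DifferentiableAt ℝ (fun q => ((D q).flip v).flip w) p :=
    (differentiableAt_const (ContinuousLinearMap.apply ℝ ℝ w ∘L
      ContinuousLinearMap.apply ℝ (A →L[ℝ] ℝ) v)).clm_comp hD
  exact hR.clm_apply (((((hD.clm_apply (hc v)).clm_apply (hc w)).fun_add
    ((hD.clm_apply (hc w)).clm_apply (hc v))).fun_sub hff).fun_const_smul _)

variable [FiniteDimensional ℝ A]

theorem differentiableAt_inverse {P : Type*} [NormedAddCommGroup P] [NormedSpace ℝ P]
    {G : P → A →L[ℝ] A →L[ℝ] ℝ} {p : P} (hG : DifferentiableAt ℝ G p)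
    (hi : (G p).IsInvertible) : DifferentiableAt ℝ (fun q => (G q).inverse) p := by
  have : CompleteSpace A := FiniteDimensional.complete ℝ A
  exact ((hi.contDiffAt_map_inverse (n := 1)).differentiableAt one_ne_zero).comp p hG

theorem differentiableAt_christoffel {G : A → A →L[ℝ] A →L[ℝ] ℝ} {y : A}
    (hG : ContDiffAt ℝ 2 G y) (hi : (G y).IsInvertible) (v w : A) :
    DifferentiableAt ℝ (fun q => christoffel G q v w) y :=
  differentiableAt_chr (differentiableAt_inverse (hG.differentiableAt two_ne_zero) hi)
    ((hG.fderiv_right (m := 1) (by norm_num)).differentiableAt one_ne_zero) v w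

omit [FiniteDimensional ℝ A] in
-- `trc` accepts any map, but splitting it into blocks by `trc_tot` requires linearity;
-- differentiability of the symbols is what makes their derivatives add.
theorem isLinearMap_curvature {G : A → A →L[ℝ] A →L[ℝ] ℝ} {y : A}
    (hG : ∀ v w, DifferentiableAt ℝ (fun q => christoffel G q v w) y) (v w : A) :
    IsLinearMap ℝ fun z => curvature G y z v w where
  map_add z z' := by
    have h : fderiv ℝ (fun q => christoffel G q (z + z') w) y =
        fderiv ℝ (fun q => christoffel G q z w) y + fderiv ℝ (fun q => christoffel G q z' w) y := by
      rw [← fderiv_fun_add (hG z w) (hG z' w)]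
      simp only [christoffel_eq_chr, chr_add_left]
    simp only [curvature, h, map_add, _root_.add_apply]
    simp only [christoffel_eq_chr, chr_add_left, chr_add_right]
    abel
  map_smul c z := by
    have h : fderiv ℝ (fun q => christoffel G q (c • z) w) y =
        c • fderiv ℝ (fun q => christoffel G q z w) y := by
      rw [← fderiv_fun_const_smul (hG z w)]
      simp only [christoffel_eq_chr, chr_smul_left]
    simp only [curvature, h, map_smul, _root_.smul_apply]
    simp only [christoffel_eq_chr, chr_smul_left, chr_smul_right]
    module

end Christoffel

end Sugra

end

noncomputable section

namespace Sugra

set_option maxSynthPendingDepth 3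

/-! ### The Ricci trace over the directions of `N`. -/

section TransverseConnection

variable {A : Type*} [NormedAddCommGroup A] [NormedSpace ℝ A]

/-- The transverse part of the Christoffel symbols of the metric `2 du dv + ρ + H du²`, in terms of
the inverse metric `R`, the derivatives `D` and `U` of `ρ` along the transverse space and along `u`,
and the transverse differential `h` of `H`. -/
def gamA (R : (A →L[ℝ] ℝ) →L[ℝ] A) (D : A →L[ℝ] A →L[ℝ] A →L[ℝ] ℝ) (U : A →L[ℝ] A →L[ℝ] ℝ)
    (h : A →L[ℝ] ℝ) (a b : ℝ × A) : A :=
  chr R D a.2 b.2 + (1 / 2 : ℝ) • (a.1 • R (U b.2) + b.1 • R (U a.2))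
    - (1 / 2 * (a.1 * b.1)) • R h

section
variable {R : ℝ × A → (A →L[ℝ] ℝ) →L[ℝ] A} {D : ℝ × A → A →L[ℝ] A →L[ℝ] A →L[ℝ] ℝ}
  {U : ℝ × A → A →L[ℝ] A →L[ℝ] ℝ} {h : ℝ × A → A →L[ℝ] ℝ} {p : ℝ × A}

theorem hasFDerivAt_gamA (hR : DifferentiableAt ℝ R p) (hD : DifferentiableAt ℝ D p)
    (hU : DifferentiableAt ℝ U p) (hh : DifferentiableAt ℝ h p) (a b : ℝ × A) :
    HasFDerivAt (fun q => gamA (R q) (D q) (U q) (h q) a b)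
      (fderiv ℝ (fun q => chr (R q) (D q) a.2 b.2) p +
        (1 / 2 : ℝ) • (a.1 • fderiv ℝ (fun q => R q (U q b.2)) p +
          b.1 • fderiv ℝ (fun q => R q (U q a.2)) p)
        - (1 / 2 * (a.1 * b.1)) • fderiv ℝ (fun q => R q (h q)) p) p := by
  have hθ : ∀ z : A, DifferentiableAt ℝ (fun q => R q (U q z)) p := fun z =>
    hR.clm_apply (hU.clm_apply (differentiableAt_const z))
  have h1 := (differentiableAt_chr hR hD a.2 b.2).hasFDerivAt
  have h2 := (hθ b.2).hasFDerivAt.const_smul a.1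
  have h3 := (hθ a.2).hasFDerivAt.const_smul b.1
  have h4 := (hR.clm_apply hh).hasFDerivAt.const_smul (1 / 2 * (a.1 * b.1))
  exact (h1.add ((h2.add h3).const_smul (1 / 2 : ℝ))).sub h4

/-- The trace is a polynomial in the `u`-components `a` of `V` and `b` of `W`. Its constant term is
the Ricci tensor of `ρ`. Its coefficients at `a` and `b` are half of `div θ - d tr θ`, evaluated on
the transverse parts of `W` and `V`. Its `ab` coefficient is minus half of the Laplacian plus `∂_u
tr θ + ½ tr θ²`. The hypotheses `h0` to `h4` dispose of these one by one. -/
theorem trc_transverse [FiniteDimensional ℝ A] (hR : DifferentiableAt ℝ R p)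
    (hD : DifferentiableAt ℝ D p) (hU : DifferentiableAt ℝ U p) (hh : DifferentiableAt ℝ h p)
    (hDs : ∀ z v w, D p z v w = D p z w v) {Δ : ℝ} (V W : ℝ × A)
    (h0 : trc (fun z => fderiv ℝ (fun q => chr (R q) (D q) V.2 W.2) p (0, z) -
      fderiv ℝ (fun q => chr (R q) (D q) z W.2) p (0, V.2) +
      chr (R p) (D p) z (chr (R p) (D p) V.2 W.2) -
      chr (R p) (D p) V.2 (chr (R p) (D p) z W.2)) = 0)
    (h1 : ∀ w, trc (fun z => fderiv ℝ (fun q => R q (U q w)) p (0, z) +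
      chr (R p) (D p) z (R p (U p w)) - R p (U p (chr (R p) (D p) z w))) =
        fderiv ℝ (fun q => trc fun z => R q (U q z)) p (0, w))
    (h2 : trc (fun z => fderiv ℝ (fun q => chr (R q) (D q) z W.2) p (1, 0)) =
      1 / 2 * fderiv ℝ (fun q => trc fun z => R q (U q z)) p (0, W.2))
    (h3 : fderiv ℝ (fun q => trc fun z => R q (U q z)) p (1, 0) +
      1 / 2 * trc (fun z => R p (U p (R p (U p z)))) = 0)
    (h4 : trc (fun z => fderiv ℝ (fun q => R q (h q)) p (0, z) +
      chr (R p) (D p) z (R p (h p))) = Δ) :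
    trc (fun z => fderiv ℝ (fun q => gamA (R q) (D q) (U q) (h q) V W) p (0, z) -
      fderiv ℝ (fun q => gamA (R q) (D q) (U q) (h q) (0, z) W) p V +
      gamA (R p) (D p) (U p) (h p) (0, z) (0, gamA (R p) (D p) (U p) (h p) V W) -
      gamA (R p) (D p) (U p) (h p) V (0, gamA (R p) (D p) (U p) (h p) (0, z) W)) =
      V.1 * W.1 * (-(1 / 2) * Δ) := by
  obtain ⟨a, v⟩ := V
  obtain ⟨b, w⟩ := W
  have hθ : ∀ z : A, DifferentiableAt ℝ (fun q => R q (U q z)) p := fun z =>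
    hR.clm_apply (hU.clm_apply (differentiableAt_const z))
  have hsplit : ∀ {L : ℝ × A →L[ℝ] A}, L (a, v) = a • L (1, 0) + L (0, v) := fun {L} => by
    rw [← map_smul, ← map_add]; simp
  let Γ : A → A → A := chr (R p) (D p)
  let θ : A → A := fun z => R p (U p z)
  have hΓa : ∀ z x y, Γ z (x + y) = Γ z x + Γ z y := fun z x y => chr_add_right _ _ z x y
  have hΓs : ∀ z x y, Γ z (x - y) = Γ z x - Γ z y := fun z x y => map_sub (chrR (R p) (D p) z) x y
  have hΓm : ∀ z (c : ℝ) y, Γ z (c • y) = c • Γ z y := fun z c y => chr_smul_right _ _ c z y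
  have hθa : ∀ x y, θ (x + y) = θ x + θ y := fun x y => by simp [θ]
  have hθm : ∀ (c : ℝ) y, θ (c • y) = c • θ y := fun x y => by simp [θ]
  -- Collected by powers of `a` and `b`; in the `b` term `θ (Γ z v)` is added and subtracted so that
  -- the divergence of `θ` appears.
  have hexp : ∀ z, fderiv ℝ (fun q => gamA (R q) (D q) (U q) (h q) (a, v) (b, w)) p (0, z) -
      fderiv ℝ (fun q => gamA (R q) (D q) (U q) (h q) (0, z) (b, w)) p (a, v) +
      gamA (R p) (D p) (U p) (h p) (0, z) (0, gamA (R p) (D p) (U p) (h p) (a, v) (b, w)) -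
      gamA (R p) (D p) (U p) (h p) (a, v) (0, gamA (R p) (D p) (U p) (h p) (0, z) (b, w)) =
      (fderiv ℝ (fun q => chr (R q) (D q) v w) p (0, z) -
        fderiv ℝ (fun q => chr (R q) (D q) z w) p (0, v) + Γ z (Γ v w) - Γ v (Γ z w)) +
      a • ((1 / 2 : ℝ) • (fderiv ℝ (fun q => R q (U q w)) p (0, z) + Γ z (θ w) - θ (Γ z w)) -
        fderiv ℝ (fun q => chr (R q) (D q) z w) p (1, 0)) +
      b • ((1 / 2 : ℝ) • (fderiv ℝ (fun q => R q (U q v)) p (0, z) + Γ z (θ v) - θ (Γ z v)) -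
        (1 / 2 : ℝ) • fderiv ℝ (fun q => R q (U q z)) p (0, v) +
        (1 / 2 : ℝ) • (θ (Γ z v) - Γ v (θ z))) +
      (a * b) • ((-(1 / 2) : ℝ) • (fderiv ℝ (fun q => R q (h q)) p (0, z) + Γ z (R p (h p))) -
        (1 / 2 : ℝ) • fderiv ℝ (fun q => R q (U q z)) p (1, 0) - (1 / 4 : ℝ) • θ (θ z)) := by
    intro z
    rw [(hasFDerivAt_gamA hR hD hU hh _ _).fderiv, (hasFDerivAt_gamA hR hD hU hh _ _).fderiv]
    simp only [_root_.add_apply, _root_.sub_apply, _root_.smul_apply, gamA]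
    change _ - _ + (Γ z (Γ v w + (1 / 2 : ℝ) • (a • θ w + b • θ v) -
      (1 / 2 * (a * b)) • R p (h p)) + (1 / 2 : ℝ) • ((0 : ℝ) • θ _ + (0 : ℝ) • θ z) -
      (1 / 2 * ((0 : ℝ) * 0)) • R p (h p)) -
      (Γ v (Γ z w + (1 / 2 : ℝ) • ((0 : ℝ) • θ w + b • θ z) - (1 / 2 * (0 * b)) • R p (h p)) +
        (1 / 2 : ℝ) • (a • θ (Γ z w + (1 / 2 : ℝ) • ((0 : ℝ) • θ w + b • θ z) -
          (1 / 2 * (0 * b)) • R p (h p)) + (0 : ℝ) • θ v) - (1 / 2 * (a * 0)) • R p (h p)) = _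
    simp only [zero_smul, mul_zero, zero_mul, sub_zero, zero_add, add_zero, smul_zero, hΓa, hΓs,
      hΓm, hθa, hθm, hsplit]
    module
  -- By symmetry of the Christoffel symbols this is the trace of a commutator.
  have hcomm : trc (fun z => θ (Γ z v) - Γ v (θ z)) = 0 := by
    have e : ∀ z, Γ v (θ z) = Γ (θ z) v := fun z => chr_comm _ hDs v (θ z)
    simp only [e]
    rw [trc_sub, sub_eq_zero]
    exact trc_comp_comm ((R p).toLinearMap ∘ₗ (U p).toLinearMap) (chrL (R p) (D p) v)
  simp only [hexp]
  have hsum : ∀ (S P K Q L C G T Z : A → A), trc (fun z => S z + a • ((1 / 2 : ℝ) • P z - K z) +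
      b • ((1 / 2 : ℝ) • Q z - (1 / 2 : ℝ) • L z + (1 / 2 : ℝ) • C z) +
      (a * b) • ((-(1 / 2) : ℝ) • G z - (1 / 2 : ℝ) • T z - (1 / 4 : ℝ) • Z z)) =
      trc S + a * (1 / 2 * trc P - trc K) + b * (1 / 2 * trc Q - 1 / 2 * trc L + 1 / 2 * trc C) +
      a * b * (-(1 / 2) * trc G - 1 / 2 * trc T - 1 / 4 * trc Z) := by
    intro S P K Q L C G T Z
    simp only [trc_add, trc_sub, trc_smul]
  rw [hsum (fun z => fderiv ℝ (fun q => chr (R q) (D q) v w) p (0, z) -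
        fderiv ℝ (fun q => chr (R q) (D q) z w) p (0, v) + Γ z (Γ v w) - Γ v (Γ z w))
    (fun z => fderiv ℝ (fun q => R q (U q w)) p (0, z) + Γ z (θ w) - θ (Γ z w))
    _ (fun z => fderiv ℝ (fun q => R q (U q v)) p (0, z) + Γ z (θ v) - θ (Γ z v))
    _ (fun z => θ (Γ z v) - Γ v (θ z))
    (fun z => fderiv ℝ (fun q => R q (h q)) p (0, z) + Γ z (R p (h p))), hcomm]
  rw [← fderiv_trc hθ, ← fderiv_trc hθ]
  have h1v := h1 v
  have h1w := h1 w
  simp only at h0 h2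
  rw [show trc (fun z => fderiv ℝ (fun q => chr (R q) (D q) v w) p (0, z) -
        fderiv ℝ (fun q => chr (R q) (D q) z w) p (0, v) + Γ z (Γ v w) - Γ v (Γ z w)) = 0 from h0,
    show trc (fun z => fderiv ℝ (fun q => R q (U q w)) p (0, z) + Γ z (θ w) - θ (Γ z w)) = _
      from h1w, show trc (fun z => fderiv ℝ (fun q => R q (U q v)) p (0, z) + Γ z (θ v) -
      θ (Γ z v)) = _ from h1v, h2,
    show trc (fun z => fderiv ℝ (fun q => R q (h q)) p (0, z) + Γ z (R p (h p))) = _ from h4]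
  have h3' : fderiv ℝ (fun q => trc fun z => R q (U q z)) p (1, 0) +
      1 / 2 * trc (fun z => θ (θ z)) = 0 := h3
  linear_combination (-(a * b) / 2) * h3'

end

end TransverseConnection

end Sugra

end

noncomputable section

namespace Sugra

set_option maxSynthPendingDepth 3

/-! ### Traces against the inverse metric. -/

section MetricTrace

variable {V : Type*} [NormedAddCommGroup V] [NormedSpace ℝ V] [FiniteDimensional ℝ V]
  {G : V →L[ℝ] V →L[ℝ] ℝ}

theorem trc_inverse (hG : G.IsInvertible) (hs : ∀ v w, G v w = G w v) (K : V → V →L[ℝ] ℝ) :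
    trc (fun z => G.inverse (K z)) = ∑ i, K (bas V i) (dualBas G i) :=
  Finset.sum_congr rfl fun i _ => inverse_symm hG hs
    (LinearMap.toContinuousLinearMap ((bas V).coord i)) (K (bas V i))

/-- A symmetric inverse metric contracted with an antisymmetric form. -/
theorem trc_inverse_eq_zero (hG : G.IsInvertible) (hs : ∀ v w, G v w = G w v)
    {K : V → V →L[ℝ] ℝ} (hK : ∀ v w, K v w = -K w v) :
    trc (fun z => G.inverse (K z)) = 0 := by
  rw [trc_inverse hG hs]
  let c := fun i j => (bas V).coord j (dualBas G i)
  have hc : ∀ i j, c i j = c j i := fun i j => inverse_symm hG hs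
    (LinearMap.toContinuousLinearMap ((bas V).coord j))
    (LinearMap.toContinuousLinearMap ((bas V).coord i))
  have h : ∀ i, K (bas V i) (dualBas G i) = ∑ j, c i j * K (bas V i) (bas V j) := fun i => by
    conv_lhs => rw [← (bas V).sum_repr (dualBas G i), map_sum]
    simp [c]
  simp only [h]
  have h2 : ∑ i, ∑ j, c i j * K (bas V i) (bas V j) =
      -∑ i, ∑ j, c i j * K (bas V i) (bas V j) := by
    conv_lhs => rw [Finset.sum_comm]
    rw [← Finset.sum_neg_distrib]
    refine Finset.sum_congr rfl fun i _ => ?_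
    rw [← Finset.sum_neg_distrib]
    refine Finset.sum_congr rfl fun j _ => ?_
    rw [hc, hK]
    ring
  linarith

/-- The formula `Γ^i_{iw} = ½ g^{ij} ∂_w g_{ij}`: the other two derivatives of the metric are
antisymmetric in the contracted pair. -/
theorem trc_chr (hG : G.IsInvertible) (hs : ∀ v w, G v w = G w v)
    {D : V →L[ℝ] V →L[ℝ] V →L[ℝ] ℝ} (hD : ∀ z v w, D z v w = D z w v) (w : V) :
    trc (fun z => chr G.inverse D z w) = 1 / 2 * trc fun z => G.inverse (D w z) := by
  have h : ∀ z, chr G.inverse D z w = (1 / 2 : ℝ) • (G.inverse (D z w - (D.flip z).flip w) +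
      G.inverse (D w z)) := fun z => by
    rw [← map_add, ← map_smul, chr]
    congr 2
    abel
  simp only [h]
  rw [trc_smul, trc_add, trc_inverse_eq_zero hG hs, zero_add]
  intro v u
  simp [hD u v w, hD v u w]

end MetricTrace

/-! ### Differentiation of the inverse metric. -/

section Derivatives

variable {A : Type*} [NormedAddCommGroup A] [NormedSpace ℝ A] [FiniteDimensional ℝ A]
  {P : Type*} [NormedAddCommGroup P] [NormedSpace ℝ P]
  {ρ : P → A →L[ℝ] A →L[ℝ] ℝ} {p : P}

/-- Differentiate `ρ (ρ⁻¹ η) = η`, which holds near `p` because invertibility is an open condition.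
-/
theorem fderiv_inverse_apply (hρ : DifferentiableAt ℝ ρ p) (hi : (ρ p).IsInvertible)
    {η : P → A →L[ℝ] ℝ} (hη : DifferentiableAt ℝ η p) (ξ : P) :
    fderiv ℝ (fun q => (ρ q).inverse (η q)) p ξ =
      (ρ p).inverse (fderiv ℝ η p ξ - fderiv ℝ ρ p ξ ((ρ p).inverse (η p))) := by
  have : CompleteSpace A := FiniteDimensional.complete ℝ A
  have hR := differentiableAt_inverse hρ hi
  have hev : ∀ᶠ q in nhds p, (ρ q).IsInvertible := by
    obtain ⟨e, he⟩ := hi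
    have h1 : ∀ᶠ L in nhds (ρ p), L ∈ Set.range ((↑) : (A ≃L[ℝ] (A →L[ℝ] ℝ)) → _) := by
      rw [← he]
      exact ContinuousLinearEquiv.nhds e
    exact hρ.continuousAt.eventually h1
  have h1 : (fun q => ρ q ((ρ q).inverse (η q))) =ᶠ[nhds p] η := by
    filter_upwards [hev] with q hq using hq.self_apply_inverse _
  have hRη : DifferentiableAt ℝ (fun q => (ρ q).inverse (η q)) p := hR.clm_apply hη
  have h2 := (hρ.hasFDerivAt.clm_apply hRη.hasFDerivAt).fderiv
  rw [h1.fderiv_eq] at h2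
  rw [h2]
  simp [hi.inverse_apply_self]

/-- The trace of `ρ⁻¹ ∂_ζ ρ` is `∂_ζ log |det ρ|`, so this is equality of mixed partials. The
determinant is avoided: both sides are `tr (ρ⁻¹ ∂_ξ ∂_ζ ρ)` minus a trace that is symmetric by
cyclicity. -/
theorem fderiv_trc_inverse_comm (hρ : ContDiffAt ℝ 2 ρ p) (hi : (ρ p).IsInvertible) (ξ ζ : P) :
    fderiv ℝ (fun q => trc fun z => (ρ q).inverse (fderiv ℝ ρ q ζ z)) p ξ =
      fderiv ℝ (fun q => trc fun z => (ρ q).inverse (fderiv ℝ ρ q ξ z)) p ζ := by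
  have hd : DifferentiableAt ℝ ρ p := hρ.differentiableAt two_ne_zero
  have hD : DifferentiableAt ℝ (fderiv ℝ ρ) p :=
    (hρ.fderiv_right (m := 1) (by norm_num)).differentiableAt one_ne_zero
  have hs : ∀ v w, fderiv ℝ (fderiv ℝ ρ) p v w = fderiv ℝ (fderiv ℝ ρ) p w v :=
    fun v w => (hρ.isSymmSndFDerivAt (by simp)).eq v w
  have hη : ∀ ζ z, HasFDerivAt (fun q => fderiv ℝ ρ q ζ z)
      (ContinuousLinearMap.apply ℝ (A →L[ℝ] ℝ) z ∘L
        ContinuousLinearMap.apply ℝ (A →L[ℝ] A →L[ℝ] ℝ) ζ ∘L fderiv ℝ (fderiv ℝ ρ) p) p := by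
    intro ζ z
    have h1 := (ContinuousLinearMap.apply ℝ (A →L[ℝ] A →L[ℝ] ℝ) ζ).hasFDerivAt.comp p hD.hasFDerivAt
    exact (ContinuousLinearMap.apply ℝ (A →L[ℝ] ℝ) z).hasFDerivAt.comp p h1
  have key : ∀ ξ ζ, fderiv ℝ (fun q => trc fun z => (ρ q).inverse (fderiv ℝ ρ q ζ z)) p ξ =
      trc (fun z => (ρ p).inverse (fderiv ℝ (fderiv ℝ ρ) p ξ ζ z)) - trc (fun z => (ρ p).inverse
        (fderiv ℝ ρ p ξ ((ρ p).inverse (fderiv ℝ ρ p ζ z)))) := by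
    intro ξ ζ
    rw [fderiv_trc fun z => (differentiableAt_inverse hd hi).clm_apply (hη ζ z).differentiableAt,
      ← trc_sub]
    congr 1
    funext z
    rw [fderiv_inverse_apply hd hi (hη ζ z).differentiableAt, map_sub, (hη ζ z).fderiv]
    rfl
  rw [key, key, hs]
  congr 1
  exact trc_comp_comm ((ρ p).inverse.toLinearMap ∘ₗ (fderiv ℝ ρ p ξ).toLinearMap)
    ((ρ p).inverse.toLinearMap ∘ₗ (fderiv ℝ ρ p ζ).toLinearMap)

end Derivatives

end Sugra

end

noncomputable section

namespace Sugra

set_option maxSynthPendingDepth 3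

/-! ### The transverse trace for an actual family of metrics. -/

section TransverseMetric

variable {A : Type*} [NormedAddCommGroup A] [NormedSpace ℝ A]

/-- The partial derivative in the second variable. -/
def dT {F : Type*} [NormedAddCommGroup F] [NormedSpace ℝ F] (f : ℝ × A → F) (q : ℝ × A) :
    A →L[ℝ] F := fderiv ℝ f q ∘L ContinuousLinearMap.inr ℝ ℝ A

theorem differentiableAt_dT {F : Type*} [NormedAddCommGroup F] [NormedSpace ℝ F]
    {f : ℝ × A → F} {p : ℝ × A} (hf : ContDiffAt ℝ 2 f p) : DifferentiableAt ℝ (dT f) p :=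
  ((hf.fderiv_right (m := 1) (by norm_num)).differentiableAt one_ne_zero).clm_comp
    (differentiableAt_const _)

omit [NormedSpace ℝ A] in
theorem eventually_slice {p : ℝ × A} {S : ℝ × A → Prop} (h : ∀ᶠ q in nhds p, S q) :
    (∀ᶠ x in nhds p.2, S (p.1, x)) ∧ ∀ᶠ s in nhds p.1, S (s, p.2) :=
  ⟨((Continuous.prodMk_right p.1).tendsto p.2).eventually h,
    ((Continuous.prodMk_left p.2).tendsto p.1).eventually h⟩

theorem fderiv_symm_of_eventually {P : Type*} [NormedAddCommGroup P] [NormedSpace ℝ P]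
    {ρ : P → A →L[ℝ] A →L[ℝ] ℝ} {p : P}
    (hs : ∀ᶠ q in nhds p, ∀ v w, ρ q v w = ρ q w v) (ξ : P) (v w : A) :
    fderiv ℝ ρ p ξ v w = fderiv ℝ ρ p ξ w v := by
  by_cases hd : DifferentiableAt ℝ ρ p
  · have h : ∀ v w, HasFDerivAt (fun q => ρ q v w) (ContinuousLinearMap.apply ℝ ℝ w ∘L
        ContinuousLinearMap.apply ℝ (A →L[ℝ] ℝ) v ∘L fderiv ℝ ρ p) p := fun v w =>
      (ContinuousLinearMap.apply ℝ ℝ w).hasFDerivAt.comp p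
        ((ContinuousLinearMap.apply ℝ (A →L[ℝ] ℝ) v).hasFDerivAt.comp p hd.hasFDerivAt)
    have he : (fun q => ρ q v w) =ᶠ[nhds p] fun q => ρ q w v := hs.mono fun q hq => hq v w
    have h2 := he.fderiv_eq (𝕜 := ℝ)
    rw [(h v w).fderiv, (h w v).fderiv] at h2
    exact DFunLike.congr_fun h2 ξ
  -- Where `ρ` is not differentiable the default value zero is symmetric too.
  · rw [fderiv_zero_of_not_differentiableAt hd]
    rfl

variable [FiniteDimensional ℝ A] {ρ : ℝ × A → A →L[ℝ] A →L[ℝ] ℝ} {H : ℝ × A → ℝ} {p : ℝ × A}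

/-- The divergence of a gradient is the Laplacian: the term from differentiating the inverse metric
and the Christoffel term of the gradient combine into `-h (Γ)`, using symmetry of the metric. -/
theorem trc_grad (hρ : DifferentiableAt ℝ ρ p) (hi : (ρ p).IsInvertible)
    (hs : ∀ v w, ρ p v w = ρ p w v) (hD : ∀ z v w, dT ρ p z v w = dT ρ p z w v)
    {h : ℝ × A → A →L[ℝ] ℝ} (hh : DifferentiableAt ℝ h p) :
    trc (fun z => fderiv ℝ (fun q => (ρ q).inverse (h q)) p (0, z) +
      chr (ρ p).inverse (dT ρ p) z ((ρ p).inverse (h p))) =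
      ∑ i, (fderiv ℝ h p (0, bas A i) (dualBas (ρ p) i) -
        h p (chr (ρ p).inverse (dT ρ p) (bas A i) (dualBas (ρ p) i))) := by
  set g := (ρ p).inverse (h p) with hg
  have e : ∀ z, fderiv ℝ (fun q => (ρ q).inverse (h q)) p (0, z) +
      chr (ρ p).inverse (dT ρ p) z g = (ρ p).inverse (fderiv ℝ h p (0, z) - dT ρ p z g +
        (1 / 2 : ℝ) • (dT ρ p z g + dT ρ p g z - ((dT ρ p).flip z).flip g)) := by
    intro z
    rw [fderiv_inverse_apply hρ hi hh, map_add]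
    rfl
  simp only [e]
  rw [trc_inverse hi hs]
  refine Finset.sum_congr rfl fun i _ => ?_
  rw [chr, inverse_symm hi hs, ← hg]
  simp only [_root_.add_apply, _root_.sub_apply, _root_.smul_apply, smul_eq_mul,
    ContinuousLinearMap.flip_apply]
  rw [hD _ g, hD g]
  ring

/-- The conditions on `ρ` are stated on slices of fixed `u` or fixed `x`; here they become joint
derivatives on `ℝ × A`, as `trc_transverse` requires. Each identity must hold near the point, since
it is differentiated once more. -/
theorem trc_transverse_metric (hρ : ContDiffAt ℝ 2 ρ p) (hH : ContDiffAt ℝ 2 H p)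
    (hneg : ∀ᶠ q in nhds p, IsNegDef (ρ q)) (V W : ℝ × A)
    (hflat : ricciLoc (fun x => ρ (p.1, x)) p.2 V.2 W.2 = 0)
    (hdiv : ∀ w, divThetaLoc (fun s x => ρ (s, x)) p.1 p.2 w =
      fderiv ℝ (fun y => trc (thetaLoc (fun s x => ρ (s, x)) p.1 y)) p.2 w)
    (htr : deriv (fun s => trc (thetaLoc (fun s x => ρ (s, x)) s p.2)) p.1 +
      1 / 2 * trc (fun z => thetaLoc (fun s x => ρ (s, x)) p.1 p.2
        (thetaLoc (fun s x => ρ (s, x)) p.1 p.2 z)) = 0) :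
    trc (fun z => fderiv ℝ (fun q => gamA (ρ q).inverse (dT ρ q) (fderiv ℝ ρ q (1, 0))
        (dT H q) V W) p (0, z) -
      fderiv ℝ (fun q => gamA (ρ q).inverse (dT ρ q) (fderiv ℝ ρ q (1, 0)) (dT H q) (0, z) W) p V +
      gamA (ρ p).inverse (dT ρ p) (fderiv ℝ ρ p (1, 0)) (dT H p) (0, z)
        (0, gamA (ρ p).inverse (dT ρ p) (fderiv ℝ ρ p (1, 0)) (dT H p) V W) -
      gamA (ρ p).inverse (dT ρ p) (fderiv ℝ ρ p (1, 0)) (dT H p) V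
        (0, gamA (ρ p).inverse (dT ρ p) (fderiv ℝ ρ p (1, 0)) (dT H p) (0, z) W)) =
      V.1 * W.1 * (-(1 / 2) * laplaceLoc (fun x => ρ (p.1, x)) (fun x => H (p.1, x)) p.2) := by
  have hnp := hneg.self_of_nhds
  have hi : (ρ p).IsInvertible := hnp.isInvertible
  have hd : DifferentiableAt ℝ ρ p := hρ.differentiableAt two_ne_zero
  have hR := differentiableAt_inverse hd hi
  have hDd := differentiableAt_dT hρ
  have hhd := differentiableAt_dT hH
  have hUd : DifferentiableAt ℝ (fun q => fderiv ℝ ρ q (1, 0)) p :=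
    ((hρ.fderiv_right (m := 1) (by norm_num)).differentiableAt one_ne_zero).clm_apply
      (differentiableAt_const _)
  have hsymm : ∀ᶠ q in nhds p, ∀ v w, ρ q v w = ρ q w v := hneg.mono fun q hq => hq.1
  have hDs : ∀ᶠ q in nhds p, ∀ z v w, dT ρ q z v w = dT ρ q z w v :=
    hsymm.eventually_nhds.mono fun q hq z v w => fderiv_symm_of_eventually hq (0, z) v w
  have hdev : ∀ᶠ q in nhds p, DifferentiableAt ℝ ρ q :=
    (hρ.eventually (by simp)).mono fun q hq => hq.differentiableAt two_ne_zero
  have hHev : ∀ᶠ q in nhds p, DifferentiableAt ℝ H q :=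
    (hH.eventually (by simp)).mono fun q hq => hq.differentiableAt two_ne_zero
  have hθ : ∀ q, DifferentiableAt ℝ ρ q → thetaLoc (fun s x => ρ (s, x)) q.1 q.2 =
      (ρ q).inverse ∘L fderiv ℝ ρ q (1, 0) := fun q hq => by
    rw [thetaLoc, deriv_slice_left hq]
  have hχ : ∀ q : ℝ × A, DifferentiableAt ℝ ρ q → ∀ v w,
      christoffel (fun x => ρ (q.1, x)) q.2 v w = chr (ρ q).inverse (dT ρ q) v w := fun q hq v w => by
    rw [christoffel_eq_chr, fderiv_slice_right hq]
    rfl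
  have hθd : ∀ z : A, DifferentiableAt ℝ (fun q => (ρ q).inverse (fderiv ℝ ρ q (1, 0) z)) p :=
    fun z => hR.clm_apply (hUd.clm_apply (differentiableAt_const z))
  have hθtr : DifferentiableAt ℝ (fun q => trc fun z => (ρ q).inverse (fderiv ℝ ρ q (1, 0) z)) p :=
    (hasFDerivAt_trc hθd).differentiableAt
  have hχd : ∀ v w, fderiv ℝ (fun x => christoffel (fun x => ρ (p.1, x)) x v w) p.2 =
      fderiv ℝ (fun q => chr (ρ q).inverse (dT ρ q) v w) p ∘L ContinuousLinearMap.inr ℝ ℝ A := by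
    intro v w
    rw [← fderiv_slice_right (differentiableAt_chr hR hDd v w)]
    refine Filter.EventuallyEq.fderiv_eq ?_
    filter_upwards [(eventually_slice hdev).1] with x hx using hχ (p.1, x) hx v w
  refine trc_transverse hR hDd hUd hhd hDs.self_of_nhds V W ?_ ?_ ?_ ?_ ?_
  · refine Eq.trans ?_ hflat
    rw [ricciLoc]
    congr 1
    funext z
    rw [curvature, hχd, hχd]
    simp only [hχ p hd]
    rfl
  · intro w
    have h1 := hdiv w
    have h2 : fderiv ℝ (fun y => trc (thetaLoc (fun s x => ρ (s, x)) p.1 y)) p.2 w =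
        fderiv ℝ (fun q => trc fun z => (ρ q).inverse (fderiv ℝ ρ q (1, 0) z)) p (0, w) := by
      have : fderiv ℝ (fun y => trc (thetaLoc (fun s x => ρ (s, x)) p.1 y)) p.2 = _ :=
        (Filter.EventuallyEq.fderiv_eq (by
          filter_upwards [(eventually_slice hdev).1] with x hx
          rw [hθ (p.1, x) hx]
          rfl)).trans (fderiv_slice_right hθtr)
      rw [this]
      rfl
    rw [← h2, ← h1, divThetaLoc]
    congr 1
    funext z
    have h3 : fderiv ℝ (fun y => thetaLoc (fun s x => ρ (s, x)) p.1 y w) p.2 = _ :=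
        (Filter.EventuallyEq.fderiv_eq (by
          filter_upwards [(eventually_slice hdev).1] with x hx
          rw [hθ (p.1, x) hx]
          rfl)).trans (fderiv_slice_right (hθd w))
    rw [h3, hχ p hd, hχ p hd, hθ p hd]
    rfl
  -- The trace of the Christoffel symbols is half the logarithmic derivative of the volume density
  -- along `W.2`; commuting it with `∂_u` produces `d tr θ`.
  · have h1 : (fun q => trc fun z => chr (ρ q).inverse (dT ρ q) z W.2) =ᶠ[nhds p] fun q =>
        1 / 2 * trc fun z => (ρ q).inverse (fderiv ℝ ρ q (0, W.2) z) := by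
      filter_upwards [hneg, hDs] with q hq hq'
      exact trc_chr hq.isInvertible hq.1 hq' W.2
    rw [← fderiv_trc fun z => differentiableAt_chr hR hDd z W.2, h1.fderiv_eq]
    have h2 : DifferentiableAt ℝ (fun q => trc fun z => (ρ q).inverse
        (fderiv ℝ ρ q (0, W.2) z)) p := by
      refine (hasFDerivAt_trc fun z => hR.clm_apply ?_).differentiableAt
      exact (((hρ.fderiv_right (m := 1) (by norm_num)).differentiableAt one_ne_zero).clm_apply
        (differentiableAt_const _)).clm_apply (differentiableAt_const z)
    rw [fderiv_const_mul h2, _root_.smul_apply, ← fderiv_trc_inverse_comm hρ hi (0, W.2) (1, 0)]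
    rfl
  · have h1 : deriv (fun s => trc (thetaLoc (fun s x => ρ (s, x)) s p.2)) p.1 = _ :=
        (Filter.EventuallyEq.deriv_eq (by
          filter_upwards [(eventually_slice hdev).2] with s hs
          rw [hθ (s, p.2) hs]
          rfl)).trans (deriv_slice_left hθtr)
    rw [h1, hθ p hd] at htr
    exact htr
  · rw [trc_grad hd hi hnp.1 hDs.self_of_nhds hhd, laplaceLoc]
    refine Finset.sum_congr rfl fun i _ => ?_
    have h1 : fderiv ℝ (fun x => H (p.1, x)) =ᶠ[nhds p.2] fun x => dT H (p.1, x) := by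
      filter_upwards [(eventually_slice hHev).1] with x hx using fderiv_slice_right (p := (p.1, x)) hx
    rw [h1.fderiv_eq, fderiv_slice_right hhd, hχ p hd, fderiv_slice_right hHev.self_of_nhds]
    rfl

end TransverseMetric

end Sugra

end

noncomputable section

namespace Sugra

set_option maxSynthPendingDepth 3

/-! ### Christoffel symbols and Ricci tensor of `2 du dv + ρ + H du² + g`. -/

section WalkerMetric

variable (A B : Type*) [NormedAddCommGroup A] [NormedSpace ℝ A] [NormedAddCommGroup B]
  [NormedSpace ℝ B]

/-- The coordinates `(u, x)`. -/
def cuA : Tot A B →L[ℝ] ℝ × A := (cu A B).prod (pA A B)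

variable {A B}

@[simp] theorem cuA_apply (y : Tot A B) : cuA A B y = (y.1.1, y.1.2.1) := rfl

/-- The metric `2 du dv + ρ + H du² + g` as a function of the point. -/
def hF (ρ : ℝ × A → A →L[ℝ] A →L[ℝ] ℝ) (H : ℝ × A → ℝ) (g : B → B →L[ℝ] B →L[ℝ] ℝ)
    (y : Tot A B) : Tot A B →L[ℝ] Tot A B →L[ℝ] ℝ :=
  hT (ρ (cuA A B y)) (H (cuA A B y)) (g (pB A B y))

theorem clm_fderiv_apply {X Y Z : Type*} [NormedAddCommGroup X] [NormedSpace ℝ X]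
    [NormedAddCommGroup Y] [NormedSpace ℝ Y] [NormedAddCommGroup Z] [NormedSpace ℝ Z]
    (π : Y →L[ℝ] Z) {f : X → Y} {x : X} (hf : DifferentiableAt ℝ f x) (v : X) :
    π (fderiv ℝ f x v) = fderiv ℝ (fun y => π (f y)) x v :=
  (DFunLike.congr_fun (π.hasFDerivAt.comp x hf.hasFDerivAt).fderiv v).symm

variable {ρ : ℝ × A → A →L[ℝ] A →L[ℝ] ℝ} {H : ℝ × A → ℝ} {g : B → B →L[ℝ] B →L[ℝ] ℝ}
  {y : Tot A B}

theorem contDiffAt_hF {n : ℕ∞} (hρ : ContDiffAt ℝ n ρ (cuA A B y))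
    (hH : ContDiffAt ℝ n H (cuA A B y)) (hg : ContDiffAt ℝ n g (pB A B y)) :
    ContDiffAt ℝ n (hF ρ H g) y := by
  have h1 := hρ.comp (f := cuA A B) y (cuA A B).contDiff.contDiffAt
  have h2 := hH.comp (f := cuA A B) y (cuA A B).contDiff.contDiffAt
  have h3 := hg.comp (f := pB A B) y (pB A B).contDiff.contDiffAt
  have e1 : ContDiffAt ℝ n (fun y => pullB (pA A B) (ρ (cuA A B y))) y :=
    contDiffAt_const.clm_comp (h1.clm_comp contDiffAt_const)
  have e3 : ContDiffAt ℝ n (fun y => pullB (pB A B) (g (pB A B y))) y :=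
    contDiffAt_const.clm_comp (h3.clm_comp contDiffAt_const)
  exact ((contDiffAt_const.add e1).add (h2.smul contDiffAt_const)).add e3

theorem fderiv_hF (hρ : DifferentiableAt ℝ ρ (cuA A B y))
    (hH : DifferentiableAt ℝ H (cuA A B y)) (hg : DifferentiableAt ℝ g (pB A B y))
    (V W Z : Tot A B) : fderiv ℝ (hF ρ H g) y V W Z =
      fderiv ℝ ρ (cuA A B y) (cuA A B V) W.1.2.1 Z.1.2.1 +
      fderiv ℝ H (cuA A B y) (cuA A B V) * (W.1.1 * Z.1.1) + fderiv ℝ g y.2 V.2 W.2 Z.2 := by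
  have hd : DifferentiableAt ℝ (hF ρ H g) y := by
    have e1 : DifferentiableAt ℝ (fun y => pullB (pA A B) (ρ (cuA A B y))) y :=
      (differentiableAt_const _).clm_comp
        ((hρ.comp y (cuA A B).differentiableAt).clm_comp (differentiableAt_const _))
    have e3 : DifferentiableAt ℝ (fun y => pullB (pB A B) (g (pB A B y))) y :=
      (differentiableAt_const _).clm_comp
        ((hg.comp y (pB A B).differentiableAt).clm_comp (differentiableAt_const _))
    exact (((differentiableAt_const _).add e1).add
      ((hH.comp y (cuA A B).differentiableAt).smul (differentiableAt_const _))).add e3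
  have h1 := (ContinuousLinearMap.apply ℝ ℝ Z).hasFDerivAt.comp y
    ((ContinuousLinearMap.apply ℝ (Tot A B →L[ℝ] ℝ) W).hasFDerivAt.comp y hd.hasFDerivAt)
  have e1 := (ContinuousLinearMap.apply ℝ ℝ Z.1.2.1).hasFDerivAt.comp y
    ((ContinuousLinearMap.apply ℝ (A →L[ℝ] ℝ) W.1.2.1).hasFDerivAt.comp y
      (hρ.hasFDerivAt.comp y (cuA A B).hasFDerivAt))
  have e2 := (hH.hasFDerivAt.comp y (cuA A B).hasFDerivAt).mul_const (W.1.1 * Z.1.1)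
  have e3 := (ContinuousLinearMap.apply ℝ ℝ Z.2).hasFDerivAt.comp y
    ((ContinuousLinearMap.apply ℝ (B →L[ℝ] ℝ) W.2).hasFDerivAt.comp y
      (hg.hasFDerivAt.comp y (pB A B).hasFDerivAt))
  have e4 := ((e1.const_add (W.1.1 * Z.1.2.2 + W.1.2.2 * Z.1.1)).add e2).add e3
  have hfun : (fun y => hF ρ H g y W Z) = fun y => W.1.1 * Z.1.2.2 + W.1.2.2 * Z.1.1 +
      ρ (cuA A B y) W.1.2.1 Z.1.2.1 + H (cuA A B y) * (W.1.1 * Z.1.1) + g (pB A B y) W.2 Z.2 := by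
    funext y
    rw [hF, hT_apply]
  have h2 : fderiv ℝ (fun y => hF ρ H g y W Z) y V = _ := DFunLike.congr_fun h1.fderiv V
  have h3 : fderiv ℝ (fun y => W.1.1 * Z.1.2.2 + W.1.2.2 * Z.1.1 +
      ρ (cuA A B y) W.1.2.1 Z.1.2.1 + H (cuA A B y) * (W.1.1 * Z.1.1) + g (pB A B y) W.2 Z.2) y V
      = _ := DFunLike.congr_fun e4.fderiv V
  rw [← hfun, h2] at h3
  refine h3.trans ?_
  simp [mul_comm]

/-- The `∂_v`-component of the Christoffel symbols of a Walker metric. -/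
def gamV (U : A →L[ℝ] A →L[ℝ] ℝ) (h : ℝ × A →L[ℝ] ℝ) (a b : ℝ × A) : ℝ :=
  -(1 / 2) * U a.2 b.2 + 1 / 2 * (a.1 * h (0, b.2) + b.1 * h (0, a.2) + a.1 * b.1 * h (1, 0))

variable [FiniteDimensional ℝ A] [FiniteDimensional ℝ B]

/-- Checked by lowering the index and pairing with an arbitrary `Z`. The zero `∂_u`-component
reflects that the metric does not depend on `v`, with `∂_v` dual to `du`. -/
theorem christoffel_hF (hρ : DifferentiableAt ℝ ρ (cuA A B y))
    (hH : DifferentiableAt ℝ H (cuA A B y)) (hg : DifferentiableAt ℝ g (pB A B y))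
    (hri : (ρ (cuA A B y)).IsInvertible) (hgi : (g (pB A B y)).IsInvertible) (V W : Tot A B) :
    christoffel (hF ρ H g) y V W =
      ((0, (gamA (ρ (cuA A B y)).inverse (dT ρ (cuA A B y)) (fderiv ℝ ρ (cuA A B y) (1, 0))
        (dT H (cuA A B y)) (cuA A B V) (cuA A B W),
        gamV (fderiv ℝ ρ (cuA A B y) (1, 0)) (fderiv ℝ H (cuA A B y)) (cuA A B V) (cuA A B W))),
        christoffel g (pB A B y) V.2 W.2) := by
  have hi : (hF ρ H g y).IsInvertible := hT_isInvertible hri hgi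
  rw [christoffel, hi.inverse_apply_eq]
  refine ContinuousLinearMap.ext fun Z => ?_
  have s1 : ∀ (L : ℝ × A →L[ℝ] A →L[ℝ] A →L[ℝ] ℝ) (a : ℝ) (v : A),
      L (a, v) = a • L (1, 0) + L (0, v) := fun L a v => by
    rw [← map_smul, ← map_add]; simp
  have s2 : ∀ (L : ℝ × A →L[ℝ] ℝ) (a : ℝ) (v : A),
      L (a, v) = a • L (1, 0) + L (0, v) := fun L a v => by
    rw [← map_smul, ← map_add]; simp
  have hri' : (ρ (y.1.1, y.1.2.1)).IsInvertible := hri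
  have hgi' : (g y.2).IsInvertible := hgi
  simp only [_root_.smul_apply, _root_.add_apply, _root_.sub_apply, ContinuousLinearMap.flip_apply,
    smul_eq_mul, fderiv_hF hρ hH hg]
  rw [hF, hT_apply]
  simp only [gamA, gamV, chr, christoffel, map_add, map_sub, map_smul, _root_.smul_apply,
    _root_.add_apply, _root_.sub_apply, ContinuousLinearMap.flip_apply, smul_eq_mul,
    hri'.self_apply_inverse, hgi'.self_apply_inverse, cuA_apply, pB_apply, dT,
    ContinuousLinearMap.comp_apply, ContinuousLinearMap.inr_apply]
  rw [s1 (fderiv ℝ ρ _) V.1.1, s1 (fderiv ℝ ρ _) W.1.1, s1 (fderiv ℝ ρ _) Z.1.1,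
    s2 (fderiv ℝ H _) V.1.1, s2 (fderiv ℝ H _) W.1.1, s2 (fderiv ℝ H _) Z.1.1]
  simp only [_root_.smul_apply, _root_.add_apply, smul_eq_mul]
  ring

/-- The trace splits into four diagonal blocks. The `u` block vanishes because the symbols have no
`∂_u`-component, the `v` block because the curvature with first argument `∂_v` is zero; the other
two are the trace over `A` and the Ricci tensor of `g`. -/
theorem ricciLoc_hF (hρ : ContDiffAt ℝ 2 ρ (cuA A B y)) (hH : ContDiffAt ℝ 2 H (cuA A B y))
    (hg : ContDiffAt ℝ 2 g (pB A B y)) (hneg : ∀ᶠ q in nhds (cuA A B y), IsNegDef (ρ q))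
    (hgneg : ∀ᶠ q in nhds (pB A B y), IsNegDef (g q)) (V W : Tot A B) :
    ricciLoc (hF ρ H g) y V W =
      trc (fun z => fderiv ℝ (fun q => gamA (ρ q).inverse (dT ρ q) (fderiv ℝ ρ q (1, 0))
          (dT H q) (cuA A B V) (cuA A B W)) (cuA A B y) (0, z) -
        fderiv ℝ (fun q => gamA (ρ q).inverse (dT ρ q) (fderiv ℝ ρ q (1, 0)) (dT H q) (0, z)
          (cuA A B W)) (cuA A B y) (cuA A B V) +
        gamA (ρ (cuA A B y)).inverse (dT ρ (cuA A B y)) (fderiv ℝ ρ (cuA A B y) (1, 0))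
          (dT H (cuA A B y)) (0, z)
          (0, gamA (ρ (cuA A B y)).inverse (dT ρ (cuA A B y)) (fderiv ℝ ρ (cuA A B y) (1, 0))
            (dT H (cuA A B y)) (cuA A B V) (cuA A B W)) -
        gamA (ρ (cuA A B y)).inverse (dT ρ (cuA A B y)) (fderiv ℝ ρ (cuA A B y) (1, 0))
          (dT H (cuA A B y)) (cuA A B V)
          (0, gamA (ρ (cuA A B y)).inverse (dT ρ (cuA A B y)) (fderiv ℝ ρ (cuA A B y) (1, 0))
            (dT H (cuA A B y)) (0, z) (cuA A B W))) +
      ricciLoc g (pB A B y) V.2 W.2 := by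
  have hG2 := contDiffAt_hF (n := 2) hρ hH hg
  have hri := hneg.self_of_nhds.isInvertible
  have hgi := hgneg.self_of_nhds.isInvertible
  have hi : (hF ρ H g y).IsInvertible := hT_isInvertible hri hgi
  have hdχ := fun V W => differentiableAt_christoffel hG2 hi V W
  have hdρ := hρ.differentiableAt two_ne_zero
  have hdH := hH.differentiableAt two_ne_zero
  have hdg := hg.differentiableAt two_ne_zero
  have hgχ := fun v w => differentiableAt_christoffel hg hgi v w
  have hev : ∀ᶠ y' in nhds y, ∀ V W, christoffel (hF ρ H g) y' V W =
      ((0, (gamA (ρ (cuA A B y')).inverse (dT ρ (cuA A B y')) (fderiv ℝ ρ (cuA A B y') (1, 0))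
        (dT H (cuA A B y')) (cuA A B V) (cuA A B W),
        gamV (fderiv ℝ ρ (cuA A B y') (1, 0)) (fderiv ℝ H (cuA A B y')) (cuA A B V)
          (cuA A B W))), christoffel g (pB A B y') V.2 W.2) := by
    have t1 := (cuA A B).continuous.tendsto y
    have t2 := (pB A B).continuous.tendsto y
    filter_upwards [t1.eventually (hρ.eventually (by simp)), t1.eventually (hH.eventually (by simp)),
      t2.eventually (hg.eventually (by simp)), t1.eventually hneg, t2.eventually hgneg]
      with y' h1 h2 h3 h4 h5 V W
    exact christoffel_hF (h1.differentiableAt two_ne_zero) (h2.differentiableAt two_ne_zero)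
      (h3.differentiableAt two_ne_zero) h4.isInvertible h5.isInvertible V W
  have hχy := hev.self_of_nhds
  have hγ : ∀ a b, DifferentiableAt ℝ (fun q => gamA (ρ q).inverse (dT ρ q)
      (fderiv ℝ ρ q (1, 0)) (dT H q) a b) (cuA A B y) := fun a b =>
    (hasFDerivAt_gamA (differentiableAt_inverse hdρ hri) (differentiableAt_dT hρ)
      (((hρ.fderiv_right (m := 1) (by norm_num)).differentiableAt one_ne_zero).clm_apply
        (differentiableAt_const _)) (differentiableAt_dT hH) a b).differentiableAt
  have hu : ∀ V W Z, (fderiv ℝ (fun y' => christoffel (hF ρ H g) y' V W) y Z).1.1 = 0 := by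
    intro V W Z
    refine (clm_fderiv_apply (cu A B) (hdχ V W) Z).trans ?_
    have : (fun y' => cu A B (christoffel (hF ρ H g) y' V W)) =ᶠ[nhds y] fun _ => 0 :=
      hev.mono fun y' h => congrArg (cu A B) (h V W)
    rw [this.fderiv_eq]
    simp
  have hA : ∀ V W Z, (fderiv ℝ (fun y' => christoffel (hF ρ H g) y' V W) y Z).1.2.1 =
      fderiv ℝ (fun q => gamA (ρ q).inverse (dT ρ q) (fderiv ℝ ρ q (1, 0)) (dT H q)
        (cuA A B V) (cuA A B W)) (cuA A B y) (cuA A B Z) := by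
    intro V W Z
    refine (clm_fderiv_apply (pA A B) (hdχ V W) Z).trans ?_
    have : (fun y' => pA A B (christoffel (hF ρ H g) y' V W)) =ᶠ[nhds y] _ :=
      hev.mono fun y' h => congrArg (pA A B) (h V W)
    rw [this.fderiv_eq]
    exact DFunLike.congr_fun
      ((hγ (cuA A B V) (cuA A B W)).hasFDerivAt.comp y (cuA A B).hasFDerivAt).fderiv Z
  have hB : ∀ V W Z, (fderiv ℝ (fun y' => christoffel (hF ρ H g) y' V W) y Z).2 =
      fderiv ℝ (fun m => christoffel g m V.2 W.2) (pB A B y) Z.2 := by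
    intro V W Z
    refine (clm_fderiv_apply (pB A B) (hdχ V W) Z).trans ?_
    have : (fun y' => pB A B (christoffel (hF ρ H g) y' V W)) =ᶠ[nhds y]
        fun y' => christoffel g (pB A B y') V.2 W.2 :=
      hev.mono fun y' h => congrArg (pB A B) (h V W)
    rw [this.fderiv_eq]
    exact DFunLike.congr_fun ((hgχ V.2 W.2).hasFDerivAt.comp y (pB A B).hasFDerivAt).fderiv Z
  have hcv : ev A B = ((0, (0, 1)), 0) := rfl
  have hev0 : ∀ W, (fun y' => christoffel (hF ρ H g) y' (ev A B) W) =ᶠ[nhds y] fun _ => 0 := by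
    intro W
    filter_upwards [hev] with y' h
    rw [h]
    have e1 : christoffel g (pB A B y') (ev A B).2 W.2 = 0 :=
      (chrL (g (pB A B y')).inverse (fderiv ℝ g (pB A B y')) W.2).map_zero
    rw [e1]
    have e2 : ∀ (q : ℝ × A) w, chr (ρ q).inverse (dT ρ q) 0 w = 0 := fun q w =>
      (chrL (ρ q).inverse (dT ρ q) w).map_zero
    have e3 : cuA A B (ev A B) = (0, 0) := rfl
    rw [e3]
    have e4 : ∀ q : ℝ × A, fderiv ℝ H q (0, 0) = 0 := fun q => map_zero _
    simp [gamA, gamV, e2, e4]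
  have hevv : (curvature (hF ρ H g) y (ev A B) V W).1.2.2 = 0 := by
    have h1 : fderiv ℝ (fun y' => christoffel (hF ρ H g) y' V W) y (ev A B) = 0 := by
      -- The metric is invariant under translation along `∂_v`, hence so are its Christoffel
      -- symbols.
      have hconst : ∀ t : ℝ, christoffel (hF ρ H g) (y + t • ev A B) V W =
          christoffel (hF ρ H g) y V W := by
        intro t
        have h0 : (fun x => hF ρ H g (x + t • ev A B)) = hF ρ H g := by
          funext x
          simp [hF, ev]
        rw [christoffel, christoffel, ← fderiv_comp_add_right, h0, congrFun h0 y]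
      rw [← (hdχ V W).lineDeriv_eq_fderiv, lineDeriv]
      simp only [hconst, deriv_const]
    have h2 : fderiv ℝ (fun y' => christoffel (hF ρ H g) y' (ev A B) W) y V = 0 := by
      rw [(hev0 W).fderiv_eq]; simp
    have h3 : ∀ W, christoffel (hF ρ H g) y (ev A B) W = 0 := fun W => (hev0 W).self_of_nhds
    have h4 : christoffel (hF ρ H g) y V 0 = 0 :=
      (chrR (hF ρ H g y).inverse (fderiv ℝ (hF ρ H g) y) V).map_zero
    rw [curvature, h1, h2, h3, h3, h4]
    simp
  rw [ricciLoc, trc_tot (isLinearMap_curvature hdχ V W), hevv]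
  have e1 : (curvature (hF ρ H g) y (eu A B) V W).1.1 = 0 := by
    simp only [curvature, Prod.fst_add, Prod.fst_sub, hu, hχy]
    simp
  rw [e1, zero_add, add_zero, ricciLoc]
  congr 1
  · congr 1
    funext z
    simp only [curvature, Prod.fst_add, Prod.fst_sub, Prod.snd_add, Prod.snd_sub, hA, hχy]
    rfl
  · congr 1
    funext z
    simp only [curvature, Prod.snd_add, Prod.snd_sub, hB, hχy]
    rfl

end WalkerMetric

end Sugra

end

noncomputable section

namespace Sugra

set_option maxSynthPendingDepth 3

/-! ### Tensor fields in charts. -/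

section ChartRep

variable {E H : Type*} [NormedAddCommGroup E] [NormedSpace ℝ E] [TopologicalSpace H]
  (I : ModelWithCorners ℝ E H) {M : Type*} [TopologicalSpace M] [ChartedSpace H M]
  {E' H' : Type*} [NormedAddCommGroup E'] [NormedSpace ℝ E'] [TopologicalSpace H']
  (I' : ModelWithCorners ℝ E' H') {M' : Type*} [TopologicalSpace M'] [ChartedSpace H' M']
  {E'' H'' : Type*} [NormedAddCommGroup E''] [NormedSpace ℝ E''] [TopologicalSpace H'']
  (I'' : ModelWithCorners ℝ E'' H'') {M'' : Type*} [TopologicalSpace M''] [ChartedSpace H'' M'']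

/-- A field of bilinear forms, with the tangent spaces identified with the model space. -/
def unB (g : BilinField I M) : M → E →L[ℝ] E →L[ℝ] ℝ := g

/-- A form, with the tangent spaces identified with the model space. -/
def unF {k : ℕ} (η : FormField I M k) : M → E [⋀^Fin k]→L[ℝ] ℝ := η

/-- The differential of a map, with the tangent spaces identified with the model spaces. -/
def mfd (f : M → M') (x : M) : E →L[ℝ] E' := mfderiv I I' f x

/-- The differential of a function, with the tangent spaces identified with the model space. -/
def mvd {F : Type*} [NormedAddCommGroup F] [NormedSpace ℝ F] (f : M → F) (x : M) : E →L[ℝ] F :=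
  mvfderiv I f x

/-- The differential of the inverse chart, with the tangent spaces identified with the model
space. -/
def cid (x₀ : M) (y : E) : E →L[ℝ] E := chartInvDeriv I x₀ y

theorem bilinRep_eq (g : BilinField I M) (x₀ : M) (y : E) :
    bilinRep I g x₀ y = pullB (cid I x₀ y) (unB I g ((extChartAt I x₀).symm y)) := rfl

theorem formRep_eq {k : ℕ} (η : FormField I M k) (x₀ : M) (y : E) :
    formRep I η x₀ y =
      (unF I η ((extChartAt I x₀).symm y)).compContinuousLinearMap (cid I x₀ y) := rfl

theorem cid_eq_mfd (x₀ : M) (y : E) :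
    cid I x₀ y = mfd 𝓘(ℝ, E) I (extChartAt I x₀).symm y := rfl

theorem mvd_eq_mfd {F : Type*} [NormedAddCommGroup F] [NormedSpace ℝ F] (f : M → F) (x : M) :
    mvd I f x = mfd I 𝓘(ℝ, F) f x := rfl

variable {I I' I''} in
theorem mfd_comp {g : M' → M''} {f : M → M'} {x : M} (hg : MDifferentiableAt I' I'' g (f x))
    (hf : MDifferentiableAt I I' f x) :
    mfd I I'' (fun z => g (f z)) x = mfd I' I'' g (f x) ∘L mfd I I' f x :=
  mfderiv_comp x hg hf

theorem mfd_eq_fderiv (f : E → E') (x : E) : mfd 𝓘(ℝ, E) 𝓘(ℝ, E') f x = fderiv ℝ f x :=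
  mfderiv_eq_fderiv

section
variable [IsManifold I 1 M] [I.Boundaryless] [IsManifold I' 1 M'] [I'.Boundaryless]

variable {I I'}

theorem mdifferentiableAt_extChartAt_symm {x₀ : M} {y : E} (hy : y ∈ (extChartAt I x₀).target) :
    MDifferentiableAt 𝓘(ℝ, E) I (extChartAt I x₀).symm y := by
  have := mdifferentiableWithinAt_extChartAt_symm hy
  rwa [I.range_eq_univ, mdifferentiableWithinAt_univ] at this

theorem cid_isInvertible {x₀ : M} {y : E} (hy : y ∈ (extChartAt I x₀).target) :
    (cid I x₀ y).IsInvertible := by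
  have := isInvertible_mfderivWithin_extChartAt_symm hy
  rw [I.range_eq_univ, mfderivWithin_univ] at this
  exact this

/-- The tangent space at `x` is identified with the model space by the preferred chart at `x`.
Therefore `dForm` and `ricci` at `x` are the local expressions at the base point, with no change of
frame. -/
theorem cid_self (x : M) : cid I x (extChartAt I x x) = ContinuousLinearMap.id ℝ E := by
  have := mfderivWithin_range_extChartAt_symm (I := I) (x := x)
  rw [I.range_eq_univ, mfderivWithin_univ] at this
  exact this

omit [I.Boundaryless] in
theorem mvd_extChartAt_self (x : M) :
    mvd I (extChartAt I x) x = ContinuousLinearMap.id ℝ E :=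
  mfderiv_extChartAt_self (I := I) (x := x)

theorem bilinRep_self (g : BilinField I M) (x : M) :
    bilinRep I g x (extChartAt I x x) = unB I g x := by
  rw [bilinRep_eq, cid_self, (extChartAt I x).left_inv (mem_extChartAt_source x)]
  rfl

theorem formRep_self {k : ℕ} (η : FormField I M k) (x : M) :
    formRep I η x (extChartAt I x x) = unF I η x := by
  rw [formRep_eq, cid_self, (extChartAt I x).left_inv (mem_extChartAt_source x)]
  rfl

omit [I.Boundaryless] in
theorem unF_dForm {k : ℕ} (η : FormField I M k) (x : M) :
    unF I (dForm I η) x = extDeriv (formRep I η x) (extChartAt I x x) := by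
  have : unF I (dForm I η) x = (extDeriv (formRep I η x) (extChartAt I x x)).compContinuousLinearMap
    (mvd I (extChartAt I x) x) := rfl
  rw [this, mvd_extChartAt_self]
  rfl

omit [I.Boundaryless] in
theorem ricci_eq [FiniteDimensional ℝ E] (g : BilinField I M) (x : M) (v w : E) :
    ricci I g x v w = ricciLoc (bilinRep I g x) (extChartAt I x x) v w := by
  have : ricci I g x v w = ricciLoc (bilinRep I g x) (extChartAt I x x)
    (mvd I (extChartAt I x) x v) (mvd I (extChartAt I x) x w) := rfl
  rw [this, mvd_extChartAt_self]
  rfl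

theorem mvd_comp_cid {F : Type*} [NormedAddCommGroup F] [NormedSpace ℝ F] {f : M → F} {x₀ : M}
    {y : E} (hy : y ∈ (extChartAt I x₀).target)
    (hf : MDifferentiableAt I 𝓘(ℝ, F) f ((extChartAt I x₀).symm y)) :
    mvd I f ((extChartAt I x₀).symm y) ∘L cid I x₀ y =
      fderiv ℝ (fun z => f ((extChartAt I x₀).symm z)) y := by
  rw [mvd_eq_mfd, cid_eq_mfd, ← mfd_comp hf (mdifferentiableAt_extChartAt_symm hy), mfd_eq_fderiv]

/-- The chain rule applied to a projection that is the linear map `π` in charts. -/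
theorem mfd_comp_cid {p : M → M'} {π : E →L[ℝ] E'} {x₀ : M} {x₀' : M'} {y : E}
    (hy : y ∈ (extChartAt I x₀).target) (hy' : π y ∈ (extChartAt I' x₀').target)
    (hp : MDifferentiableAt I I' p ((extChartAt I x₀).symm y))
    (h : ∀ z, p ((extChartAt I x₀).symm z) = (extChartAt I' x₀').symm (π z)) :
    mfd I I' p ((extChartAt I x₀).symm y) ∘L cid I x₀ y = cid I' x₀' (π y) ∘L π := by
  have h1 := mfd_comp (I := 𝓘(ℝ, E)) hp (mdifferentiableAt_extChartAt_symm hy)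
  have h2 := mfd_comp (I := 𝓘(ℝ, E)) (mdifferentiableAt_extChartAt_symm hy')
    (π.differentiableAt (x := y)).mdifferentiableAt
  rw [cid_eq_mfd, cid_eq_mfd, ← h1]
  simp only [h]
  rw [h2, mfd_eq_fderiv, π.fderiv]

theorem bilinRep_pullBilin {p : M → M'} {π : E →L[ℝ] E'} {x₀ : M} {x₀' : M'} {y : E}
    (hy : y ∈ (extChartAt I x₀).target) (hy' : π y ∈ (extChartAt I' x₀').target)
    (hp : MDifferentiableAt I I' p ((extChartAt I x₀).symm y))
    (h : ∀ z, p ((extChartAt I x₀).symm z) = (extChartAt I' x₀').symm (π z))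
    (g : BilinField I' M') :
    bilinRep I (pullBilin I I' p g) x₀ y = pullB π (bilinRep I' g x₀' (π y)) := by
  have h1 : bilinRep I (pullBilin I I' p g) x₀ y = pullB (mfd I I' p ((extChartAt I x₀).symm y) ∘L
    cid I x₀ y) (unB I' g (p ((extChartAt I x₀).symm y))) := rfl
  rw [h1, mfd_comp_cid hy hy' hp h, h]
  rfl

theorem formRep_pullForm {p : M → M'} {π : E →L[ℝ] E'} {x₀ : M} {x₀' : M'} {y : E}
    (hy : y ∈ (extChartAt I x₀).target) (hy' : π y ∈ (extChartAt I' x₀').target)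
    (hp : MDifferentiableAt I I' p ((extChartAt I x₀).symm y))
    (h : ∀ z, p ((extChartAt I x₀).symm z) = (extChartAt I' x₀').symm (π z))
    {k : ℕ} (η : FormField I' M' k) :
    formRep I (pullForm I I' p η) x₀ y =
      (formRep I' η x₀' (π y)).compContinuousLinearMap π := by
  have h1 : formRep I (pullForm I I' p η) x₀ y = (unF I' η (p ((extChartAt I x₀).symm y))
    ).compContinuousLinearMap (mfd I I' p ((extChartAt I x₀).symm y) ∘L cid I x₀ y) := rfl
  rw [h1, mfd_comp_cid hy hy' hp h, h]
  rfl

theorem formRep_dFun {f : M → ℝ} {x₀ : M} {y : E} (hy : y ∈ (extChartAt I x₀).target)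
    (hf : MDifferentiableAt I 𝓘(ℝ, ℝ) f ((extChartAt I x₀).symm y)) :
    formRep I (dFun I f) x₀ y = oneForm (fderiv ℝ (fun z => f ((extChartAt I x₀).symm z)) y) := by
  rw [← mvd_comp_cid hy hf]
  rfl

variable [FiniteDimensional ℝ E]

/-- The differential of the inverse chart is an isomorphism, hence compatible with the inverse
metrics, and the star commutes with it. -/
theorem formRep_starForm {g : BilinField I M} {k m : ℕ} {vol : FormField I M (m + k)}
    {β : FormField I M k} {x₀ : M} {y : E} (hy : y ∈ (extChartAt I x₀).target)
    (hg : (unB I g ((extChartAt I x₀).symm y)).IsInvertible) :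
    formRep I (starForm I g vol β) x₀ y =
      hodge (bilinRep I g x₀ y) (formRep I vol x₀ y) (formRep I β x₀ y) := by
  obtain ⟨e, he⟩ := cid_isInvertible hy
  have h1 := (isCoisometry_of_equiv e hg).hodge_comp (m := m)
    (unF I vol ((extChartAt I x₀).symm y)) (unF I β ((extChartAt I x₀).symm y))
  have h2 : formRep I (starForm I g vol β) x₀ y = (hodge (unB I g ((extChartAt I x₀).symm y))
    (unF I vol ((extChartAt I x₀).symm y)) (unF I β ((extChartAt I x₀).symm y))
    ).compContinuousLinearMap (cid I x₀ y) := rfl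
  rw [h2, bilinRep_eq, formRep_eq, formRep_eq, ← he]
  exact h1.symm

end

theorem isVolumeForm_rep {g : BilinField I M} {n : ℕ} {vol : FormField I M n}
    (h : ∀ x, IsVolumeForm (g x) (vol x)) (x₀ : M) (y : E) :
    IsVolumeForm (bilinRep I g x₀ y) (formRep I vol x₀ y) := fun v =>
  h ((extChartAt I x₀).symm y) fun i => chartInvDeriv I x₀ y (v i)

theorem isNegDef_rep [IsManifold I 1 M] [I.Boundaryless] {g : BilinField I M}
    (h : ∀ x, IsNegDef (g x)) {x₀ : M} {y : E} (hy : y ∈ (extChartAt I x₀).target) :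
    IsNegDef (bilinRep I g x₀ y) := by
  refine ⟨fun v w => (h ((extChartAt I x₀).symm y)).1 _ _, fun v hv => ?_⟩
  refine (h ((extChartAt I x₀).symm y)).2 (chartInvDeriv I x₀ y v) fun h0 => hv ?_
  refine (cid_isInvertible hy).injective ?_
  rw [map_zero]
  exact h0

end ChartRep

end Sugra

end

noncomputable section

namespace Sugra

set_option maxSynthPendingDepth 3

/-! ### Naturality of the wedge product. -/

section WedgePull

variable {V W : Type*} [NormedAddCommGroup V] [NormedSpace ℝ V] [NormedAddCommGroup W]
  [NormedSpace ℝ W]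

theorem wedge_compContinuousLinearMap {k l : ℕ} (α : V [⋀^Fin k]→L[ℝ] ℝ) (β : V [⋀^Fin l]→L[ℝ] ℝ)
    (L : W →L[ℝ] V) : (wedge α β).compContinuousLinearMap L =
      wedge (α.compContinuousLinearMap L) (β.compContinuousLinearMap L) := by
  ext v
  rw [ContinuousAlternatingMap.compContinuousLinearMap_apply, wedge_apply, wedge_apply]
  rfl

end WedgePull

/-! ### Metric and flux in the product chart. -/

section ProductChart

/-- The model space of three-manifolds. -/
abbrev E3 := EuclideanSpace ℝ (Fin 3)

/-- The model space of six-manifolds. -/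
abbrev E6 := EuclideanSpace ℝ (Fin 6)

variable {N : Type*} [TopologicalSpace N] [ChartedSpace E3 N] {M : Type*} [TopologicalSpace M]
  [ChartedSpace E6 M]

theorem extChartAt_five_symm (p : ℝ × N × ℝ) (z : ℝ × (E3 × ℝ)) :
    (extChartAt I5 p).symm z = (z.1, (extChartAt I3 p.2.1).symm z.2.1, z.2.2) := by
  rw [extChartAt_prod, extChartAt_prod]
  rfl

theorem extChartAt_eleven_symm (p : (ℝ × N × ℝ) × M) (y : Tot E3 E6) :
    (extChartAt I11 p).symm y = ((extChartAt I5 p.1).symm y.1, (extChartAt I6 p.2).symm y.2) := by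
  rw [extChartAt_prod]
  rfl

theorem extChartAt_eleven (p : (ℝ × N × ℝ) × M) : extChartAt I11 p p =
    ((p.1.1, (extChartAt I3 p.1.2.1 p.1.2.1, p.1.2.2)), extChartAt I6 p.2 p.2) := by
  rw [extChartAt_prod, extChartAt_prod, extChartAt_prod]
  rfl

theorem mem_target_five {p : ℝ × N × ℝ} {z : ℝ × (E3 × ℝ)} :
    z ∈ (extChartAt I5 p).target ↔ z.2.1 ∈ (extChartAt I3 p.2.1).target := by
  rw [extChartAt_prod, extChartAt_prod]
  simp only [PartialEquiv.prod_target, Set.mem_prod, extChartAt_model_space_eq_id]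
  simp

theorem mem_target_eleven {p : (ℝ × N × ℝ) × M} {y : Tot E3 E6} :
    y ∈ (extChartAt I11 p).target ↔ y.1.2.1 ∈ (extChartAt I3 p.1.2.1).target ∧
      y.2 ∈ (extChartAt I6 p.2).target := by
  rw [extChartAt_prod, PartialEquiv.prod_target, Set.mem_prod, mem_target_five]

/-- The projection of `ℝ × A × ℝ` to `A`. -/
def p5 : ℝ × (E3 × ℝ) →L[ℝ] E3 :=
  ContinuousLinearMap.fst ℝ E3 ℝ ∘L ContinuousLinearMap.snd ℝ ℝ (E3 × ℝ)

theorem mdifferentiableAt_proj_N (q : ℝ × N × ℝ) :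
    MDifferentiableAt I5 I3 (fun q : ℝ × N × ℝ => q.2.1) q :=
  MDifferentiableAt.comp q mdifferentiableAt_fst mdifferentiableAt_snd

theorem mdifferentiableAt_proj_v (q : ℝ × N × ℝ) :
    MDifferentiableAt I5 𝓘(ℝ, ℝ) (fun q : ℝ × N × ℝ => q.2.2) q :=
  MDifferentiableAt.comp q mdifferentiableAt_snd mdifferentiableAt_snd

variable [IsManifold (𝓡 3) 1 N] [IsManifold (𝓡 6) 1 M]

theorem du_comp_cid {p : ℝ × N × ℝ} {z : ℝ × (E3 × ℝ)} (hz : z ∈ (extChartAt I5 p).target) :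
    mvd I5 (fun q : ℝ × N × ℝ => q.1) ((extChartAt I5 p).symm z) ∘L cid I5 p z =
      ContinuousLinearMap.fst ℝ ℝ (E3 × ℝ) := by
  rw [mvd_comp_cid hz mdifferentiableAt_fst]
  simp only [extChartAt_five_symm]
  exact (ContinuousLinearMap.fst ℝ ℝ (E3 × ℝ)).fderiv

theorem dv_comp_cid {p : ℝ × N × ℝ} {z : ℝ × (E3 × ℝ)} (hz : z ∈ (extChartAt I5 p).target) :
    mvd I5 (fun q : ℝ × N × ℝ => q.2.2) ((extChartAt I5 p).symm z) ∘L cid I5 p z =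
      ContinuousLinearMap.snd ℝ E3 ℝ ∘L ContinuousLinearMap.snd ℝ ℝ (E3 × ℝ) := by
  rw [mvd_comp_cid hz (mdifferentiableAt_proj_v _)]
  simp only [extChartAt_five_symm]
  exact (ContinuousLinearMap.snd ℝ E3 ℝ ∘L ContinuousLinearMap.snd ℝ ℝ (E3 × ℝ)).fderiv

theorem bilinRep_walker (ρ : ℝ → BilinField I3 N) (H : ℝ → N → ℝ) {p : ℝ × N × ℝ}
    {z : ℝ × (E3 × ℝ)} (hz : z ∈ (extChartAt I5 p).target) (V W : ℝ × (E3 × ℝ)) :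
    bilinRep I5 (walker ρ H) p z V W = V.1 * W.2.2 + V.2.2 * W.1 +
      bilinRep I3 (ρ z.1) p.2.1 z.2.1 V.2.1 W.2.1 +
      H z.1 ((extChartAt I3 p.2.1).symm z.2.1) * (V.1 * W.1) := by
  have hu : ∀ V, mvd I5 (fun q : ℝ × N × ℝ => q.1) ((extChartAt I5 p).symm z) (cid I5 p z V) = V.1 :=
    fun V => DFunLike.congr_fun (du_comp_cid hz) V
  have hv : ∀ V, mvd I5 (fun q : ℝ × N × ℝ => q.2.2) ((extChartAt I5 p).symm z) (cid I5 p z V) =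
      V.2.2 := fun V => DFunLike.congr_fun (dv_comp_cid hz) V
  have hN := bilinRep_pullBilin (π := p5) hz (mem_target_five.1 hz) (mdifferentiableAt_proj_N _)
    (fun z => by rw [extChartAt_five_symm]; rfl) (ρ ((extChartAt I5 p).symm z).1)
  have h1 : bilinRep I5 (walker ρ H) p z V W =
      mvd I5 (fun q : ℝ × N × ℝ => q.1) ((extChartAt I5 p).symm z) (cid I5 p z V) *
        mvd I5 (fun q : ℝ × N × ℝ => q.2.2) ((extChartAt I5 p).symm z) (cid I5 p z W) +
      mvd I5 (fun q : ℝ × N × ℝ => q.2.2) ((extChartAt I5 p).symm z) (cid I5 p z V) *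
        mvd I5 (fun q : ℝ × N × ℝ => q.1) ((extChartAt I5 p).symm z) (cid I5 p z W) +
      bilinRep I5 (pullBilin I5 I3 (fun q : ℝ × N × ℝ => q.2.1)
        (ρ ((extChartAt I5 p).symm z).1)) p z V W +
      H ((extChartAt I5 p).symm z).1 ((extChartAt I5 p).symm z).2.1 *
        (mvd I5 (fun q : ℝ × N × ℝ => q.1) ((extChartAt I5 p).symm z) (cid I5 p z V) *
        mvd I5 (fun q : ℝ × N × ℝ => q.1) ((extChartAt I5 p).symm z) (cid I5 p z W)) := rfl
  rw [h1, hu, hu, hv, hv, hN, extChartAt_five_symm]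
  rfl

theorem bilinRep_prodMetric (ρ : ℝ → BilinField I3 N) (H : ℝ → N → ℝ) (g : BilinField I6 M)
    {p : (ℝ × N × ℝ) × M} {y : Tot E3 E6} (hy : y ∈ (extChartAt I11 p).target) :
    bilinRep I11 (prodMetric (walker ρ H) g) p y =
      hF (fun q => bilinRep I3 (ρ q.1) p.1.2.1 q.2)
        (fun q => H q.1 ((extChartAt I3 p.1.2.1).symm q.2)) (bilinRep I6 g p.2) y := by
  have hy1 : y.1 ∈ (extChartAt I5 p.1).target := mem_target_five.2 (mem_target_eleven.1 hy).1
  have h5 := bilinRep_pullBilin (I' := I5) (p := Prod.fst) (x₀' := p.1)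
    (π := ContinuousLinearMap.fst ℝ (ℝ × (E3 × ℝ)) E6) hy
    hy1 mdifferentiableAt_fst
    (fun z => by rw [extChartAt_eleven_symm]; rfl) (walker ρ H)
  have h6 := bilinRep_pullBilin (I' := I6) (p := Prod.snd) (x₀' := p.2)
    (π := ContinuousLinearMap.snd ℝ (ℝ × (E3 × ℝ)) E6) hy
    (mem_target_eleven.1 hy).2 mdifferentiableAt_snd
    (fun z => by rw [extChartAt_eleven_symm]; rfl) g
  have h1 : bilinRep I11 (prodMetric (walker ρ H) g) p y =
    bilinRep I11 (pullBilin I11 I5 Prod.fst (walker ρ H)) p y +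
      bilinRep I11 (pullBilin I11 I6 Prod.snd g) p y := rfl
  rw [h1, h5, h6]
  refine ContinuousLinearMap.ext fun V => ContinuousLinearMap.ext fun W => ?_
  rw [hF, hT_apply]
  simp only [_root_.add_apply, pullB_apply]
  rw [ContinuousLinearMap.coe_fst', bilinRep_walker ρ H hy1]
  rfl

theorem formRep_duWedge {k : ℕ} (η : ℝ → FormField I3 N k) {p : ℝ × N × ℝ}
    {z : ℝ × (E3 × ℝ)} (hz : z ∈ (extChartAt I5 p).target) :
    formRep I5 (duWedge η) p z = wedge (oneForm (ContinuousLinearMap.fst ℝ ℝ (E3 × ℝ)))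
      ((formRep I3 (η z.1) p.2.1 z.2.1).compContinuousLinearMap p5) := by
  have hN := formRep_pullForm (π := p5) hz (mem_target_five.1 hz) (mdifferentiableAt_proj_N _)
    (fun z => by rw [extChartAt_five_symm]; rfl) (η ((extChartAt I5 p).symm z).1)
  have h1 : formRep I5 (duWedge η) p z = (wedge (oneForm (mvd I5 (fun q : ℝ × N × ℝ => q.1)
    ((extChartAt I5 p).symm z))) (unF I5 (pullForm I5 I3 (fun q : ℝ × N × ℝ => q.2.1)
      (η ((extChartAt I5 p).symm z).1)) ((extChartAt I5 p).symm z))).compContinuousLinearMap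
        (cid I5 p z) := rfl
  rw [h1, wedge_compContinuousLinearMap, ← formRep_eq, hN, ← du_comp_cid hz, extChartAt_five_symm]
  rfl

/-- Moving `ν` to the front of the three-form `du ∧ η` costs `(-1)³`, and moving it behind `du`
costs another sign, so `β̃ ∧ ν` becomes `du ∧ ν ∧ η`. -/
theorem formRep_fluxForm (vol : ℝ → FormField I3 N 3) (f : ℝ → N → ℝ) (η : ℝ → FormField I3 N 2)
    (φ : M → ℝ) (ν : FormField I6 M 1) {p : (ℝ × N × ℝ) × M} {y : Tot E3 E6}
    (hy : y ∈ (extChartAt I11 p).target) {ξ : E6 →L[ℝ] ℝ}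
    (hξ : formRep I6 ν p.2 y.2 = oneForm ξ) :
    formRep I11 (fluxForm φ (alphaForm vol f) (betaForm η) ν) p y =
      lw (cu E3 E6) (preFlux (f y.1.1 ((extChartAt I3 p.1.2.1).symm y.1.2.1) •
        formRep I3 (vol y.1.1) p.1.2.1 y.1.2.1) (formRep I3 (η y.1.1) p.1.2.1 y.1.2.1) ξ
        (φ ((extChartAt I6 p.2).symm y.2))) := by
  have hy1 : y.1 ∈ (extChartAt I5 p.1).target := mem_target_five.2 (mem_target_eleven.1 hy).1
  have h5 : ∀ {k : ℕ} (α : FormField I5 (ℝ × N × ℝ) k), _ := fun {k} α =>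
    formRep_pullForm (I' := I5) (p := Prod.fst) (x₀' := p.1)
    (π := ContinuousLinearMap.fst ℝ (ℝ × (E3 × ℝ)) E6) hy
    hy1 mdifferentiableAt_fst
    (fun z => by rw [extChartAt_eleven_symm]; rfl) α
  have h6 := formRep_pullForm (I' := I6) (p := Prod.snd) (x₀' := p.2)
    (π := ContinuousLinearMap.snd ℝ (ℝ × (E3 × ℝ)) E6) hy
    (mem_target_eleven.1 hy).2 mdifferentiableAt_snd
    (fun z => by rw [extChartAt_eleven_symm]; rfl) ν
  have h1 : formRep I11 (fluxForm φ (alphaForm vol f) (betaForm η) ν) p y =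
      φ ((extChartAt I11 p).symm y).2 • formRep I11 (pullForm I11 I5 Prod.fst (alphaForm vol f)) p y +
      (wedge (unF I11 (pullForm I11 I5 Prod.fst (betaForm η)) ((extChartAt I11 p).symm y))
        (unF I11 (pullForm I11 I6 Prod.snd ν) ((extChartAt I11 p).symm y))
        ).compContinuousLinearMap (cid I11 p y) := rfl
  rw [h1, wedge_compContinuousLinearMap, ← formRep_eq, ← formRep_eq, h5, h5, h6, alphaForm, betaForm]
  rw [ContinuousLinearMap.coe_fst', ContinuousLinearMap.coe_snd', hξ,
    formRep_duWedge _ hy1, formRep_duWedge _ hy1, extChartAt_eleven_symm]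
  have e1 : (oneForm ξ).compContinuousLinearMap (ContinuousLinearMap.snd ℝ (ℝ × (E3 × ℝ)) E6) =
    oneForm (ξ ∘L pB E3 E6) := rfl
  have e2 : ∀ {k : ℕ} (γ : E3 [⋀^Fin k]→L[ℝ] ℝ), (wedge (oneForm (ContinuousLinearMap.fst ℝ ℝ
      (E3 × ℝ))) (γ.compContinuousLinearMap p5)).compContinuousLinearMap
      (ContinuousLinearMap.fst ℝ (ℝ × (E3 × ℝ)) E6) =
      wedge (oneForm (cu E3 E6)) (γ.compContinuousLinearMap (pA E3 E6)) := fun γ =>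
    wedge_compContinuousLinearMap _ _ _
  rw [e1, e2, e2, wedge_oneForm_right]
  have e3 : wedge (oneForm (cu E3 E6)) ((formRep I3 (η y.1.1) p.1.2.1 y.1.2.1
      ).compContinuousLinearMap (pA E3 E6)) = lw (cu E3 E6) ((formRep I3 (η y.1.1) p.1.2.1 y.1.2.1
      ).compContinuousLinearMap (pA E3 E6)) := by
    ext v
    exact wedge_oneForm_left _ _ _
  have e4 : ∀ γ : Tot E3 E6 [⋀^Fin 3]→L[ℝ] ℝ, wedge (oneForm (cu E3 E6)) γ = lw (cu E3 E6) γ := by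
    intro γ
    ext v
    exact wedge_oneForm_left _ _ _
  -- The degrees `1 + 2` and `1 + 3` have to be unfolded to match those produced by `lw`.
  erw [e3, e4]
  rw [preFlux, lw_add, lw_smul, lw_lw (cu E3 E6)]
  ext v
  simp only [ContinuousAlternatingMap.add_apply, ContinuousAlternatingMap.neg_apply,
    ContinuousAlternatingMap.smul_apply, smul_eq_mul]
  norm_num
  exact Or.inl rfl

end ProductChart

end Sugra

end

noncomputable section

namespace Sugra

set_option maxSynthPendingDepth 3

/-! ### The star on top-degree forms. -/

section TopDegree

variable {V : Type*} [NormedAddCommGroup V] [NormedSpace ℝ V] [FiniteDimensional ℝ V]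

theorem hodge_top {n : ℕ} (G : V →L[ℝ] V →L[ℝ] ℝ) {vol : V [⋀^Fin (0 + n)]→L[ℝ] ℝ}
    {vol' : V [⋀^Fin n]→L[ℝ] ℝ} (h : ∀ v, vol v = vol' fun i => v (Fin.cast (zero_add n).symm i))
    (β : V [⋀^Fin n]→L[ℝ] ℝ) (w : Fin 0 → V) : hodge (m := 0) G vol β w = formInner G vol' β := by
  rw [hodge_apply, formInner]
  congr 1
  refine Finset.sum_congr rfl fun J _ => ?_
  rw [interiorAlt_apply, interiorMany_apply, h, mul_comm]
  congr 2
  funext i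
  rw [prependTuple, dif_pos]
  · rfl

theorem IsVolumeForm.exists_ne_zero {n : ℕ} (hn : Module.finrank ℝ V = n)
    {G : V →L[ℝ] V →L[ℝ] ℝ} (hG : IsNegDef G) {vol : V [⋀^Fin n]→L[ℝ] ℝ}
    (hvol : IsVolumeForm G vol) : ∃ b, vol b ≠ 0 := by
  obtain ⟨e, he⟩ := hG.exists_orthonormal hn
  refine ⟨e, fun h => ?_⟩
  have := hvol.sq_eq_one (pseudoOrthonormal_of_basis he)
  rw [h] at this
  norm_num at this

/-- The star of `c vol` is `c ‖vol‖² = (-1)ⁿ c`. The resulting sign is minus on `N` and plus on `M`.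
-/
theorem eq_smul_vol_of_hodge {n : ℕ} (hn : Module.finrank ℝ V = n) {G : V →L[ℝ] V →L[ℝ] ℝ}
    (hG : IsNegDef G) {vol : V [⋀^Fin (0 + n)]→L[ℝ] ℝ} {vol' : V [⋀^Fin n]→L[ℝ] ℝ}
    (h : ∀ v, vol v = vol' fun i => v (Fin.cast (zero_add n).symm i)) (hvol : IsVolumeForm G vol')
    {T : V [⋀^Fin n]→L[ℝ] ℝ} {s : ℝ} (hT : ∀ w, hodge (m := 0) G vol T w = s) :
    T = ((-1) ^ n * s) • vol' := by
  obtain ⟨b, hb⟩ := hvol.exists_ne_zero hn hG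
  have h1 := top_form_eq_smul hn T vol' b hb
  have h2 := hT ![]
  rw [hodge_top G h, h1, formInner_smul_right, formInner_vol hn hG hvol] at h2
  have h3 : ((-1 : ℝ) ^ n) * (-1) ^ n = 1 := by rw [← mul_pow]; norm_num
  rw [h1, ← h2]
  congr 1
  linear_combination (-(T b / vol' b)) * h3

end TopDegree

/-! ### Regularity, closed one-forms, and locality of the Ricci tensor. -/

section Smoothness

variable {V : Type*} [NormedAddCommGroup V] [NormedSpace ℝ V]
  {P : Type*} [NormedAddCommGroup P] [NormedSpace ℝ P] {p : P}

theorem differentiableAt_iprod {k : ℕ} {X : P → V} {η : P → V [⋀^Fin (k + 1)]→L[ℝ] ℝ}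
    (hX : DifferentiableAt ℝ X p) (hη : DifferentiableAt ℝ η p) :
    DifferentiableAt ℝ (fun q => iprod (X q) (η q)) p := by
  have h1 : DifferentiableAt ℝ (fun q => (η q).curryLeft) p :=
    (ContinuousAlternatingMap.curryLeftLI (𝕜 := ℝ) (E := V) (F := ℝ) (n := k)
      ).toContinuousLinearMap.differentiableAt.comp p hη
  exact h1.clm_apply hX

theorem differentiableAt_hodge_oneForm [FiniteDimensional ℝ V] {m : ℕ}
    {G : P → V →L[ℝ] V →L[ℝ] ℝ} {vol : P → V [⋀^Fin (m + 1)]→L[ℝ] ℝ} {ξ : P → V →L[ℝ] ℝ}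
    (hG : DifferentiableAt ℝ G p) (hneg : ∀ᶠ q in nhds p, IsNegDef (G q))
    (hvol : DifferentiableAt ℝ vol p) (hξ : DifferentiableAt ℝ ξ p) :
    DifferentiableAt ℝ (fun q => hodge (G q) (vol q) (oneForm (ξ q))) p := by
  have h1 : (fun q => hodge (G q) (vol q) (oneForm (ξ q))) =ᶠ[nhds p]
      fun q => iprod ((G q).inverse (ξ q)) (vol q) := by
    filter_upwards [hneg] with q hq using hodge_oneForm hq.isInvertible hq.1 _ _
  refine DifferentiableAt.congr_of_eventuallyEq ?_ h1
  exact differentiableAt_iprod ((differentiableAt_inverse hG hneg.self_of_nhds.isInvertible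
    ).clm_apply hξ) hvol

/-- The covector of a one-form. -/
def cov : (V [⋀^Fin 1]→L[ℝ] ℝ) →L[ℝ] V →L[ℝ] ℝ :=
  (ContinuousAlternatingMap.ofSubsingletonLIE (𝕜 := ℝ) (E := V) (F := ℝ) (0 : Fin 1)
    ).symm.toContinuousLinearEquiv.toContinuousLinearMap

theorem oneForm_cov (η : V [⋀^Fin 1]→L[ℝ] ℝ) : oneForm (cov η) = η :=
  (ContinuousAlternatingMap.ofSubsingletonLIE (𝕜 := ℝ) (E := V) (F := ℝ) (0 : Fin 1)
    ).apply_symm_apply η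

theorem cov_oneForm (ξ : V →L[ℝ] ℝ) : cov (oneForm ξ) = ξ :=
  (ContinuousAlternatingMap.ofSubsingletonLIE (𝕜 := ℝ) (E := V) (F := ℝ) (0 : Fin 1)
    ).symm_apply_apply ξ

/-- The exterior derivative of a one-form on the pair `v, w` is the antisymmetrised derivative. -/
theorem fderiv_cov_symm {η : V → V [⋀^Fin 1]→L[ℝ] ℝ} {x : V} (hη : DifferentiableAt ℝ η x)
    (hd : extDeriv η x = 0) (v w : V) :
    fderiv ℝ (fun y => cov (η y)) x v w = fderiv ℝ (fun y => cov (η y)) x w v := by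
  have hc : ∀ a b, fderiv ℝ (fun y => cov (η y)) x a b = fderiv ℝ (fun y => η y fun _ => b) x a := by
    intro a b
    have h1 : DifferentiableAt ℝ (fun y => cov (η y)) x := cov.differentiableAt.comp x hη
    have h2 := clm_fderiv_apply (ContinuousLinearMap.apply ℝ ℝ b) h1 a
    refine h2.trans ?_
    congr 2
  have h := extDeriv_apply hη ![v, w]
  rw [hd, Fin.sum_univ_two] at h
  have e0 : (0 : Fin 2).removeNth ![v, w] = fun _ => w := by
    funext i; fin_cases i; rfl
  have e1 : (1 : Fin 2).removeNth ![v, w] = fun _ => v := by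
    funext i; fin_cases i; rfl
  rw [e0, e1] at h
  rw [hc, hc]
  simp at h
  linarith

theorem ricciLoc_congr [FiniteDimensional ℝ V] {G G' : V → V →L[ℝ] V →L[ℝ] ℝ} {x : V}
    (h : G =ᶠ[nhds x] G') (v w : V) : ricciLoc G x v w = ricciLoc G' x v w := by
  have hχ : ∀ a b, (fun y => christoffel G y a b) =ᶠ[nhds x] fun y => christoffel G' y a b := by
    intro a b
    filter_upwards [h.eventually_nhds] with y hy
    have hy' : G =ᶠ[nhds y] G' := hy
    rw [christoffel_eq_chr, christoffel_eq_chr, hy'.fderiv_eq, hy'.eq_of_nhds]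
  have hχx : ∀ a b, christoffel G x a b = christoffel G' x a b := fun a b => (hχ a b).eq_of_nhds
  rw [ricciLoc, ricciLoc]
  congr 1
  funext z
  rw [curvature, curvature, (hχ v w).fderiv_eq, (hχ z w).fderiv_eq]
  simp only [hχx]

end Smoothness

/-! ### Vanishing of the wedge of the flux with itself. -/

section Wedge

variable {V : Type*} [NormedAddCommGroup V] [NormedSpace ℝ V]

theorem lw_apply_eq_zero {k : ℕ} {ξ : V →L[ℝ] ℝ} (α : V [⋀^Fin k]→L[ℝ] ℝ) {v : Fin (k + 1) → V}
    (hv : ∀ i, ξ (v i) = 0) : lw ξ α v = 0 := by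
  rw [lw_apply]
  simp [hv]

/-- On distinct basis vectors `ξ` is nonzero at one of them at most, and that vector cannot be an
argument of both factors. Parity would not suffice, since the flux has even degree. -/
theorem wedge_lw_lw {ι : Type*} (e : Module.Basis ι ℝ V) (i₀ : ι)
    {ξ : V →L[ℝ] ℝ} (hξ : ∀ i, i ≠ i₀ → ξ (e i) = 0) {k l : ℕ} (α : V [⋀^Fin k]→L[ℝ] ℝ)
    (β : V [⋀^Fin l]→L[ℝ] ℝ) : wedge (lw ξ α) (lw ξ β) = 0 := by
  apply ContinuousAlternatingMap.toAlternatingMap_injective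
  refine Module.Basis.ext_alternating e fun v hv => ?_
  change wedge (lw ξ α) (lw ξ β) (fun i => e (v i)) = 0
  rw [wedge_apply]
  refine mul_eq_zero_of_right _ (Finset.sum_eq_zero fun σ _ => mul_eq_zero_of_right _ ?_)
  by_cases h1 : ∀ i, v (σ (Fin.castAdd (l + 1) i)) ≠ i₀
  · exact mul_eq_zero_of_left (lw_apply_eq_zero α fun i => hξ _ (h1 i)) _
  · push Not at h1
    obtain ⟨i, hi⟩ := h1
    refine mul_eq_zero_of_right _ (lw_apply_eq_zero β fun j => hξ _ fun hj => ?_)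
    have := σ.injective (hv (hi.trans hj.symm))
    have h2 := congrArg Fin.val this
    simp at h2
    omega

variable {A B : Type*} [NormedAddCommGroup A] [NormedSpace ℝ A] [FiniteDimensional ℝ A]
  [NormedAddCommGroup B] [NormedSpace ℝ B] [FiniteDimensional ℝ B]

theorem wedge_flux_self {k l : ℕ} (α : Tot A B [⋀^Fin k]→L[ℝ] ℝ) (β : Tot A B [⋀^Fin l]→L[ℝ] ℝ) :
    wedge (lw (cu A B) α) (lw (cu A B) β) = 0 := by
  let e := ((Module.Basis.singleton Unit ℝ).prod
    ((bas A).prod (Module.Basis.singleton Unit ℝ))).prod (bas B)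
  refine wedge_lw_lw e (Sum.inl (Sum.inl ())) (fun i hi => ?_) α β
  rcases i with (_ | _ | _) | _ <;> simp_all [e]

end Wedge

end Sugra

end

noncomputable section

namespace Sugra

set_option maxSynthPendingDepth 3

/-! ### Smooth fields and functions near a chart point. -/

section SmoothFields

variable {E H : Type*} [NormedAddCommGroup E] [NormedSpace ℝ E] [TopologicalSpace H]
  {I : ModelWithCorners ℝ E H} {M : Type*} [TopologicalSpace M] [ChartedSpace H M]

theorem target_mem_nhds [I.Boundaryless] {x₀ : M} {y : E} (hy : y ∈ (extChartAt I x₀).target) :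
    (extChartAt I x₀).target ∈ nhds y :=
  (isOpen_extChartAt_target x₀).mem_nhds hy

theorem univ_prod_target_mem_nhds [I.Boundaryless] {x₀ : M} {q : ℝ × E}
    (hy : q.2 ∈ (extChartAt I x₀).target) :
    Set.univ ×ˢ (extChartAt I x₀).target ∈ nhds q :=
  (isOpen_univ.prod (isOpen_extChartAt_target x₀)).mem_nhds ⟨Set.mem_univ _, hy⟩

theorem eventually_family [I.Boundaryless] {x₀ : M} {q : ℝ × E}
    (hy : q.2 ∈ (extChartAt I x₀).target) :
    ∀ᶠ q' in nhds q, q'.2 ∈ (extChartAt I x₀).target :=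
  Filter.mem_of_superset (univ_prod_target_mem_nhds hy) fun _ h => h.2

theorem contDiffAt_comp_symm [I.Boundaryless] [IsManifold I ∞ M] {φ : M → ℝ}
    (hφ : ContMDiff I 𝓘(ℝ, ℝ) ∞ φ) {x₀ : M} {y : E} (hy : y ∈ (extChartAt I x₀).target) :
    ContDiffAt ℝ ∞ (fun z => φ ((extChartAt I x₀).symm z)) y := by
  rw [← contMDiffAt_iff_contDiffAt]
  exact hφ.contMDiffAt.comp y
    ((contMDiffOn_extChartAt_symm (n := ∞) x₀).contMDiffAt (target_mem_nhds hy))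

theorem contDiffAt_family [I.Boundaryless] [IsManifold I ∞ M] {f : ℝ → M → ℝ}
    (hf : ContMDiff (𝓘(ℝ, ℝ).prod I) 𝓘(ℝ, ℝ) ∞ fun p : ℝ × M => f p.1 p.2) {x₀ : M} {q : ℝ × E}
    (hq : q.2 ∈ (extChartAt I x₀).target) :
    ContDiffAt ℝ ∞ (fun q : ℝ × E => f q.1 ((extChartAt I x₀).symm q.2)) q := by
  rw [← contMDiffAt_iff_contDiffAt]
  have h2 : ContMDiffAt 𝓘(ℝ, ℝ × E) I ∞ (fun q : ℝ × E => (extChartAt I x₀).symm q.2) q :=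
    ((contMDiffOn_extChartAt_symm (n := ∞) x₀).contMDiffAt (target_mem_nhds hq)).comp q
      contDiff_snd.contMDiff.contMDiffAt
  exact hf.contMDiffAt.comp (f := fun q : ℝ × E => (q.1, (extChartAt I x₀).symm q.2)) q
    (contDiff_fst.contMDiff.contMDiffAt.prodMk h2)

theorem contMDiff_slice {f : ℝ → M → ℝ}
    (hf : ContMDiff (𝓘(ℝ, ℝ).prod I) 𝓘(ℝ, ℝ) ∞ fun p : ℝ × M => f p.1 p.2) (u : ℝ) :
    ContMDiff I 𝓘(ℝ, ℝ) ∞ (f u) :=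
  hf.comp (contMDiff_const.prodMk contMDiff_id)

theorem formRep_smul {k : ℕ} {η : FormField I M k} {ζ : FormField I M k} {c : ℝ}
    (h : ∀ x, ζ x = c • η x) (x₀ : M) (y : E) : formRep I ζ x₀ y = c • formRep I η x₀ y := by
  ext v
  have := congrArg (fun α => α fun i => chartInvDeriv I x₀ y (v i)) (h ((extChartAt I x₀).symm y))
  exact this

theorem extDeriv_formRep_of_hodge [FiniteDimensional ℝ E] [I.Boundaryless] [IsManifold I 1 M]
    {k : ℕ} (hn : Module.finrank ℝ E = k + 1) {g : BilinField I M} {x : M}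
    (hg : IsNegDef (unB I g x)) {vol : E [⋀^Fin (0 + (k + 1))]→L[ℝ] ℝ}
    {vol' : E [⋀^Fin (k + 1)]→L[ℝ] ℝ}
    (h : ∀ v, vol v = vol' fun i => v (Fin.cast (zero_add (k + 1)).symm i))
    (hvol : IsVolumeForm (unB I g x) vol') {T : FormField I M k} {s : ℝ}
    (hT : ∀ w, hodge (m := 0) (unB I g x) vol (unF I (dForm I T) x) w = s) :
    extDeriv (formRep I T x) (extChartAt I x x) = ((-1) ^ (k + 1) * s) • vol' := by
  rw [← unF_dForm]
  exact eq_smul_vol_of_hodge hn hg h hvol hT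

end SmoothFields

/-- A continuous function with values in `{1, -1}` is locally constant: near `p` the product `t q *
t p` stays positive. -/
theorem eventually_eq_of_sq_eq_one {P : Type*} [TopologicalSpace P] {t : P → ℝ} {p : P}
    (ht : ContinuousAt t p) (h : ∀ᶠ q in nhds p, t q ^ 2 = 1) : ∀ᶠ q in nhds p, t q = t p := by
  have hp := h.self_of_nhds
  have h1 : ∀ᶠ q in nhds p, 0 < t q * t p := by
    refine (ht.mul continuousAt_const).eventually (lt_mem_nhds ?_)
    change 0 < t p * t p
    nlinarith
  filter_upwards [h, h1] with q hq hq1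
  have h2 : (t q - t p) * (t q + t p) = 0 := by linear_combination hq - hp
  rcases mul_eq_zero.1 h2 with h3 | h3
  · linarith
  · rw [eq_neg_of_add_eq_zero_left h3] at hq1
    nlinarith

/-- In an orthonormal basis the square norm is `(-1) ^ k` times a positive multiple of a sum of
squares of components. -/
theorem formInner_self_ne_zero {V : Type*} [NormedAddCommGroup V] [NormedSpace ℝ V]
    [FiniteDimensional ℝ V] {G : V →L[ℝ] V →L[ℝ] ℝ} (hG : IsNegDef G) {k : ℕ}
    {α : V [⋀^Fin k]→L[ℝ] ℝ} (hα : α ≠ 0) : formInner G α α ≠ 0 := by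
  obtain ⟨e, he⟩ := hG.exists_orthonormal rfl
  have hsum : ∀ ξ ζ : V →ₗ[ℝ] ℝ, ∑ i, ξ (e i) * ζ (-e i) =
      ζ (G.inverse ξ.toContinuousLinearMap) := by
    intro ξ ζ
    have : G.inverse ξ.toContinuousLinearMap = ∑ i, ξ (e i) • (-e i) := by
      rw [hG.isInvertible.inverse_apply_eq]
      apply ContinuousLinearMap.coe_injective
      refine e.ext fun j => ?_
      simp [he]
    rw [this]
    simp
  have h1 : ∀ J : Fin k → Fin (Module.finrank ℝ V), α (fun a => e (J a)) * α (fun a => -e (J a)) =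
      (-1) ^ k * α (fun a => e (J a)) ^ 2 := fun J => by
    have := α.map_smul_univ (fun _ => (-1 : ℝ)) (fun a => e (J a))
    simp at this
    rw [this]
    ring
  rw [formInner_eq_of_sum hsum]
  simp only [h1, ← Finset.mul_sum]
  refine mul_ne_zero (by positivity) (mul_ne_zero (by simp) fun h0 => hα ?_)
  rw [Finset.sum_eq_zero_iff_of_nonneg fun _ _ => sq_nonneg _] at h0
  apply ContinuousAlternatingMap.toAlternatingMap_injective
  refine Module.Basis.ext_alternating e fun v _ => ?_
  exact pow_eq_zero_iff two_ne_zero |>.1 (h0 v (Finset.mem_univ _))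

end Sugra

end

noncomputable section

namespace Sugra

set_option maxSynthPendingDepth 3

/-! ### The data on `N` in a chart. -/

section LocalData

variable {N : Type*} [TopologicalSpace N] [ChartedSpace E3 N] [IsManifold (𝓡 3) ∞ N]
  {M : Type*} [TopologicalSpace M] [ChartedSpace E6 M] [IsManifold (𝓡 6) ∞ M]

/-- The family of metrics in the chart at `x`. -/
def locBilin (ρ : ℝ → BilinField I3 N) (x : N) (q : ℝ × E3) : E3 →L[ℝ] E3 →L[ℝ] ℝ :=
  bilinRep I3 (ρ q.1) x q.2

/-- A family of forms in the chart at `x`. -/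
def locForm {k : ℕ} (η : ℝ → FormField I3 N k) (x : N) (q : ℝ × E3) : E3 [⋀^Fin k]→L[ℝ] ℝ :=
  formRep I3 (η q.1) x q.2

/-- A family of functions in the chart at `x`. -/
def locFun (f : ℝ → N → ℝ) (x : N) (q : ℝ × E3) : ℝ := f q.1 ((extChartAt I3 x).symm q.2)

/-- The star of the differential of `f` along `N`, in the chart at `x`. -/
def locStar (ρ : ℝ → BilinField I3 N) (vol : ℝ → FormField I3 N 3) (f : ℝ → N → ℝ) (x : N)
    (q : ℝ × E3) : E3 [⋀^Fin 2]→L[ℝ] ℝ :=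
  hodge (k := 1) (m := 2) (locBilin ρ x q) (locForm vol x q) (oneForm (dT (locFun f x) q))

variable {ρ : ℝ → BilinField I3 N} {vol : ℝ → FormField I3 N 3} {f : ℝ → N → ℝ} {x : N}
  {q : ℝ × E3}

theorem contDiffAt_locFun
    (hf : ContMDiff (𝓘(ℝ, ℝ).prod (𝓡 3)) 𝓘(ℝ, ℝ) ∞ (fun p : ℝ × N => f p.1 p.2))
    (hq : q.2 ∈ (extChartAt I3 x).target) : ContDiffAt ℝ ∞ (locFun f x) q :=
  contDiffAt_family hf hq

theorem contDiffAt_locBilin (hρ : IsRiemannianFamily I3 ρ) (hq : q.2 ∈ (extChartAt I3 x).target) :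
    ContDiffAt ℝ ∞ (locBilin ρ x) q :=
  (hρ.1 x).contDiffAt (univ_prod_target_mem_nhds hq)

theorem contDiffAt_locForm {k : ℕ} {η : ℝ → FormField I3 N k} (hη : SmoothFormFamily I3 η)
    (hq : q.2 ∈ (extChartAt I3 x).target) : ContDiffAt ℝ ∞ (locForm η x) q :=
  (hη x).contDiffAt (univ_prod_target_mem_nhds hq)

theorem isNegDef_locBilin (hρ : IsRiemannianFamily I3 ρ) (hq : q.2 ∈ (extChartAt I3 x).target) :
    IsNegDef (locBilin ρ x q) :=
  isNegDef_rep I3 (hρ.2 q.1) hq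

theorem differentiableAt_locStar (hρ : IsRiemannianFamily I3 ρ) (hvol : SmoothFormFamily I3 vol)
    (hf : ContMDiff (𝓘(ℝ, ℝ).prod (𝓡 3)) 𝓘(ℝ, ℝ) ∞ (fun p : ℝ × N => f p.1 p.2))
    (hq : q.2 ∈ (extChartAt I3 x).target) : DifferentiableAt ℝ (locStar ρ vol f x) q := by
  refine differentiableAt_hodge_oneForm (m := 2)
    ((contDiffAt_locBilin hρ hq).differentiableAt (by simp))
    ((eventually_family hq).mono fun _ h => isNegDef_locBilin hρ h)
    ((contDiffAt_locForm hvol hq).differentiableAt (by simp)) (differentiableAt_dT ?_)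
  exact (contDiffAt_locFun hf hq).of_le ENat.LEInfty.out

theorem formRep_star_dFun (hρ : IsRiemannianFamily I3 ρ)
    (hf : ContMDiff (𝓘(ℝ, ℝ).prod (𝓡 3)) 𝓘(ℝ, ℝ) ∞ (fun p : ℝ × N => f p.1 p.2)) {u : ℝ} {z : E3}
    (hz : z ∈ (extChartAt I3 x).target) :
    formRep I3 (starForm I3 (k := 1) (m := 2) (ρ u) (vol u) (dFun I3 (f u))) x z =
      locStar ρ vol f x (u, z) := by
  rw [formRep_starForm (k := 1) (m := 2) hz
    (IsNegDef.isInvertible (hρ.2 u ((extChartAt I3 x).symm z))), formRep_dFun hz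
    ((contMDiff_slice hf u).mdifferentiable (by simp) _), locStar, dT,
    ← fderiv_slice_right (p := (u, z)) ((contDiffAt_locFun hf hz).differentiableAt (by simp))]
  rfl

theorem formRep_omegaForm (hρ : IsRiemannianFamily I3 ρ)
    (hf : ContMDiff (𝓘(ℝ, ℝ).prod (𝓡 3)) 𝓘(ℝ, ℝ) ∞ (fun p : ℝ × N => f p.1 p.2)) {u l : ℝ} {z : E3}
    (hz : z ∈ (extChartAt I3 x).target) :
    formRep I3 (omegaForm ρ vol l f u) x z = (-(1 / l)) • locStar ρ vol f x (u, z) := by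
  rw [← formRep_star_dFun hρ hf hz]
  exact formRep_smul (fun _ => rfl) x z

/-- The minus sign is `(-1)³` from the star of a top form in dimension three. -/
theorem extDeriv_locStar (hρ : IsRiemannianFamily I3 ρ)
    (hvol : ∀ u x, IsVolumeForm (ρ u x) (vol u x))
    (hf : ContMDiff (𝓘(ℝ, ℝ).prod (𝓡 3)) 𝓘(ℝ, ℝ) ∞ (fun p : ℝ × N => f p.1 p.2)) {u c : ℝ}
    (h : ∀ w, starForm I3 (k := 3) (m := 0) (ρ u) (vol u) (dForm I3
      (starForm I3 (k := 1) (m := 2) (ρ u) (vol u) (dFun I3 (f u)))) x w = c) :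
    extDeriv (fun z => locStar ρ vol f x (u, z)) (extChartAt I3 x x) =
      (-c) • locForm vol x (u, extChartAt I3 x x) := by
  have h1 := extDeriv_formRep_of_hodge (I := I3) (k := 2) (vol' := unF I3 (vol u) x)
    (vol := unF I3 (vol u) x) (by simp) (hρ.2 u x) (fun _ => rfl) (hvol u x)
    (T := starForm I3 (k := 1) (m := 2) (ρ u) (vol u) (dFun I3 (f u))) h
  have h2 : (fun z => locStar ρ vol f x (u, z)) =ᶠ[nhds (extChartAt I3 x x)]
      formRep I3 (starForm I3 (k := 1) (m := 2) (ρ u) (vol u) (dFun I3 (f u))) x := by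
    filter_upwards [target_mem_nhds (mem_extChartAt_target (I := I3) x)] with z hz
    exact (formRep_star_dFun hρ hf hz).symm
  rw [h2.extDeriv_eq, h1, locForm, formRep_self]
  norm_num

end LocalData

/-! ### The data on `M` in a chart. -/

section LocalDataM

variable {M : Type*} [TopologicalSpace M] [ChartedSpace E6 M] [IsManifold (𝓡 6) ∞ M]
  {g : BilinField I6 M} {volM : FormField I6 M 6} {ν : FormField I6 M 1} {φ : M → ℝ} {m : M} {y : E6}

/-- A one-form on `M` as a field of covectors in the chart at `m`. -/
def locCov (ν : FormField I6 M 1) (m : M) (y : E6) : E6 →L[ℝ] ℝ := cov (formRep I6 ν m y)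

theorem oneForm_locCov : oneForm (locCov ν m y) = formRep I6 ν m y := oneForm_cov _

/-- The star of a one-form on `M` in the chart at `m`. -/
def locStarM (g : BilinField I6 M) (volM : FormField I6 M 6) (ν : FormField I6 M 1) (m : M)
    (y : E6) : E6 [⋀^Fin 5]→L[ℝ] ℝ :=
  hodge (k := 1) (m := 5) (bilinRep I6 g m y) (formRep I6 volM m y) (oneForm (locCov ν m y))

theorem differentiableAt_locCov (hν : SmoothForm I6 ν) (hy : y ∈ (extChartAt I6 m).target) :
    DifferentiableAt ℝ (locCov ν m) y :=
  cov.differentiableAt.comp y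
    (((hν m).contDiffAt (target_mem_nhds hy)).differentiableAt (by simp))

theorem fderiv_locCov_symm (hν : SmoothForm I6 ν) (hd : dForm I6 ν m = 0) (v w : E6) :
    fderiv ℝ (locCov ν m) (extChartAt I6 m m) v w =
      fderiv ℝ (locCov ν m) (extChartAt I6 m m) w v := by
  refine fderiv_cov_symm (((hν m).contDiffAt (target_mem_nhds (mem_extChartAt_target m))
    ).differentiableAt (by simp)) ?_ v w
  rw [← unF_dForm]
  exact hd

theorem fderiv_eq_locCov (hφ : ContMDiff I6 𝓘(ℝ, ℝ) ∞ φ) {κ : ℝ}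
    (h : ∀ m, dFun I6 φ m = κ • ν m) (hy : y ∈ (extChartAt I6 m).target) :
    fderiv ℝ (fun z => φ ((extChartAt I6 m).symm z)) y = κ • locCov ν m y := by
  have h1 := formRep_dFun hy (hφ.mdifferentiable (by simp) ((extChartAt I6 m).symm y))
  rw [formRep_smul h] at h1
  rw [locCov, ← map_smul, h1, cov_oneForm]

theorem differentiableAt_locStarM (hg : SmoothBilin I6 g) (hneg : ∀ m, IsNegDef (g m))
    (hvol : SmoothForm I6 volM) (hν : SmoothForm I6 ν) (hy : y ∈ (extChartAt I6 m).target) :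
    DifferentiableAt ℝ (locStarM g volM ν m) y :=
  differentiableAt_hodge_oneForm (m := 5)
    (((hg m).contDiffAt (target_mem_nhds hy)).differentiableAt (by simp))
    (Filter.mem_of_superset (target_mem_nhds hy) fun _ h => isNegDef_rep I6 hneg h)
    (((hvol m).contDiffAt (target_mem_nhds hy)).differentiableAt (by simp))
    (differentiableAt_locCov hν hy)

theorem extDeriv_locStarM (hneg : ∀ m, IsNegDef (g m)) (hvol : ∀ m, IsVolumeForm (g m) (volM m))
    {c : ℝ} (h : ∀ w, starForm I6 (k := 6) (m := 0) g volM (dForm I6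
      (starForm I6 (k := 1) (m := 5) g volM ν)) m w = c) :
    extDeriv (locStarM g volM ν m) (extChartAt I6 m m) =
      c • formRep I6 volM m (extChartAt I6 m m) := by
  have h1 := extDeriv_formRep_of_hodge (I := I6) (k := 5) (vol' := unF I6 volM m)
    (vol := unF I6 volM m) (by simp) (hneg m) (fun _ => rfl) (hvol m)
    (T := starForm I6 (k := 1) (m := 5) g volM ν) h
  have h2 : locStarM g volM ν m =ᶠ[nhds (extChartAt I6 m m)]
      formRep I6 (starForm I6 (k := 1) (m := 5) g volM ν) m := by
    filter_upwards [target_mem_nhds (mem_extChartAt_target (I := I6) m)] with z hz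
    rw [formRep_starForm (k := 1) (m := 5) hz (IsNegDef.isInvertible (hneg _)), locStarM,
      oneForm_locCov]
  rw [h2.extDeriv_eq, h1, formRep_self]
  norm_num

end LocalDataM

end Sugra

end

noncomputable section

namespace Sugra

set_option maxSynthPendingDepth 3

/-! ### Closedness and the Maxwell equation on the manifold. -/

section Background

variable {N : Type*} [TopologicalSpace N] [ChartedSpace E3 N] [IsManifold (𝓡 3) ∞ N]
  {M : Type*} [TopologicalSpace M] [ChartedSpace E6 M] [IsManifold (𝓡 6) ∞ M]
  {ρ : ℝ → BilinField I3 N} {vol : ℝ → FormField I3 N 3} {H f : ℝ → N → ℝ}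
  {g : BilinField I6 M} {volM : FormField I6 M 6} {ν : FormField I6 M 1} {φ : M → ℝ}
  {κ l : ℝ} {p : (ℝ × N × ℝ) × M} {y : Tot E3 E6}

/-- The flux form in the chart at `p`. -/
def locFlux (ρ : ℝ → BilinField I3 N) (vol : ℝ → FormField I3 N 3) (f : ℝ → N → ℝ)
    (ν : FormField I6 M 1) (φ : M → ℝ) (l : ℝ) (p : (ℝ × N × ℝ) × M) (y : Tot E3 E6) :
    Tot E3 E6 [⋀^Fin 3]→L[ℝ] ℝ :=
  preFlux (locFun f p.1.2.1 (cuA E3 E6 y) • locForm vol p.1.2.1 (cuA E3 E6 y))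
    ((-(1 / l)) • locStar ρ vol f p.1.2.1 (cuA E3 E6 y)) (locCov ν p.2 (pB E3 E6 y))
    (φ ((extChartAt I6 p.2).symm (pB E3 E6 y)))

theorem formRep_flux (hρ : IsRiemannianFamily I3 ρ)
    (hf : ContMDiff (𝓘(ℝ, ℝ).prod (𝓡 3)) 𝓘(ℝ, ℝ) ∞ (fun p : ℝ × N => f p.1 p.2))
    (hy : y ∈ (extChartAt I11 p).target) :
    formRep I11 (fluxForm φ (alphaForm vol f) (betaForm (omegaForm ρ vol l f)) ν) p y =
      lw (cu E3 E6) (locFlux ρ vol f ν φ l p y) := by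
  rw [formRep_fluxForm _ _ _ _ _ hy (ξ := locCov ν p.2 y.2) oneForm_locCov.symm,
    formRep_omegaForm hρ hf (mem_target_eleven.1 hy).1]
  rfl

theorem dForm_flux (hρ : IsRiemannianFamily I3 ρ)
    (hvols : SmoothFormFamily I3 vol) (hvol : ∀ u x, IsVolumeForm (ρ u x) (vol u x))
    (hf : ContMDiff (𝓘(ℝ, ℝ).prod (𝓡 3)) 𝓘(ℝ, ℝ) ∞ (fun p : ℝ × N => f p.1 p.2))
    (hl : l ≠ 0) (hφ : ContMDiff I6 𝓘(ℝ, ℝ) ∞ φ) (hν : SmoothForm I6 ν)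
    (hdν : ∀ m, dForm I6 ν m = 0) (hφν : ∀ m, dFun I6 φ m = κ • ν m)
    (hN : ∀ u x w, starForm I3 (k := 3) (m := 0) (ρ u) (vol u) (dForm I3
      (starForm I3 (k := 1) (m := 2) (ρ u) (vol u) (dFun I3 (f u)))) x w = κ * l * f u x)
    (p : (ℝ × N × ℝ) × M) :
    dForm I11 (fluxForm φ (alphaForm vol f) (betaForm (omegaForm ρ vol l f)) ν) p = 0 := by
  have hp := mem_extChartAt_target (I := I11) p
  have hx := mem_extChartAt_target (I := I3) p.1.2.1
  have hm := mem_extChartAt_target (I := I6) p.2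
  have he : formRep I11 (fluxForm φ (alphaForm vol f) (betaForm (omegaForm ρ vol l f)) ν) p
      =ᶠ[nhds (extChartAt I11 p p)] fun y => lw (cu E3 E6) (locFlux ρ vol f ν φ l p y) :=
    Filter.mem_of_superset (target_mem_nhds hp) fun y hy => formRep_flux hρ hf hy
  have hy : extChartAt I11 p p = (_ : Tot E3 E6) := extChartAt_eleven p
  refine Eq.trans (unF_dForm (I := I11) _ p) ?_
  rw [he.extDeriv_eq, hy]
  have hfd := (contDiffAt_locFun (q := (p.1.1, extChartAt I3 p.1.2.1 p.1.2.1)) hf hx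
    ).differentiableAt (by simp)
  refine extDeriv_flux (κ := κ) (by simp)
    (a := fun q => locFun f p.1.2.1 q • locForm vol p.1.2.1 q)
    (ψ := fun q => (-(1 / l)) • locStar ρ vol f p.1.2.1 q) (ν := locCov ν p.2)
    (φ := fun z => φ ((extChartAt I6 p.2).symm z))
    (hfd.smul ((contDiffAt_locForm hvols hx).differentiableAt (by simp)))
    ((differentiableAt_locStar hρ hvols hf (q := (p.1.1, extChartAt I3 p.1.2.1 p.1.2.1)) hx
      ).fun_const_smul _)
    (differentiableAt_locCov hν hm) ((contDiffAt_comp_symm hφ hm).differentiableAt (by simp))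
    (fderiv_locCov_symm hν (hdν _)) (fderiv_eq_locCov hφ hφν hm) ?_
  have h1 := extDeriv_locStar hρ hvol hf (hN p.1.1 p.1.2.1)
  refine (extDeriv_fun_smul _ _).trans ?_
  have h2 : (extDeriv (fun z => locStar ρ vol f p.1.2.1 (p.1.1, z))
      (extChartAt I3 p.1.2.1 p.1.2.1)) = _ := h1
  have h3 : locFun f p.1.2.1 (p.1.1, extChartAt I3 p.1.2.1 p.1.2.1) = f p.1.1 p.1.2.1 := by
    rw [locFun, (extChartAt I3 p.1.2.1).left_inv (mem_extChartAt_source _)]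
  change (-(1 / l)) • extDeriv (fun z => locStar ρ vol f p.1.2.1 (p.1.1, z))
      (extChartAt I3 p.1.2.1 p.1.2.1) = κ • (locFun f p.1.2.1 (p.1.1, extChartAt I3 p.1.2.1 p.1.2.1)
      • locForm vol p.1.2.1 (p.1.1, extChartAt I3 p.1.2.1 p.1.2.1))
  -- The factor `-(1 / l)` of `omegaForm` meets `-κ l f` from the star in dimension three, leaving
  -- `κ f`.
  rw [h2, h3, smul_smul, smul_smul]
  congr 1
  field_simp

theorem bilinRep_prod (hy : y ∈ (extChartAt I11 p).target) :
    bilinRep I11 (prodMetric (walker ρ H) g) p y =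
      hF (locBilin ρ p.1.2.1) (locFun H p.1.2.1) (bilinRep I6 g p.2) y :=
  bilinRep_prodMetric ρ H g hy

theorem isInvertible_prodMetric (hρ : IsRiemannianFamily I3 ρ) (hneg : ∀ m, IsNegDef (g m))
    (p : (ℝ × N × ℝ) × M) : (unB I11 (prodMetric (walker ρ H) g) p).IsInvertible := by
  rw [← bilinRep_self, bilinRep_prod (mem_extChartAt_target p)]
  have hp := mem_target_eleven.1 (mem_extChartAt_target (I := I11) p)
  exact hT_isInvertible (isNegDef_locBilin hρ hp.1).isInvertible
    (isNegDef_rep I6 hneg hp.2).isInvertible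

theorem fderiv_slice_locFun
    (hf : ContMDiff (𝓘(ℝ, ℝ).prod (𝓡 3)) 𝓘(ℝ, ℝ) ∞ (fun p : ℝ × N => f p.1 p.2)) {x : N} {u : ℝ}
    {z : E3} (hz : z ∈ (extChartAt I3 x).target) :
    fderiv ℝ (fun z => locFun f x (u, z)) z = dT (locFun f x) (u, z) :=
  fderiv_slice_right (p := (u, z)) ((contDiffAt_locFun hf hz).differentiableAt (by simp))

/-- `hodge_flux` yields an orientation sign separately at every point. Before differentiating, this
sign must be shown constant near the base point. -/
theorem dForm_star_flux (hρ : IsRiemannianFamily I3 ρ)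
    (hvols : SmoothFormFamily I3 vol) (hvol : ∀ u x, IsVolumeForm (ρ u x) (vol u x))
    (hf : ContMDiff (𝓘(ℝ, ℝ).prod (𝓡 3)) 𝓘(ℝ, ℝ) ∞ (fun p : ℝ × N => f p.1 p.2))
    (hg : SmoothBilin I6 g) (hneg : ∀ m, IsNegDef (g m)) (hvolM : IsOrientedVolume I6 g volM)
    (hl : l ≠ 0) (hφ : ContMDiff I6 𝓘(ℝ, ℝ) ∞ φ) (hν : SmoothForm I6 ν)
    (hM : ∀ m w, starForm I6 (k := 6) (m := 0) g volM (dForm I6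
      (starForm I6 (k := 1) (m := 5) g volM ν)) m w = l * φ m)
    {volX : FormField I11 ((ℝ × N × ℝ) × M) 11}
    (hvolX : IsOrientedVolume I11 (prodMetric (walker ρ H) g) volX) (p : (ℝ × N × ℝ) × M) :
    dForm I11 (starForm I11 (k := 4) (m := 7) (prodMetric (walker ρ H) g) volX
      (fluxForm φ (alphaForm vol f) (betaForm (omegaForm ρ vol l f)) ν)) p = 0 := by
  have hp := mem_extChartAt_target (I := I11) p
  have hx := mem_extChartAt_target (I := I3) p.1.2.1
  have hm := mem_extChartAt_target (I := I6) p.2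
  have hnr := fun y (hy : y ∈ (extChartAt I11 p).target) =>
    isNegDef_locBilin (q := cuA E3 E6 y) hρ (mem_target_eleven.1 hy).1
  have hng := fun y (hy : y ∈ (extChartAt I11 p).target) =>
    isNegDef_rep I6 hneg (mem_target_eleven.1 hy).2
  have hvA : ∀ y, IsVolumeForm (locBilin ρ p.1.2.1 (cuA E3 E6 y))
      (locForm vol p.1.2.1 (cuA E3 E6 y)) := fun y => isVolumeForm_rep I3 (hvol _) _ _
  have hvB : ∀ z, IsVolumeForm (bilinRep I6 g p.2 z) (formRep I6 volM p.2 z) :=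
    isVolumeForm_rep I6 hvolM.2 _
  have hvX : ∀ y ∈ (extChartAt I11 p).target, IsVolumeForm (n := 4 + 3 + 4)
      (hT (locBilin ρ p.1.2.1 (cuA E3 E6 y)) (locFun H p.1.2.1 (cuA E3 E6 y))
        (bilinRep I6 g p.2 (pB E3 E6 y))) (formRep I11 volX p y) := fun y hy => by
    have := isVolumeForm_rep I11 hvolX.2 p y
    rw [bilinRep_prod hy] at this
    exact this
  have hflux := fun y (hy : y ∈ (extChartAt I11 p).target) =>
    hodge_flux (k := 4) (by simp) (by simp) (hnr y hy) (hng y hy) (hvA y) (hvB y.2) (hvX y hy)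
  obtain ⟨a, ha⟩ := (hvA (extChartAt I11 p p)).exists_ne_zero (by simp) (hnr _ hp)
  obtain ⟨b, hb⟩ := (hvB (extChartAt I11 p p).2).exists_ne_zero (by simp) (hng _ hp)
  -- With `a` and `b` fixed, the sign is a quotient of continuous functions whose denominator is
  -- nonzero near the base point.
  let t : Tot E3 E6 → ℝ := fun y => formRep I11 volX p y (frame a b) /
    (locForm vol p.1.2.1 (cuA E3 E6 y) a * formRep I6 volM p.2 (pB E3 E6 y) b)
  have hcA : ContinuousAt (fun y : Tot E3 E6 => locForm vol p.1.2.1 (cuA E3 E6 y) a)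
      (extChartAt I11 p p) :=
    (ContinuousAt.comp (f := cuA E3 E6) (contDiffAt_locForm hvols
      (mem_target_eleven.1 hp).1).continuousAt (cuA E3 E6).continuous.continuousAt).eval_const a
  have hcB : ContinuousAt (fun y : Tot E3 E6 => formRep I6 volM p.2 (pB E3 E6 y) b)
      (extChartAt I11 p p) :=
    (ContinuousAt.comp (f := pB E3 E6) ((hvolM.1 p.2).contDiffAt (target_mem_nhds
      (mem_target_eleven.1 hp).2)).continuousAt (pB E3 E6).continuous.continuousAt).eval_const b
  have hcX : ContinuousAt (fun y : Tot E3 E6 => formRep I11 volX p y (frame a b))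
      (extChartAt I11 p p) :=
    ((hvolX.1 p).contDiffAt (target_mem_nhds hp)).continuousAt.eval_const _
  have hct : ContinuousAt t (extChartAt I11 p p) := hcX.div (hcA.mul hcB) (mul_ne_zero ha hb)
  have hne : ∀ᶠ y in nhds (extChartAt I11 p p), locForm vol p.1.2.1 (cuA E3 E6 y) a *
      formRep I6 volM p.2 (pB E3 E6 y) b ≠ 0 :=
    (hcA.mul hcB).eventually_ne (mul_ne_zero ha hb)
  have hτ : ∀ᶠ y in nhds (extChartAt I11 p p), t y ^ 2 = 1 ∧
      formRep I11 (starForm I11 (k := 4) (m := 7) (prodMetric (walker ρ H) g) volX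
        (fluxForm φ (alphaForm vol f) (betaForm (omegaForm ρ vol l f)) ν)) p y =
      (-t y) • lw (cu E3 E6) ((φ ((extChartAt I6 p.2).symm (pB E3 E6 y)) *
          locFun f p.1.2.1 (cu E3 E6 y, pA E3 E6 y)) •
          (formRep I6 volM p.2 (pB E3 E6 y)).compContinuousLinearMap (pB E3 E6) +
        (1 / l) • lw (fderiv ℝ (fun x => locFun f p.1.2.1 (cu E3 E6 y, x)) (pA E3 E6 y) ∘L
          pA E3 E6) ((locStarM g volM ν p.2 (pB E3 E6 y)).compContinuousLinearMap (pB E3 E6))) := by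
    filter_upwards [hne, target_mem_nhds hp] with y hy0 hy
    obtain ⟨τ, hτ2, hτX, hτs⟩ := hflux y hy
    have htτ : t y = τ := (div_eq_iff hy0).2 (hτX a b)
    rw [htτ]
    refine ⟨hτ2, ?_⟩
    have hd : fderiv ℝ (fun x => locFun f p.1.2.1 (cu E3 E6 y, x)) (pA E3 E6 y) =
        dT (locFun f p.1.2.1) (cuA E3 E6 y) := fderiv_slice_locFun hf (mem_target_eleven.1 hy).1
    rw [formRep_starForm (k := 4) (m := 7) hy (isInvertible_prodMetric hρ hneg _),
      formRep_flux hρ hf hy, bilinRep_prod hy, hd]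
    exact hτs _ _ l _ _
  have hconst := eventually_eq_of_sq_eq_one hct (hτ.mono fun _ h => h.1)
  refine Eq.trans (unF_dForm (I := I11) _ p) ?_
  have he : formRep I11 (starForm I11 (k := 4) (m := 7) (prodMetric (walker ρ H) g) volX
        (fluxForm φ (alphaForm vol f) (betaForm (omegaForm ρ vol l f)) ν)) p
      =ᶠ[nhds (extChartAt I11 p p)] fun y =>
      (-t (extChartAt I11 p p)) • lw (cu E3 E6) ((φ ((extChartAt I6 p.2).symm (pB E3 E6 y)) *
          locFun f p.1.2.1 (cu E3 E6 y, pA E3 E6 y)) •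
          (formRep I6 volM p.2 (pB E3 E6 y)).compContinuousLinearMap (pB E3 E6) +
        (1 / l) • lw (fderiv ℝ (fun x => locFun f p.1.2.1 (cu E3 E6 y, x)) (pA E3 E6 y) ∘L
          pA E3 E6) ((locStarM g volM ν p.2 (pB E3 E6 y)).compContinuousLinearMap (pB E3 E6))) := by
    filter_upwards [hτ, hconst] with y h1 h2
    rw [h1.2, h2]
  rw [he.extDeriv_eq]
  have hy : extChartAt I11 p p = (_ : Tot E3 E6) := extChartAt_eleven p
  have hφm : φ ((extChartAt I6 p.2).symm (extChartAt I6 p.2 p.2)) = φ p.2 := by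
    rw [(extChartAt I6 p.2).left_inv (mem_extChartAt_source _)]
  generalize t (extChartAt I11 p p) = τ
  rw [hy]
  refine extDeriv_star_flux (by simp) hl (f := locFun f p.1.2.1)
    (φ := fun z => φ ((extChartAt I6 p.2).symm z)) (volB := formRep I6 volM p.2)
    (μ := locStarM g volM ν p.2)
    ((contDiffAt_locFun (q := (p.1.1, extChartAt I3 p.1.2.1 p.1.2.1)) hf hx).of_le
      ENat.LEInfty.out)
    ((contDiffAt_comp_symm hφ hm).differentiableAt (by simp))
    (((hvolM.1 p.2).contDiffAt (target_mem_nhds hm)).differentiableAt (by simp))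
    (differentiableAt_locStarM hg hneg hvolM.1 hν hm) ?_
  -- In dimension six the top-degree sign is plus, so `d ⋆ ν = λ φ vol_M`.
  have h1 := extDeriv_locStarM hneg hvolM.2 (hM p.2)
  rw [← hφm] at h1
  exact h1

end Background

end Sugra

end

noncomputable section

namespace Sugra

set_option maxSynthPendingDepth 3

/-! ### The Einstein equation and the common form of both cases. -/

section Einstein

variable {N : Type*} [TopologicalSpace N] [ChartedSpace E3 N] [IsManifold (𝓡 3) ∞ N]
  {M : Type*} [TopologicalSpace M] [ChartedSpace E6 M] [IsManifold (𝓡 6) ∞ M]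
  {ρ : ℝ → BilinField I3 N} {vol : ℝ → FormField I3 N 3} {H f : ℝ → N → ℝ}
  {g : BilinField I6 M} {volM : FormField I6 M 6} {ν : FormField I6 M 1} {φ : M → ℝ}
  {κ l : ℝ}

/-- Ricci-flatness of `g` removes the block of `M`; the conditions on `ρ` leave only the Laplacian
of `H` in the trace over `N`. -/
theorem ricci_prodMetric (hρ : IsRiemannianFamily I3 ρ) (hρflat : ∀ u, RicciFlat I3 (ρ u))
    (htrans : TransverseConditions I3 ρ)
    (hH : ContMDiff (𝓘(ℝ, ℝ).prod (𝓡 3)) 𝓘(ℝ, ℝ) ∞ (fun p : ℝ × N => H p.1 p.2))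
    (hg : SmoothBilin I6 g) (hneg : ∀ m, IsNegDef (g m)) (hgflat : RicciFlat I6 g)
    (p : (ℝ × N × ℝ) × M) (v w : Tot E3 E6) :
    ricci I11 (prodMetric (walker ρ H) g) p v w =
      v.1.1 * w.1.1 * (-(1 / 2) * laplace I3 (ρ p.1.1) (H p.1.1) p.1.2.1) := by
  have hp := mem_extChartAt_target (I := I11) p
  have hx := mem_extChartAt_target (I := I3) p.1.2.1
  have hm := mem_extChartAt_target (I := I6) p.2
  have he : bilinRep I11 (prodMetric (walker ρ H) g) p =ᶠ[nhds (extChartAt I11 p p)]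
      hF (locBilin ρ p.1.2.1) (locFun H p.1.2.1) (bilinRep I6 g p.2) :=
    Filter.mem_of_superset (target_mem_nhds hp) fun y hy => bilinRep_prod hy
  have hy : extChartAt I11 p p = (_ : Tot E3 E6) := extChartAt_eleven p
  have hρ2 : ContDiffAt ℝ 2 (locBilin ρ p.1.2.1) (p.1.1, extChartAt I3 p.1.2.1 p.1.2.1) :=
    (contDiffAt_locBilin hρ hx).of_le ENat.LEInfty.out
  have hH2 : ContDiffAt ℝ 2 (locFun H p.1.2.1) (p.1.1, extChartAt I3 p.1.2.1 p.1.2.1) :=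
    (contDiffAt_locFun hH hx).of_le ENat.LEInfty.out
  have hg2 : ContDiffAt ℝ 2 (bilinRep I6 g p.2) (extChartAt I6 p.2 p.2) :=
    ((hg p.2).contDiffAt (target_mem_nhds hm)).of_le ENat.LEInfty.out
  have hn : ∀ᶠ q in nhds (p.1.1, extChartAt I3 p.1.2.1 p.1.2.1),
      IsNegDef (locBilin ρ p.1.2.1 q) :=
    (eventually_family hx).mono fun _ h => isNegDef_locBilin hρ h
  have hgn : ∀ᶠ y in nhds (extChartAt I6 p.2 p.2), IsNegDef (bilinRep I6 g p.2 y) :=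
    Filter.mem_of_superset (target_mem_nhds hm) fun _ h => isNegDef_rep I6 hneg h
  have h6 : ricciLoc (bilinRep I6 g p.2) (extChartAt I6 p.2 p.2) v.2 w.2 = 0 :=
    (ricci_eq g p.2 v.2 w.2).symm.trans (hgflat p.2 v.2 w.2)
  have h3 := (ricci_eq (ρ p.1.1) p.1.2.1 v.1.2.1 w.1.2.1).symm.trans
    (hρflat p.1.1 p.1.2.1 v.1.2.1 w.1.2.1)
  refine (ricci_eq (I := I11) _ p v w).trans ?_
  rw [ricciLoc_congr he, hy]
  refine (ricciLoc_hF hρ2 hH2 hg2 hn hgn v w).trans ?_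
  refine (congrArg₂ (· + ·) (trc_transverse_metric hρ2 hH2 hn (cuA E3 E6 v) (cuA E3 E6 w) h3
    (htrans p.1.1 p.1.2.1).1 (htrans p.1.1 p.1.2.1).2) h6).trans ?_
  rw [add_zero]
  rfl

theorem unF_flux (hρ : IsRiemannianFamily I3 ρ)
    (hf : ContMDiff (𝓘(ℝ, ℝ).prod (𝓡 3)) 𝓘(ℝ, ℝ) ∞ (fun p : ℝ × N => f p.1 p.2))
    (p : (ℝ × N × ℝ) × M) :
    unF I11 (fluxForm φ (alphaForm vol f) (betaForm (omegaForm ρ vol l f)) ν) p =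
      lw (cu E3 E6) (preFlux (f p.1.1 p.1.2.1 • unF I3 (vol p.1.1) p.1.2.1)
        (unF I3 (omegaForm ρ vol l f p.1.1) p.1.2.1) (cov (unF I6 ν p.2)) (φ p.2)) := by
  have hy : extChartAt I11 p p = (_ : Tot E3 E6) := extChartAt_eleven p
  have hx := mem_extChartAt_target (I := I3) p.1.2.1
  rw [← formRep_self, formRep_flux hρ hf (mem_extChartAt_target p), ← formRep_self (I := I3),
    ← formRep_self (I := I3), ← formRep_self (I := I6), formRep_omegaForm hρ hf hx, locFlux, hy]
  have h1 : φ p.2 = φ ((extChartAt I6 p.2).symm (extChartAt I6 p.2 p.2)) := by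
    rw [(extChartAt I6 p.2).left_inv (mem_extChartAt_source _)]
  have h2 : f p.1.1 p.1.2.1 =
      locFun f p.1.2.1 (p.1.1, extChartAt I3 p.1.2.1 p.1.2.1) := by
    rw [locFun, (extChartAt I3 p.1.2.1).left_inv (mem_extChartAt_source _)]
  rw [h1, h2]
  rfl

theorem unB_prodMetric (ρ : ℝ → BilinField I3 N) (H : ℝ → N → ℝ) (g : BilinField I6 M)
    (p : (ℝ × N × ℝ) × M) : unB I11 (prodMetric (walker ρ H) g) p =
      hT (unB I3 (ρ p.1.1) p.1.2.1) (H p.1.1 p.1.2.1) (unB I6 g p.2) := by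
  have hy : extChartAt I11 p p = (_ : Tot E3 E6) := extChartAt_eleven p
  rw [← bilinRep_self, bilinRep_prod (mem_extChartAt_target p), ← bilinRep_self (I := I3),
    ← bilinRep_self (I := I6), hy]
  have h2 : H p.1.1 p.1.2.1 = locFun H p.1.2.1 (p.1.1, extChartAt I3 p.1.2.1 p.1.2.1) := by
    rw [locFun, (extChartAt I3 p.1.2.1).left_inv (mem_extChartAt_source _)]
  rw [h2]
  rfl

theorem formInner_fluxForm_self (hρ : IsRiemannianFamily I3 ρ)
    (hf : ContMDiff (𝓘(ℝ, ℝ).prod (𝓡 3)) 𝓘(ℝ, ℝ) ∞ (fun p : ℝ × N => f p.1 p.2))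
    (hneg : ∀ m, IsNegDef (g m)) (p : (ℝ × N × ℝ) × M) :
    formInner (prodMetric (walker ρ H) g p)
      (fluxForm φ (alphaForm vol f) (betaForm (omegaForm ρ vol l f)) ν p)
      (fluxForm φ (alphaForm vol f) (betaForm (omegaForm ρ vol l f)) ν p) = 0 := by
  change formInner (unB I11 (prodMetric (walker ρ H) g) p)
    (unF I11 (fluxForm φ (alphaForm vol f) (betaForm (omegaForm ρ vol l f)) ν) p)
    (unF I11 (fluxForm φ (alphaForm vol f) (betaForm (omegaForm ρ vol l f)) ν) p) = 0
  rw [unB_prodMetric, unF_flux hρ hf]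
  exact formInner_flux_self _ _ _ _ (IsNegDef.isInvertible (hρ.2 _ _))
    (IsNegDef.isInvertible (hneg _))

/-- The term `f² φ²` is negative because the square norm of the volume form of `ρ` is `(-1) ^ 3`. -/
theorem formInner_iprod_fluxForm (hρ : IsRiemannianFamily I3 ρ)
    (hvol : ∀ u x, IsVolumeForm (ρ u x) (vol u x))
    (hf : ContMDiff (𝓘(ℝ, ℝ).prod (𝓡 3)) 𝓘(ℝ, ℝ) ∞ (fun p : ℝ × N => f p.1 p.2))
    (hneg : ∀ m, IsNegDef (g m)) (p : (ℝ × N × ℝ) × M) (v w : TangentSpace I11 p) :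
    formInner (prodMetric (walker ρ H) g p)
      (iprod v (fluxForm φ (alphaForm vol f) (betaForm (omegaForm ρ vol l f)) ν p))
      (iprod w (fluxForm φ (alphaForm vol f) (betaForm (omegaForm ρ vol l f)) ν p)) =
      cu E3 E6 v * cu E3 E6 w * (formInner (ρ p.1.1 p.1.2.1) (omegaForm ρ vol l f p.1.1 p.1.2.1)
        (omegaForm ρ vol l f p.1.1 p.1.2.1) * formInner (g p.2) (ν p.2) (ν p.2) -
          f p.1.1 p.1.2.1 ^ 2 * φ p.2 ^ 2) := by
  have hr : IsNegDef (unB I3 (ρ p.1.1) p.1.2.1) := hρ.2 _ _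
  have hG : IsNegDef (unB I6 g p.2) := hneg _
  have hv : IsVolumeForm (unB I3 (ρ p.1.1) p.1.2.1) (unF I3 (vol p.1.1) p.1.2.1) := hvol _ _
  change formInner (unB I11 (prodMetric (walker ρ H) g) p)
    (iprod (V := Tot E3 E6) v
      (unF I11 (fluxForm φ (alphaForm vol f) (betaForm (omegaForm ρ vol l f)) ν) p))
    (iprod (V := Tot E3 E6) w
      (unF I11 (fluxForm φ (alphaForm vol f) (betaForm (omegaForm ρ vol l f)) ν) p)) = _
  rw [unB_prodMetric, unF_flux hρ hf]
  refine (formInner_iprod_flux _ _ _ _ hr.isInvertible hr.1 hG.isInvertible hG.1 v w).trans ?_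
  rw [formInner_smul_left, formInner_smul_right, formInner_vol (by simp) hr hv,
    oneForm_cov]
  change cu E3 E6 v * cu E3 E6 w * (φ p.2 ^ 2 * (f p.1.1 p.1.2.1 * (f p.1.1 p.1.2.1 * (-1) ^ 3)) +
    formInner (ρ p.1.1 p.1.2.1) (omegaForm ρ vol l f p.1.1 p.1.2.1)
        (omegaForm ρ vol l f p.1.1 p.1.2.1) * formInner (g p.2) (ν p.2) (ν p.2)) = _
  ring

/-- Covers both cases at once: `κ = 0` is allowed, and `φ` and `ν` are linked only by `dφ = κ ν` and
`⋆ d ⋆ ν = λ φ`. The form equations hold without any condition on `H`, so the equivalence lies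
entirely in the Einstein equation. -/
theorem isBosonicBackground_iff (hρ : IsRiemannianFamily I3 ρ) (hρflat : ∀ u, RicciFlat I3 (ρ u))
    (htrans : TransverseConditions I3 ρ) (hvols : SmoothFormFamily I3 vol)
    (hvol : ∀ u x, IsVolumeForm (ρ u x) (vol u x))
    (hH : ContMDiff (𝓘(ℝ, ℝ).prod (𝓡 3)) 𝓘(ℝ, ℝ) ∞ (fun p : ℝ × N => H p.1 p.2))
    (hf : ContMDiff (𝓘(ℝ, ℝ).prod (𝓡 3)) 𝓘(ℝ, ℝ) ∞ (fun p : ℝ × N => f p.1 p.2))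
    (hg : SmoothBilin I6 g) (hneg : ∀ m, IsNegDef (g m)) (hgflat : RicciFlat I6 g)
    (hvolM : IsOrientedVolume I6 g volM) {volX : FormField I11 ((ℝ × N × ℝ) × M) 11}
    (hvolX : IsOrientedVolume I11 (prodMetric (walker ρ H) g) volX)
    (hl : l ≠ 0) (hφ : ContMDiff I6 𝓘(ℝ, ℝ) ∞ φ) (hν : SmoothForm I6 ν)
    (hdν : ∀ m, dForm I6 ν m = 0) (hφν : ∀ m, dFun I6 φ m = κ • ν m)
    (hN : ∀ u x w, starForm I3 (k := 3) (m := 0) (ρ u) (vol u) (dForm I3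
      (starForm I3 (k := 1) (m := 2) (ρ u) (vol u) (dFun I3 (f u)))) x w = κ * l * f u x)
    (hM : ∀ m w, starForm I6 (k := 6) (m := 0) g volM (dForm I6
      (starForm I6 (k := 1) (m := 5) g volM ν)) m w = l * φ m) :
    IsBosonicBackground I11 (prodMetric (walker ρ H) g) volX
        (fluxForm φ (alphaForm vol f) (betaForm (omegaForm ρ vol l f)) ν) ↔
      ∀ u x m, laplace I3 (ρ u) (H u) x =
        formInner (ρ u x) (omegaForm ρ vol l f u x) (omegaForm ρ vol l f u x) *
          formInner (g m) (ν m) (ν m) - f u x ^ 2 * φ m ^ 2 := by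
  have hR := ricci_prodMetric hρ hρflat htrans hH hg hneg hgflat
  constructor
  · intro hB u x m
    have h0 : ∀ v w : TangentSpace I11 (((u, x, 0), m) : (ℝ × N × ℝ) × M),
        cu E3 E6 v * cu E3 E6 w * (-(1 / 2) * laplace I3 (ρ u) (H u) x) =
        -(1 / 2) * (cu E3 E6 v * cu E3 E6 w *
          (formInner (ρ u x) (omegaForm ρ vol l f u x) (omegaForm ρ vol l f u x) *
            formInner (g m) (ν m) (ν m) - f u x ^ 2 * φ m ^ 2)) := fun v w => by
      have h1 := hB.einstein ((u, x, 0), m) v w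
      rw [formInner_fluxForm_self hρ hf hneg, formInner_iprod_fluxForm hρ hvol hf hneg, mul_zero,
        add_zero] at h1
      exact (hR ((u, x, 0), m) v w).symm.trans h1
    -- Both sides are multiples of `du²`, so the pair `∂_u, ∂_u` extracts everything. The value of
    -- `v` at the chosen point is immaterial.
    have h2 := h0 (eu E3 E6) (eu E3 E6)
    have h3 : cu E3 E6 (eu E3 E6) = 1 := rfl
    erw [h3] at h2
    linarith
  · intro hL
    refine ⟨dForm_flux hρ hvols hvol hf hl hφ hν hdν hφν hN, fun p => ?_, fun p v w => ?_⟩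
    · rw [dForm_star_flux hρ hvols hvol hf hg hneg hvolM hl hφ hν hM hvolX]
      -- The right-hand side of the Maxwell equation vanishes because the flux has the factor `du`.
      have hF := unF_flux (φ := φ) (ν := ν) (l := l) (vol := vol) hρ hf p
      have hw := (congrArg₂ wedge hF hF).trans (wedge_flux_self _ _)
      have hw' : wedge (fluxForm φ (alphaForm vol f) (betaForm (omegaForm ρ vol l f)) ν p)
        (fluxForm φ (alphaForm vol f) (betaForm (omegaForm ρ vol l f)) ν p) = 0 := hw
      rw [hw', smul_zero]
    · rw [formInner_fluxForm_self hρ hf hneg, formInner_iprod_fluxForm hρ hvol hf hneg,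
        ← hL]
      have h : ∀ a b c d : ℝ, a * b * (-(1 / 2) * c) = -(1 / 2) * (a * b * c) + 1 / 6 * d * 0 :=
        fun a b c d => by ring
      generalize prodMetric (walker ρ H) g p v w = d
      have h1 := h (cu E3 E6 v) (cu E3 E6 w) (laplace I3 (ρ p.1.1) (H p.1.1) p.1.2.1) d
      exact (hR p v w).trans h1

end Einstein

end Sugra

end

noncomputable section

namespace Sugra

set_option maxSynthPendingDepth 3

/-! ### Scaling of form operations, and exact one-forms. -/

section Exact

variable {E H : Type*} [NormedAddCommGroup E] [NormedSpace ℝ E] [TopologicalSpace H]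
  {I : ModelWithCorners ℝ E H} {M : Type*} [TopologicalSpace M] [ChartedSpace H M]

theorem starForm_smul [FiniteDimensional ℝ E] {k m : ℕ} {g : BilinField I M}
    {vol : FormField I M (m + k)} {η ζ : FormField I M k} {c : ℝ} (h : ∀ x, ζ x = c • η x) (x : M) :
    starForm I g vol ζ x = c • starForm I g vol η x :=
  (congrArg (hodge (unB I g x) (unF I vol x)) (h x)).trans
    (hodge_smul (unB I g x) (unF I vol x) c (unF I η x))

theorem dForm_smul [IsManifold I 1 M] {k : ℕ} {η ζ : FormField I M k} {c : ℝ}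
    (h : ∀ x, ζ x = c • η x) (x : M) : dForm I ζ x = c • dForm I η x := by
  have h1 : formRep I ζ x = fun y => c • formRep I η x y := funext (formRep_smul h x)
  refine (unF_dForm (I := I) ζ x).trans (Eq.trans ?_ (congrArg (c • ·) (unF_dForm (I := I) η x).symm))
  rw [h1]
  exact extDeriv_fun_smul _ _

theorem oneForm_eq_lw (ξ : E →L[ℝ] ℝ) :
    oneForm ξ = lw ξ (ContinuousAlternatingMap.constOfIsEmpty ℝ E (Fin 0) (1 : ℝ)) := by
  ext v
  simp [oneForm, lw_apply]

variable [I.Boundaryless] [IsManifold I ∞ M] {φ : M → ℝ}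

theorem formRep_dFun_of_contMDiff (hφ : ContMDiff I 𝓘(ℝ, ℝ) ∞ φ) {x : M} {y : E}
    (hy : y ∈ (extChartAt I x).target) : formRep I (dFun I φ) x y =
      oneForm (fderiv ℝ (fun z => φ ((extChartAt I x).symm z)) y) :=
  formRep_dFun hy (hφ.mdifferentiable (by simp) _)

theorem smoothForm_dFun (hφ : ContMDiff I 𝓘(ℝ, ℝ) ∞ φ) : SmoothForm I (dFun I φ) := by
  intro x
  refine ContDiffOn.congr (f := fun y => oneForm (fderiv ℝ (fun z => φ ((extChartAt I x).symm z)) y))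
    (fun y hy => ?_) fun y hy => formRep_dFun_of_contMDiff hφ hy
  refine ContDiffAt.contDiffWithinAt ?_
  have h1 : ContDiffAt ℝ ∞ (fderiv ℝ (fun z => φ ((extChartAt I x).symm z))) y :=
    (contDiffAt_comp_symm hφ hy).fderiv_right (by simp)
  exact (ContinuousAlternatingMap.ofSubsingletonLIE (𝕜 := ℝ) (E := E) (F := ℝ) (0 : Fin 1)
    ).toContinuousLinearEquiv.contDiff.contDiffAt.comp y h1

theorem smoothForm_smul {k : ℕ} {η ζ : FormField I M k} {c : ℝ} (h : ∀ x, ζ x = c • η x)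
    (hη : SmoothForm I η) : SmoothForm I ζ := fun x =>
  ((hη x).const_smul c).congr fun y _ => formRep_smul h x y

/-- A differential is `lw` of it with the constant zero-form `1`; the Leibniz rule for closed
one-forms then needs only the symmetry of the second derivative. -/
theorem dForm_dFun (hφ : ContMDiff I 𝓘(ℝ, ℝ) ∞ φ) (x : M) : dForm I (dFun I φ) x = 0 := by
  have hx := mem_extChartAt_target (I := I) x
  refine (unF_dForm (I := I) (dFun I φ) x).trans ?_
  have he : formRep I (dFun I φ) x =ᶠ[nhds (extChartAt I x x)] fun y =>
      lw (fderiv ℝ (fun z => φ ((extChartAt I x).symm z)) y)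
        (ContinuousAlternatingMap.constOfIsEmpty ℝ E (Fin 0) (1 : ℝ)) :=
    Filter.mem_of_superset (target_mem_nhds hx) fun y hy =>
      (formRep_dFun_of_contMDiff hφ hy).trans (oneForm_eq_lw _)
  have hs := contDiffAt_comp_symm hφ hx
  refine he.extDeriv_eq.trans ?_
  rw [extDeriv_lw (((hs.of_le (n := ∞) (m := 2) ENat.LEInfty.out).fderiv_right (m := 1) (by norm_num)).differentiableAt one_ne_zero)
    (differentiableAt_const _)
    (fun v w => (hs.isSymmSndFDerivAt (by simpa using ENat.LEInfty.out)) v w)]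
  have h0 : extDeriv (fun _ : E => ContinuousAlternatingMap.constOfIsEmpty ℝ E (Fin 0) (1 : ℝ))
      (extChartAt I x x) = 0 := by
    ext v
    rw [extDeriv_apply (differentiableAt_const _)]
    simp
  rw [h0, lw_zero, neg_zero]
  rfl

theorem dFun_const (c : ℝ) (x : M) : dFun I (fun _ : M => c) x = 0 := by
  have h : mvd I (fun _ : M => c) x = 0 := mfderiv_const
  have h1 : unF I (dFun I (fun _ : M => c)) x = oneForm (mvd I (fun _ : M => c) x) := rfl
  refine h1.trans ?_
  rw [h]
  ext v
  rfl

end Exact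

end Sugra

end

/-! ### The two families of backgrounds. -/

theorem mainTheorem10
    {N : Type*} [TopologicalSpace N] [ChartedSpace (EuclideanSpace ℝ (Fin 3)) N]
    [IsManifold (𝓡 3) ∞ N]
    {M : Type*} [TopologicalSpace M] [ChartedSpace (EuclideanSpace ℝ (Fin 6)) M]
    [IsManifold (𝓡 6) ∞ M]
    -- the Ricci-flat Riemannian (negative definite) six-manifold `(M, g)` with its orientation
    (g : Sugra.BilinField (𝓡 6) M) (volM : Sugra.FormField (𝓡 6) M 6)
    (hg : Sugra.SmoothBilin (𝓡 6) g) (hg_neg : ∀ m, Sugra.IsNegDef (g m))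
    (hg_flat : Sugra.RicciFlat (𝓡 6) g)
    (hvolM : Sugra.IsOrientedVolume (𝓡 6) g volM)
    -- the family `ρ(u)` of Ricci-flat Riemannian metrics on `N` with its volume forms
    (ρ : ℝ → Sugra.BilinField (𝓡 3) N) (volρ : ℝ → Sugra.FormField (𝓡 3) N 3)
    (hρ : Sugra.IsRiemannianFamily (𝓡 3) ρ)
    (hρ_flat : ∀ u, Sugra.RicciFlat (𝓡 3) (ρ u))
    (hρ_trans : Sugra.TransverseConditions (𝓡 3) ρ)
    (hvolρ : Sugra.SmoothFormFamily (𝓡 3) volρ)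
    (hvolρ' : ∀ u x, Sugra.IsVolumeForm (ρ u x) (volρ u x))
    -- the functions `H` and `f` on `ℝ × N`
    (H f : ℝ → N → ℝ)
    (hH : ContMDiff (𝓘(ℝ, ℝ).prod (𝓡 3)) 𝓘(ℝ, ℝ) ∞ (fun p : ℝ × N => H p.1 p.2))
    (hf : ContMDiff (𝓘(ℝ, ℝ).prod (𝓡 3)) 𝓘(ℝ, ℝ) ∞ (fun p : ℝ × N => f p.1 p.2))
    -- the orientation of the product
    (volX : Sugra.FormField Sugra.I11 ((ℝ × N × ℝ) × M) 11)
    (hvolX : Sugra.IsOrientedVolume Sugra.I11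
      (Sugra.prodMetric (Sugra.walker ρ H) g) volX) :
    -- the case `κ ≠ 0`
    (∀ (κ l : ℝ), κ ≠ 0 → l ≠ 0 → ∀ φ : M → ℝ, ContMDiff (𝓡 6) 𝓘(ℝ, ℝ) ∞ φ →
      (∀ m, Sugra.starForm (𝓡 6) (k := 6) (m := 0) g volM (Sugra.dForm (𝓡 6)
          (Sugra.starForm (𝓡 6) (k := 1) (m := 5) g volM (Sugra.dFun (𝓡 6) φ))) m
        = Sugra.zeroForm (𝓡 6) (fun m' => κ * l * φ m') m) →
      (∀ u x, Sugra.starForm (𝓡 3) (k := 3) (m := 0) (ρ u) (volρ u) (Sugra.dForm (𝓡 3)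
          (Sugra.starForm (𝓡 3) (k := 1) (m := 2) (ρ u) (volρ u) (Sugra.dFun (𝓡 3) (f u)))) x
        = Sugra.zeroForm (𝓡 3) (fun x' => κ * l * f u x') x) →
      ∀ (η : ℝ → Sugra.FormField (𝓡 3) N 2) (ν : Sugra.FormField (𝓡 6) M 1),
        η = Sugra.omegaForm ρ volρ l f →
        (∀ m, ν m = (1 / κ) • Sugra.dFun (𝓡 6) φ m) →
        (Sugra.IsBosonicBackground Sugra.I11 (Sugra.prodMetric (Sugra.walker ρ H) g) volX
            (Sugra.fluxForm φ (Sugra.alphaForm volρ f) (Sugra.betaForm η) ν) ↔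
          ∀ u x m, Sugra.laplace (𝓡 3) (ρ u) (H u) x =
            Sugra.formInner (ρ u x) (η u x) (η u x) * Sugra.formInner (g m) (ν m) (ν m)
              - f u x ^ 2 * φ m ^ 2)) ∧
    -- the case `κ = 0`, `φ = 1`
    (∀ l : ℝ, l ≠ 0 → ∀ ν : Sugra.FormField (𝓡 6) M 1, Sugra.SmoothForm (𝓡 6) ν →
      (∀ m, Sugra.dForm (𝓡 6) ν m = 0) →
      (∀ m, Sugra.starForm (𝓡 6) (k := 6) (m := 0) g volM (Sugra.dForm (𝓡 6)
          (Sugra.starForm (𝓡 6) (k := 1) (m := 5) g volM ν)) m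
        = Sugra.zeroForm (𝓡 6) (fun _ => l) m) →
      (∀ u x, Sugra.starForm (𝓡 3) (k := 3) (m := 0) (ρ u) (volρ u) (Sugra.dForm (𝓡 3)
          (Sugra.starForm (𝓡 3) (k := 1) (m := 2) (ρ u) (volρ u) (Sugra.dFun (𝓡 3) (f u)))) x
        = 0) →
      ∀ η : ℝ → Sugra.FormField (𝓡 3) N 2, η = Sugra.omegaForm ρ volρ l f →
        (Sugra.IsBosonicBackground Sugra.I11 (Sugra.prodMetric (Sugra.walker ρ H) g) volX
            (Sugra.fluxForm (fun _ => 1) (Sugra.alphaForm volρ f) (Sugra.betaForm η) ν) ↔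
          ∀ u x m, Sugra.laplace (𝓡 3) (ρ u) (H u) x =
            Sugra.formInner (ρ u x) (η u x) (η u x) * Sugra.formInner (g m) (ν m) (ν m)
              - f u x ^ 2) ∧
        (Sugra.IsBosonicBackground Sugra.I11 (Sugra.prodMetric (Sugra.walker ρ H) g) volX
            (Sugra.fluxForm (fun _ => 1) (Sugra.alphaForm volρ f) (Sugra.betaForm η) ν) →
          (∃ u x, η u x ≠ 0) →
          ∃ c : ℝ, ∀ m, Sugra.formInner (g m) (ν m) (ν m) = c)) := by
  refine ⟨fun κ l hκ hl φ hφ hM hN η ν hη hν => ?_, fun l hl ν hν hdν hM hN η hη => ?_⟩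
  · subst hη
    have hdφ : ∀ m, Sugra.dFun (𝓡 6) φ m = κ • ν m := fun m => by
      rw [hν, smul_smul, mul_one_div_cancel hκ, one_smul]
    refine Sugra.isBosonicBackground_iff (κ := κ) hρ hρ_flat hρ_trans hvolρ hvolρ' hH hf hg hg_neg
      hg_flat hvolM hvolX hl hφ (Sugra.smoothForm_smul hν (Sugra.smoothForm_dFun hφ))
      (fun m => ?_) hdφ (fun u x w => ?_) fun m w => ?_
    · rw [Sugra.dForm_smul hν, Sugra.dForm_dFun hφ, smul_zero]
    · rw [hN]
      rfl
    -- The factor `1 / κ` passes through `⋆ d ⋆` and turns `κ λ φ` into `λ φ`.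
    · have h1 := Sugra.starForm_smul (k := 6) (m := 0) (g := g) (vol := volM) (Sugra.dForm_smul
        (Sugra.starForm_smul (k := 1) (m := 5) (g := g) (vol := volM) hν)) m
      rw [h1, hM]
      change 1 / κ * (κ * l * φ m) = l * φ m
      field_simp
  · subst hη
    -- With `κ = 0` and `φ = 1`, the relation `dφ = κ ν` is trivial and the equation for `f` has
    -- zero right-hand side.
    have hiff := Sugra.isBosonicBackground_iff (κ := 0) (φ := fun _ => 1) (ν := ν) hρ hρ_flat
      hρ_trans hvolρ hvolρ' hH hf hg hg_neg hg_flat hvolM hvolX hl contMDiff_const hν hdν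
      (fun m => by rw [Sugra.dFun_const, zero_smul])
      (fun u x w => by rw [hN]; simp) (fun m w => by rw [hM]; exact (mul_one l).symm)
    simp only [one_pow, mul_one] at hiff
    refine ⟨hiff, fun hB hne => ?_⟩
    obtain ⟨u, x, hx⟩ := hne
    have h0 : Sugra.formInner (ρ u x) (Sugra.omegaForm ρ volρ l f u x)
        (Sugra.omegaForm ρ volρ l f u x) ≠ 0 :=
      Sugra.formInner_self_ne_zero (V := Sugra.E3) (hρ.2 u x) hx
    -- At the fixed point `(u, x)` the scalar equation is solved for `‖ν‖²`; the result does not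
    -- involve `m`.
    refine ⟨(Sugra.laplace (𝓡 3) (ρ u) (H u) x + f u x ^ 2) / Sugra.formInner (ρ u x)
      (Sugra.omegaForm ρ volρ l f u x) (Sugra.omegaForm ρ volρ l f u x), fun m => ?_⟩
    rw [eq_div_iff h0, hiff.1 hB u x m]
    ring
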